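/- Let $\mathcal P(\mathbb Z^2)$ be the family of convex hulls of non-empty finite subsets of $\mathbb Z^2$ in $\mathbb R^2$. A function $Z:\mathcal P(\mathbb Z^2)\to\mathbb Q[[x,y]]$ is a valuation if $Z(P\cup Q)+Z(P\cap Q)=Z(P)+Z(Q)$ whenever $P,Q\in\mathcal P(\mathbb Z^2)$ and $P\cup Q$ is convex; it is simple if $Z(P)=0$ whenever $\dim P\le 1$. The group $\mathcal G(\mathbb Z^2)=\mathbb Z^2\rtimes \mathrm{GL}(2,\mathbb Z)$ acts on $\mathcal P(\mathbb Z^2)$ by affine maps, and on $\mathbb Q[[x,y]]$ by $$(\Xi\cdot f)(x,y)=\exp(\alpha x+\beta y)\, f(ax+cy,\,bx+dy)\quad\text{for }\ \Xi(x,y)=(ax+by+\alpha,\ cx+dy+\beta).$$ $Z$ is called equivariant if $Z(\Xi P)=\Xi\cdot Z(P)$ for all $\Xi\in\mathcal G(\mathbb Z^2)$ and $P\in\mathcal P(\mathbb Z^2)$. Let $o=(0,0)$, let $e_1,e_2$ be the standard basis, let $[\,\cdot\,]$ denote the convex hull, and let $T=[e_1,e_2,o]$. Let $D_4\subset \mathrm{GL}(2,\mathbb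 Z)$ be the subgroup generated by $\begin{pmatrix}1&0\\1&-1\end{pmatrix}$ and $\begin{pmatrix}1&-2\\0&-1\end{pmatrix}$, and let $\mathcal V$ be the set of all $D_4$-invariant $\varrho\in\mathbb Q[[x,y]]$ with $$(2x+y)\,\varrho(x,y)=(x+y)\,\varrho(x,x+y)+x\,\varrho(x+y,x).$$ Exponentials are formal power series, and $\frac{e^t-1}{t}=\sum_{n\ge0}\frac{t^n}{(n+1)!}$. For $\varrho\in\mathcal V$ consider $$f_2^{\varrho}(x,y)=\frac{e^x}{y}\cdot\frac{e^{y-x}-1}{y-x}\cdot\varrho(y-x,x)-\frac1y\cdot\frac{e^x-1}{x}\cdot\varrho(x,y-x),$$ and for $f_1\in\mathbb Q[[x,y]]$ put $$B(f_1)(x,y)=\tfrac12 f_1(x,y)+\tfrac12 f_1(y,-x)+\tfrac{e^x}{2}f_1(-x+y,-x).$$ 1. For every equivariant valuation $Z:\mathcal P(\mathbb Z^2)\to\mathbb Q[[x,y]]$, $Z(\{o\})$ is a constant $c\in\mathbb Q$; $f_1:=Z([o,e_1])$ has the form $f_1(x,y)=g(x^2)\exp(\frac12x)$ for some $g\in\mathbb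 Q[[x]]$; and there is a $\varrho\in\mathcal V$ such that $f_2^\varrho\in\mathbb Q[[x,y]]$ and $Z(T)=f_2^\varrho+B(f_1)$. Moreover, $Z=Z_1+Z_2$ for equivariant valuations $Z_1,Z_2$ such that $Z_1(\{o\})=c$, $Z_1([o,e_1])=f_1$, $Z_1(T)=B(f_1)$, and $Z_2$ is simple with $Z_2(T)=f_2^\varrho$. 2. Conversely, for all $c\in\mathbb Q$, $g\in\mathbb Q[[x]]$ and $\varrho\in\mathcal V$, $f_2^\varrho$ is a formal power series, and with $f_1(x,y)=g(x^2)\exp(\frac12x)$ there is an equivariant valuation $Z:\mathcal P(\mathbb Z^2)\to\mathbb Q[[x,y]]$ such that $Z(\{o\})=c$, $Z([o,e_1])=f_1$ and $Z(T)=f_2^\varrho+B(f_1)$. 3. In particular, simple equivariant valuations $Z:\mathcal P(\mathbb Z^2)\to\mathbb Q[[x,y]]$ are in bijective correspondence with the elements $\varrho$ of $\mathcal V$ via $Z(T)=f_2^\varrho$: for every such $Z$ there is exactly one such $\varrho\in\mathcal V$, and for every $\varrho\in\mathcal V$ exactly one such $Z$. -/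

import Mathlib

noncomputable section

namespace LatticeVal

/-- The ring `ℚ[[x,y]]`. -/
abbrev PS : Type := MvPowerSeries (Fin 2) ℚ

/-- The variable `x`. -/
def x : PS := MvPowerSeries.X 0

/-- The variable `y`. -/
def y : PS := MvPowerSeries.X 1

/-- The power series `f(p, q)`. It is used only for `p`, `q` without constant term. -/
def sub (f p q : PS) : PS := MvPowerSeries.subst ![p, q] f

/-- The power series `h(p)` for `h` in one variable. It is used only for `p` without
constant term. -/
def sub1 (h : PowerSeries ℚ) (p : PS) : PS := PowerSeries.subst p h

/-- The power series `exp(p)`. -/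
def expS (p : PS) : PS := sub1 (PowerSeries.exp ℚ) p

/-- The one-variable power series `(e^t - 1) / t = ∑ t^n / (n+1)!`. -/
def expQuot : PowerSeries ℚ := PowerSeries.mk fun n => 1 / (Nat.factorial (n + 1) : ℚ)

/-- The embedding of `ℤ²` in `ℝ²`. -/
def toReal (p : Fin 2 → ℤ) : Fin 2 → ℝ := fun i => (p i : ℝ)

/-- The elements of `𝒫(ℤ²)`: convex hulls of non-empty finite sets of points of `ℤ²`
(points and segments are included). -/
@[ext]
structure LatticePolytope where
  carrier : Set (Fin 2 → ℝ)
  isLattice : ∃ S : Finset (Fin 2 → ℤ), S.Nonempty ∧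
    carrier = convexHull ℝ (toReal '' (S : Set (Fin 2 → ℤ)))

/-- The convex hull of a non-empty finite set of lattice points. -/
def hull (S : Finset (Fin 2 → ℤ)) (hS : S.Nonempty) : LatticePolytope where
  carrier := convexHull ℝ (toReal '' (S : Set (Fin 2 → ℤ)))
  isLattice := ⟨S, hS, rfl⟩

/-- The point `{o}`. -/
def origin : LatticePolytope := hull {0} (by simp)

/-- The segment `[o, e₁]`. -/
def unitSegment : LatticePolytope := hull {0, ![1, 0]} (by simp)

/-- The triangle `T = [e₁, e₂, o]`. -/
def stdTriangle : LatticePolytope := hull {![1, 0], ![0, 1], 0} (by simp)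

/-- The affine map `v ↦ Φ v + w` of `ℝ²`. -/
def affineMap (Φ : Matrix.GeneralLinearGroup (Fin 2) ℤ) (w : Fin 2 → ℤ) (v : Fin 2 → ℝ) : Fin 2 → ℝ :=
  (Φ.1.map (Int.cast : ℤ → ℝ)).mulVec v + toReal w

theorem affineMap_image_hull (Φ : Matrix.GeneralLinearGroup (Fin 2) ℤ) (w : Fin 2 → ℤ) (S : Finset (Fin 2 → ℤ)) :
    affineMap Φ w '' convexHull ℝ (toReal '' (S : Set (Fin 2 → ℤ))) =
      convexHull ℝ (toReal '' ((S.image fun p => Φ.1.mulVec p + w : Finset (Fin 2 → ℤ)) :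
        Set (Fin 2 → ℤ))) := by
  have h := AffineMap.image_convexHull
    ((Matrix.toLin' (Φ.1.map (Int.cast : ℤ → ℝ))).toAffineMap +
      AffineMap.const ℝ (Fin 2 → ℝ) (toReal w)) (toReal '' (S : Set (Fin 2 → ℤ)))
  have hfun : (⇑((Matrix.toLin' (Φ.1.map (Int.cast : ℤ → ℝ))).toAffineMap +
      AffineMap.const ℝ (Fin 2 → ℝ) (toReal w))) = affineMap Φ w := by
    funext v
    simp [affineMap]
  rw [hfun] at h
  rw [h, Finset.coe_image, Set.image_image, Set.image_image]
  congr 1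
  apply Set.image_congr
  intro p _
  funext i
  fin_cases i <;> simp [affineMap, toReal]

/-- The image `Ξ P` of a lattice polytope under `Ξ(v) = Φ v + w` in `𝒢(ℤ²) = ℤ² ⋊ GL(2,ℤ)`. -/
def LatticePolytope.map (Φ : Matrix.GeneralLinearGroup (Fin 2) ℤ) (w : Fin 2 → ℤ) (P : LatticePolytope) :
    LatticePolytope where
  carrier := affineMap Φ w '' P.carrier
  isLattice := by
    obtain ⟨S, hS, hP⟩ := P.isLattice
    exact ⟨S.image fun p => Φ.1.mulVec p + w, hS.image _, by rw [hP, affineMap_image_hull]⟩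

/-- The action of `GL(2,ℤ)` on `ℚ[[x,y]]`: for `Φ = [a b; c d]`,
`(Φ · f)(x, y) = f(a x + c y, b x + d y)`. -/
def linAct (Φ : Matrix.GeneralLinearGroup (Fin 2) ℤ) (f : PS) : PS :=
  sub f ((Φ.1 0 0 : PS) * x + (Φ.1 1 0 : PS) * y) ((Φ.1 0 1 : PS) * x + (Φ.1 1 1 : PS) * y)

/-- The action of `𝒢(ℤ²)` on `ℚ[[x,y]]`: for `Ξ(v) = Φ v + (α, β)`,
`Ξ · f = exp(α x + β y) (Φ · f)`. -/
def affAct (Φ : Matrix.GeneralLinearGroup (Fin 2) ℤ) (w : Fin 2 → ℤ) (f : PS) : PS :=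
  expS ((w 0 : PS) * x + (w 1 : PS) * y) * linAct Φ f

/-- Valuations on `𝒫(ℤ²)`: `Z(P ∪ Q) + Z(P ∩ Q) = Z(P) + Z(Q)` whenever `P ∪ Q` is convex.
In this case `P ∪ Q` and `P ∩ Q` are lattice polytopes; they are named `U` and `I` here. -/
def IsValuation (Z : LatticePolytope → PS) : Prop :=
  ∀ P Q U I : LatticePolytope, Convex ℝ (P.carrier ∪ Q.carrier) →
    U.carrier = P.carrier ∪ Q.carrier → I.carrier = P.carrier ∩ Q.carrier →
    Z U + Z I = Z P + Z Q

/-- `𝒢(ℤ²)` equivariance. -/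
def IsEquivariant (Z : LatticePolytope → PS) : Prop :=
  ∀ (Φ : Matrix.GeneralLinearGroup (Fin 2) ℤ) (w : Fin 2 → ℤ) (P : LatticePolytope), Z (P.map Φ w) = affAct Φ w (Z P)

/-- `𝒢(ℤ²)` equivariant valuations `𝒫(ℤ²) → ℚ[[x,y]]`. -/
def IsEquivariantValuation (Z : LatticePolytope → PS) : Prop :=
  IsValuation Z ∧ IsEquivariant Z

/-- `Z` is simple: it vanishes on lattice polytopes of dimension at most one. -/
def IsSimple (Z : LatticePolytope → PS) : Prop :=
  ∀ P : LatticePolytope, Module.finrank ℝ (vectorSpan ℝ P.carrier) ≤ 1 → Z P = 0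

/-- The matrix `[1 0; 1 -1]`. -/
def genA : Matrix.GeneralLinearGroup (Fin 2) ℤ :=
  ⟨!![1, 0; 1, -1], !![1, 0; 1, -1], by decide, by decide⟩

/-- The matrix `[1 -2; 0 -1]`. -/
def genB : Matrix.GeneralLinearGroup (Fin 2) ℤ :=
  ⟨!![1, -2; 0, -1], !![1, -2; 0, -1], by decide, by decide⟩

/-- The dihedral subgroup `D₄` of `GL(2,ℤ)`. -/
def D4 : Subgroup (Matrix.GeneralLinearGroup (Fin 2) ℤ) := Subgroup.closure {genA, genB}

/-- `ϱ` is a `D₄`-invariant power series with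
`(2x + y) ϱ(x, y) = (x + y) ϱ(x, x + y) + x ϱ(x + y, x)`. -/
def Admissible (ϱ : PS) : Prop :=
  (∀ Φ ∈ D4, linAct Φ ϱ = ϱ) ∧
    (2 * x + y) * ϱ = (x + y) * sub ϱ x (x + y) + x * sub ϱ (x + y) x

/-- `f` is the power series
`(e^x / y) ((e^(y-x) - 1) / (y-x)) ϱ(y-x, x) - (1 / y) ((e^x - 1) / x) ϱ(x, y-x)`,
written with the denominator `y` cleared (`ℚ[[x,y]]` is a domain, so `f` is unique). -/
def IsTriangleSeries (ϱ f : PS) : Prop :=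
  y * f = expS x * sub1 expQuot (y - x) * sub ϱ (y - x) x - sub1 expQuot x * sub ϱ x (y - x)

/-- `½ f₁(x, y) + ½ f₁(y, -x) + ½ e^x f₁(-x + y, -x)`. -/
def boundaryPart (f₁ : PS) : PS :=
  (1 / 2 : ℚ) • f₁ + (1 / 2 : ℚ) • sub f₁ y (-x) + (1 / 2 : ℚ) • (expS x * sub f₁ (-x + y) (-x))

/-- The power series `g(x²) exp(x / 2)`. -/
def segmentSeries (g : PowerSeries ℚ) : PS := sub1 g (x ^ 2) * expS ((1 / 2 : ℚ) • x)

end LatticeVal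

end

/-!
Write `e_v` for the exponential of the linear form of a lattice vector `v` (`expV`, `lin`).

**Unimodular simplices.** Every lattice polygon can be cut into unimodular simplices by steps to
which the valuation property applies: a polygon with at least four vertices is cut along a diagonal,
a triangle of larger area at a lattice point in its boundary or by means of a convex quadrilateral,
and a segment at its lattice points. Hence an equivariant valuation is determined by its values on
`{o}`, `[o, e₁]` and `T` (`IsVal.mem`), and it is simple if and only if the first two vanish
(`IsEquivariantValuation.isSimple_iff`). The value on `{o}` is a constant and the value on `[o, e₁]`
is a power series in `x` because they are invariant under shears; the reflection of the segment
gives `h(t) = e^t h(-t)` for the latter, that is `h(t) = g(t²) e^(t/2)` (`IsSegmentSymm.exists_eq`).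

**Sums over edges.** Valuations are constructed as sums `∑ φ(d) (e_b - e_a)` over the boundary edges
`[a, b]` of a polygon, oriented counterclockwise, where `d` is the primitive direction of the edge
and `φ` has values in the field of fractions of `ℚ[[x,y]]` (`loopSum`). Such a sum is a valuation
for every `φ`, because `a` and `b` are the greatest points of the polygon in linear orders of the
plane and every function of the greatest point is a valuation (`IsTotalCone.isVal`). It is
equivariant if `φ` is equivariant up to the sign of the determinant and up to constants, because the
constants cancel on closed loops (`loopSum_equivariant`). It has values in `ℚ[[x,y]]` if its values
on the unimodular simplices are power series (`exists_equivariantValuation`).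

The function `φ(d) = h(d) / (2 (e_d - 1))` gives the valuation with the value `h` on the unit
segment and `0` at `o`, and a multiple of the sum of `e_p` over all lattice points `p` adjusts the
value at `o` (`IsSegmentSymm.exists_valuation_origin`). This is the summand `Z₁`.

**Simple valuations.** Put `ϱ(x, y) = σ(x, x + y)`. Then `ϱ` is admissible if and only if `σ` is
symmetric, even in each variable, and `F(u, v) = σ(u, v) / (u v)` satisfies `F(u, v) = F(u, u + v) +
F(u + v, v)` (`admissible_iff`). If `Z` is simple, then its value on the unit square, divided by
`((e^x - 1) / x) ((e^y - 1) / y)`, is such a `σ`: the cocycle relation follows from the two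
triangulations of the square, and the formula for `Z(T)` from the cut of a sheared square
(`IsEquivariantValuation.exists_isSymbol`). The series `σ` is recovered from `Z(T)` by adding the
value on the other half of the square (`IsSymbol.eq_of_isTriangleSeries`).

Conversely, `det(u, v) F(u, v)` is a cocycle on the Farey complex, whose vertices are the primitive
vectors up to sign and whose edges are the bases of the lattice. This complex is a tree of
triangles, so that the cocycle has a potential `φ`, which is computed by the Euclidean algorithm
(`IsFareyCocycle.exists_potential`). Since the Farey graph is connected, `φ` is equivariant up to
constants, and the sum over the edges is a simple equivariant valuation with the required value on
`T` (`IsSymbol.exists_valuation`).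
-/

noncomputable section

namespace LatticeVal

/-! ### Substitution of linear forms and exponentials -/

/-- The linear form `v₀ x + v₁ y` attached to a lattice vector `v`. -/
def lin (v : Fin 2 → ℤ) : PS := (v 0 : PS) * x + (v 1 : PS) * y

theorem lin_add (v w : Fin 2 → ℤ) : lin (v + w) = lin v + lin w := by
  simp [lin]; ring

theorem lin_smul (n : ℤ) (v : Fin 2 → ℤ) : lin (n • v) = n * lin v := by
  simp [lin]; ring

theorem lin_neg (v : Fin 2 → ℤ) : lin (-v) = -lin v := by
  simp [lin]; ring

@[simp] theorem lin_zero : lin 0 = 0 := by simp [lin]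

theorem x_eq_lin : x = lin ![1, 0] := by simp [lin]

theorem y_eq_lin : y = lin ![0, 1] := by simp [lin]

@[simp] theorem constantCoeff_lin (v : Fin 2 → ℤ) : MvPowerSeries.constantCoeff (lin v) = 0 := by
  simp [lin, x, y]

theorem lin_ne_zero {v : Fin 2 → ℤ} (hv : v ≠ 0) : lin v ≠ 0 := by
  classical
  intro h
  apply hv
  have key : ∀ i : Fin 2, MvPowerSeries.coeff (Finsupp.single i 1) (lin v) = v i := by
    intro i
    have hc : ∀ n : ℤ, (n : PS) = MvPowerSeries.C (n : ℚ) := fun n => by simp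
    simp only [lin, hc, map_add, MvPowerSeries.coeff_C_mul, x, y, MvPowerSeries.coeff_X]
    fin_cases i <;> simp [Finsupp.single_left_inj]
  funext i
  have := key i
  rw [h] at this
  simpa using this.symm

theorem hasSubst_lin (u v : Fin 2 → ℤ) :
    MvPowerSeries.HasSubst (![lin u, lin v] : Fin 2 → PS) :=
  MvPowerSeries.hasSubst_of_constantCoeff_zero (by intro i; fin_cases i <;> simp)

theorem hasSubst_lin_one (v : Fin 2 → ℤ) : PowerSeries.HasSubst (lin v) :=
  PowerSeries.HasSubst.of_constantCoeff_zero (constantCoeff_lin v)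

/-- Substitution of linear forms, `f ↦ f(u, v)`, as an algebra homomorphism. -/
def linSub (u v : Fin 2 → ℤ) : PS →ₐ[ℚ] PS := MvPowerSeries.substAlgHom (hasSubst_lin u v)

/-- Substitution of a linear form in a power series in one variable. -/
def linSub1 (v : Fin 2 → ℤ) : PowerSeries ℚ →ₐ[ℚ] PS :=
  PowerSeries.substAlgHom (hasSubst_lin_one v)

theorem linSub_eq (u v : Fin 2 → ℤ) (f : PS) : linSub u v f = sub f (lin u) (lin v) := by
  simp [linSub, sub]

theorem linSub1_eq (v : Fin 2 → ℤ) (h : PowerSeries ℚ) : linSub1 v h = sub1 h (lin v) := by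
  simp [linSub1, sub1, PowerSeries.coe_substAlgHom]

theorem linSub_x (u v : Fin 2 → ℤ) : linSub u v x = lin u := by
  exact MvPowerSeries.substAlgHom_X (hasSubst_lin u v) 0

theorem linSub_y (u v : Fin 2 → ℤ) : linSub u v y = lin v := by
  exact MvPowerSeries.substAlgHom_X (hasSubst_lin u v) 1

theorem linSub_lin (u v w : Fin 2 → ℤ) : linSub u v (lin w) = lin (w 0 • u + w 1 • v) := by
  rw [lin_add, lin_smul, lin_smul]
  conv_lhs => rw [lin]
  simp [linSub_x, linSub_y]

theorem linSub_linSub (u v u' v' : Fin 2 → ℤ) (f : PS) :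
    linSub u v (linSub u' v' f) = linSub (u' 0 • u + u' 1 • v) (v' 0 • u + v' 1 • v) f := by
  have h := MvPowerSeries.substAlgHom_comp_substAlgHom_apply (R := ℚ)
    (hasSubst_lin u' v') (hasSubst_lin u v) f
  have e : ∀ (a b : Fin 2 → PS) (ha : MvPowerSeries.HasSubst a) (hb : MvPowerSeries.HasSubst b),
      a = b →
        MvPowerSeries.substAlgHom (R := ℚ) ha f = MvPowerSeries.substAlgHom (R := ℚ) hb f := by
    rintro a b ha hb rfl; rfl
  refine h.trans (e _ _ _ _ ?_)
  funext i
  fin_cases i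
  · exact linSub_lin u v u'
  · exact linSub_lin u v v'

theorem linSub_linSub1 (u v w : Fin 2 → ℤ) (h : PowerSeries ℚ) :
    linSub u v (linSub1 w h) = linSub1 (w 0 • u + w 1 • v) h := by
  have h1 := MvPowerSeries.substAlgHom_comp_substAlgHom_apply (R := ℚ)
    (hasSubst_lin_one w).const (hasSubst_lin u v) h
  have e : ∀ (a b : Unit → PS) (ha : MvPowerSeries.HasSubst a) (hb : MvPowerSeries.HasSubst b),
      a = b →
        MvPowerSeries.substAlgHom (R := ℚ) ha h = MvPowerSeries.substAlgHom (R := ℚ) hb h := by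
    rintro a b ha hb rfl; rfl
  refine h1.trans (e _ _ _ (hasSubst_lin_one _).const ?_)
  funext i
  exact linSub_lin u v w

theorem linSub_id (f : PS) : linSub ![1, 0] ![0, 1] f = f := by
  have h : (![lin ![1, 0], lin ![0, 1]] : Fin 2 → PS) = MvPowerSeries.X := by
    rw [← x_eq_lin, ← y_eq_lin]; funext i; fin_cases i <;> rfl
  rw [linSub_eq, sub, h, MvPowerSeries.subst_self]; rfl

theorem linAct_eq (Φ : Matrix.GeneralLinearGroup (Fin 2) ℤ) (f : PS) :
    linAct Φ f = linSub ![Φ.1 0 0, Φ.1 1 0] ![Φ.1 0 1, Φ.1 1 1] f := by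
  rw [linSub_eq]; rfl

/-- The action of `GL(2,ℤ)` on `ℚ[[x,y]]` by algebra homomorphisms. -/
def linActHom (Φ : Matrix.GeneralLinearGroup (Fin 2) ℤ) : PS →ₐ[ℚ] PS :=
  linSub ![Φ.1 0 0, Φ.1 1 0] ![Φ.1 0 1, Φ.1 1 1]

theorem linActHom_apply (Φ : Matrix.GeneralLinearGroup (Fin 2) ℤ) (f : PS) :
    linActHom Φ f = linAct Φ f := (linAct_eq Φ f).symm

theorem mulVec_eq_smul_add (Φ : Matrix (Fin 2) (Fin 2) ℤ) (w : Fin 2 → ℤ) :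
    w 0 • ![Φ 0 0, Φ 1 0] + w 1 • ![Φ 0 1, Φ 1 1] = Φ.mulVec w := by
  funext i; fin_cases i <;> simp [Matrix.mulVec, dotProduct, Fin.sum_univ_two] <;> ring

theorem linAct_lin (Φ : Matrix.GeneralLinearGroup (Fin 2) ℤ) (w : Fin 2 → ℤ) :
    linAct Φ (lin w) = lin (Φ.1.mulVec w) := by
  rw [linAct_eq, linSub_lin, mulVec_eq_smul_add]

theorem linAct_linSub (Φ : Matrix.GeneralLinearGroup (Fin 2) ℤ) (u v : Fin 2 → ℤ) (f : PS) :
    linAct Φ (linSub u v f) = linSub (Φ.1.mulVec u) (Φ.1.mulVec v) f := by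
  rw [linAct_eq, linSub_linSub, mulVec_eq_smul_add, mulVec_eq_smul_add]

theorem linAct_linSub1 (Φ : Matrix.GeneralLinearGroup (Fin 2) ℤ) (w : Fin 2 → ℤ)
    (h : PowerSeries ℚ) : linAct Φ (linSub1 w h) = linSub1 (Φ.1.mulVec w) h := by
  rw [linAct_eq, linSub_linSub1, mulVec_eq_smul_add]

theorem linAct_mul (Φ Ψ : Matrix.GeneralLinearGroup (Fin 2) ℤ) (f : PS) :
    linAct (Φ * Ψ) f = linAct Φ (linAct Ψ f) := by
  rw [linAct_eq Ψ, linAct_linSub, linAct_eq]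
  have h : ∀ j, ![(Φ * Ψ).1 0 j, (Φ * Ψ).1 1 j] = Φ.1.mulVec ![Ψ.1 0 j, Ψ.1 1 j] := by
    intro j
    funext i
    fin_cases i <;> simp [Matrix.mulVec, dotProduct, Fin.sum_univ_two, Matrix.mul_apply]
  rw [h, h]

theorem linAct_one (f : PS) : linAct 1 f = f := by
  rw [linAct_eq]; simpa using linSub_id f

theorem linAct_injective (Φ : Matrix.GeneralLinearGroup (Fin 2) ℤ) :
    Function.Injective (linAct Φ) := by
  intro f g h
  have := congrArg (linAct Φ⁻¹) h
  simpa [← linAct_mul, linAct_one] using this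

/-- The exponential `exp(v₀ x + v₁ y)` of a lattice vector. -/
def expV (v : Fin 2 → ℤ) : PS := linSub1 v (PowerSeries.exp ℚ)

theorem expS_lin (v : Fin 2 → ℤ) : expS (lin v) = expV v := (linSub1_eq v _).symm

theorem affAct_eq (Φ : Matrix.GeneralLinearGroup (Fin 2) ℤ) (w : Fin 2 → ℤ) (f : PS) :
    affAct Φ w f = expV w * linAct Φ f := by rw [← expS_lin]; rfl

/-- The functional equation of the exponential for power series without constant term. -/
theorem expS_add {p q : PS} (hp : MvPowerSeries.constantCoeff p = 0)
    (hq : MvPowerSeries.constantCoeff q = 0) : expS (p + q) = expS p * expS q := by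
  -- comparison of coefficients for `p = x`, `q = y`, which is the universal case
  have hxy : expS (x + y) = expS x * expS y := by
    ext e
    rw [expS, expS, expS, sub1, sub1, sub1, x, y, PowerSeries.coeff_subst_X_zero_add_X_one,
      PowerSeries.coeff_subst_X_zero_subst_mul_X_one]
    simp only [PowerSeries.coeff_exp, Algebra.algebraMap_self, RingHom.id_apply]
    rw [Nat.choose_symm_add, Nat.add_choose]
    have h0 := Nat.factorial_ne_zero (e 0)
    have h1 := Nat.factorial_ne_zero (e 1)
    have h2 := Nat.factorial_ne_zero (e 0 + e 1)
    rw [Nat.cast_div (Nat.factorial_mul_factorial_dvd_factorial_add _ _) (by positivity)]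
    push_cast
    field_simp
  have hs : MvPowerSeries.HasSubst (![p, q] : Fin 2 → PS) :=
    MvPowerSeries.hasSubst_of_constantCoeff_zero (by intro i; fin_cases i <;> simp [hp, hq])
  have key : ∀ r : PS, MvPowerSeries.constantCoeff r = 0 →
      MvPowerSeries.substAlgHom hs (expS r) = expS (MvPowerSeries.substAlgHom hs r) := by
    intro r hr
    have hr' : PowerSeries.HasSubst r := PowerSeries.HasSubst.of_constantCoeff_zero hr
    have := MvPowerSeries.subst_comp_subst_apply (R := ℚ) hr'.const hs (PowerSeries.exp ℚ)
    rw [MvPowerSeries.coe_substAlgHom]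
    exact this
  have h := congrArg (MvPowerSeries.substAlgHom (R := ℚ) hs) hxy
  have hx : MvPowerSeries.substAlgHom (R := ℚ) hs x = p := MvPowerSeries.substAlgHom_X hs 0
  have hy : MvPowerSeries.substAlgHom (R := ℚ) hs y = q := MvPowerSeries.substAlgHom_X hs 1
  rwa [map_mul, key _ (by simp [x, y]), key _ (by simp [x]), key _ (by simp [y]), map_add,
    hx, hy] at h

theorem expV_add (v w : Fin 2 → ℤ) : expV (v + w) = expV v * expV w := by
  rw [← expS_lin, ← expS_lin, ← expS_lin, lin_add, expS_add (by simp) (by simp)]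

theorem constantCoeff_linSub1 (v : Fin 2 → ℤ) (h : PowerSeries ℚ) :
    MvPowerSeries.constantCoeff (linSub1 v h) = PowerSeries.constantCoeff h := by
  have h0 := PowerSeries.constantCoeff_subst_eq_zero (constantCoeff_lin v)
    (h - PowerSeries.C (PowerSeries.constantCoeff h)) (by simp)
  rw [PowerSeries.subst_sub (hasSubst_lin_one v), PowerSeries.subst_C, map_sub, sub_eq_zero] at h0
  rw [linSub1_eq, sub1, h0, MvPowerSeries.constantCoeff_C]

@[simp] theorem expV_zero : expV 0 = 1 := by
  have h := expV_add 0 0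
  rw [add_zero] at h
  have hne : expV 0 ≠ 0 := by
    intro h0
    have := congrArg MvPowerSeries.constantCoeff h0
    rw [expV, constantCoeff_linSub1] at this
    simp at this
  exact (mul_eq_left₀ hne).mp h.symm

theorem linAct_expV (Φ : Matrix.GeneralLinearGroup (Fin 2) ℤ) (v : Fin 2 → ℤ) :
    linAct Φ (expV v) = expV (Φ.1.mulVec v) := linAct_linSub1 _ _ _

theorem X_mul_expQuot : PowerSeries.X * expQuot = PowerSeries.exp ℚ - 1 := by
  ext n
  cases n with
  | zero => simp
  | succ n => simp [PowerSeries.coeff_succ_X_mul, expQuot, PowerSeries.coeff_exp,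
      PowerSeries.coeff_one]

theorem linSub1_X (v : Fin 2 → ℤ) : linSub1 v PowerSeries.X = lin v :=
  PowerSeries.substAlgHom_X _

/-- The identity `t · (e^t - 1) / t = e^t - 1` at the linear form of `v`. -/
theorem lin_mul_expQuot (v : Fin 2 → ℤ) : lin v * linSub1 v expQuot = expV v - 1 := by
  have := congrArg (linSub1 v) X_mul_expQuot
  rwa [map_mul, linSub1_X, map_sub, map_one] at this

theorem isUnit_linSub1_expQuot (v : Fin 2 → ℤ) : IsUnit (linSub1 v expQuot) := by
  rw [MvPowerSeries.isUnit_iff_constantCoeff, constantCoeff_linSub1]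
  simp [expQuot]

theorem expV_sub_one_ne_zero {v : Fin 2 → ℤ} (hv : v ≠ 0) : expV v - 1 ≠ 0 := by
  rw [← lin_mul_expQuot]
  exact mul_ne_zero (lin_ne_zero hv) (isUnit_linSub1_expQuot v).ne_zero

/-! ### Cutting lattice polytopes along lines -/

/-- The convex hull of a finite set of lattice points. -/
def latHull (S : Finset (Fin 2 → ℤ)) : Set (Fin 2 → ℝ) :=
  convexHull ℝ (toReal '' (S : Set (Fin 2 → ℤ)))

/-- The determinant of two lattice vectors. -/
def crs (d p : Fin 2 → ℤ) : ℤ := d 0 * p 1 - d 1 * p 0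

/-- The linear functional `x ↦ det(d, x)` on `ℝ²`. -/
def crsL (d : Fin 2 → ℤ) : (Fin 2 → ℝ) →ₗ[ℝ] ℝ :=
  (d 0 : ℝ) • LinearMap.proj 1 - (d 1 : ℝ) • LinearMap.proj 0

theorem crsL_apply (d : Fin 2 → ℤ) (p : Fin 2 → ℝ) : crsL d p = d 0 * p 1 - d 1 * p 0 := by
  simp [crsL]

theorem crsL_toReal (d p : Fin 2 → ℤ) : crsL d (toReal p) = crs d p := by
  simp [crsL_apply, crs, toReal]

theorem toReal_injective : Function.Injective toReal := by
  intro p q h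
  funext i
  have := congrFun h i
  simpa [toReal] using this

theorem toReal_mem_latHull {S : Finset (Fin 2 → ℤ)} {p : Fin 2 → ℤ} (hp : p ∈ S) :
    toReal p ∈ latHull S :=
  subset_convexHull ℝ _ ⟨p, hp, rfl⟩

theorem convex_latHull (S : Finset (Fin 2 → ℤ)) : Convex ℝ (latHull S) := convex_convexHull ℝ _

theorem latHull_subset {S : Finset (Fin 2 → ℤ)} {C : Set (Fin 2 → ℝ)} (hC : Convex ℝ C)
    (h : ∀ s ∈ S, toReal s ∈ C) : latHull S ⊆ C := by
  refine convexHull_min ?_ hC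
  rintro _ ⟨s, hs, rfl⟩
  exact h s hs

theorem latHull_mono {S T : Finset (Fin 2 → ℤ)} (h : S ⊆ T) : latHull S ⊆ latHull T :=
  latHull_subset (convex_latHull T) fun _ hs => toReal_mem_latHull (h hs)

theorem le_crsL_of_mem {S : Finset (Fin 2 → ℤ)} {d : Fin 2 → ℤ} {c : ℤ}
    (h : ∀ s ∈ S, c ≤ crs d s) {p : Fin 2 → ℝ} (hp : p ∈ latHull S) : (c : ℝ) ≤ crsL d p :=
  latHull_subset (C := {p | (c : ℝ) ≤ crsL d p}) (convex_halfSpace_ge (crsL d).isLinear _)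
    (fun s hs => by simpa [crsL_toReal] using h s hs) hp

theorem latHull_pair (a b : Fin 2 → ℤ) : latHull {a, b} = segment ℝ (toReal a) (toReal b) := by
  rw [latHull, ← convexHull_pair]
  simp [Set.image_pair]

/-- The part of the convex hull of `S` in a half-space is the convex hull of the points of `S` in
this half-space, if it contains the intersection of the convex hull of `S` with the boundary. -/
theorem convexHull_inter_halfSpace {V : Type*} [AddCommGroup V] [Module ℝ V] (S : Set V)
    (f : V →ₗ[ℝ] ℝ) (c : ℝ)
    (h : ∀ p ∈ convexHull ℝ S, f p = c → p ∈ convexHull ℝ (S ∩ {s | c ≤ f s})) :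
    convexHull ℝ S ∩ {p | c ≤ f p} = convexHull ℝ (S ∩ {s | c ≤ f s}) := by
  apply Set.Subset.antisymm
  · rintro p ⟨hp, hfp⟩
    have hS : S = (S ∩ {s | c ≤ f s}) ∪ (S ∩ {s | f s < c}) := by
      rw [← Set.inter_union_distrib_left]
      ext s; simp [le_or_gt]
    rcases (S ∩ {s | f s < c}).eq_empty_or_nonempty with hE | hE
    · rw [hE, Set.union_empty] at hS
      rwa [← hS]
    rcases (S ∩ {s | c ≤ f s}).eq_empty_or_nonempty with hE' | hE'
    · rw [hE', Set.empty_union] at hS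
      have : convexHull ℝ S ⊆ {s | f s < c} :=
        convexHull_min (by rw [hS]; exact Set.inter_subset_right)
          (convex_halfSpace_lt f.isLinear c)
      exact absurd (show f p < c from this hp) (not_lt.mpr hfp)
    have hp' := hp
    rw [hS, convexHull_union hE' hE, mem_convexJoin] at hp'
    obtain ⟨r, hr, t, ht, hpt⟩ := hp'
    have hfr : c ≤ f r := convexHull_min (t := {s | c ≤ f s}) Set.inter_subset_right
      (convex_halfSpace_ge f.isLinear c) hr
    have hft : f t < c := convexHull_min (t := {s | f s < c}) Set.inter_subset_right
      (convex_halfSpace_lt f.isLinear c) ht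
    obtain ⟨s, hs, rfl⟩ := (segment_eq_image_lineMap ℝ r t ▸ hpt :
      p ∈ AffineMap.lineMap r t '' Set.Icc (0 : ℝ) 1)
    have hpos : 0 < f r - f t := by linarith
    -- the parameter at which the segment from `r` to `t` crosses the line
    set τ := (f r - c) / (f r - f t) with hτ
    have hτm : τ * (f r - f t) = f r - c := by rw [hτ]; field_simp
    have hfl : ∀ u : ℝ, f (AffineMap.lineMap r t u) = f r - u * (f r - f t) := by
      intro u
      simp [AffineMap.lineMap_apply]; ring
    have hsτ : s ≤ τ := by
      have : c ≤ f r - s * (f r - f t) := hfl s ▸ hfp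
      by_contra hlt
      push Not at hlt
      nlinarith
    have hτ0 : 0 ≤ τ := hs.1.trans hsτ
    have hτ1 : τ ≤ 1 := by rw [hτ, div_le_one hpos]; linarith
    have hz : AffineMap.lineMap r t τ ∈ convexHull ℝ (S ∩ {s | c ≤ f s}) := by
      apply h
      · exact (convex_convexHull ℝ S).lineMap_mem
          (convexHull_mono Set.inter_subset_left hr) (convexHull_mono Set.inter_subset_left ht)
          ⟨hτ0, hτ1⟩
      · rw [hfl, hτm]; ring
    rcases hτ0.eq_or_lt with h0 | h0
    · have : s = 0 := le_antisymm (h0 ▸ hsτ) hs.1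
      simpa [this] using hr
    · have : AffineMap.lineMap r t s = AffineMap.lineMap r (AffineMap.lineMap r t τ) (s / τ) := by
        simp only [AffineMap.lineMap_apply, vsub_eq_sub, vadd_eq_add, add_sub_cancel_right,
          smul_smul]
        rw [div_mul_cancel₀ _ h0.ne']
      rw [this]
      exact (convex_convexHull ℝ _).lineMap_mem hr hz
        ⟨div_nonneg hs.1 hτ0, (div_le_one h0).mpr hsτ⟩
  · intro p hp
    exact ⟨convexHull_mono Set.inter_subset_left hp,
      convexHull_min (t := {s | c ≤ f s}) Set.inter_subset_right
        (convex_halfSpace_ge f.isLinear c) hp⟩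

theorem latHull_inter_le {S : Finset (Fin 2 → ℤ)} {d : Fin 2 → ℤ} {c : ℤ}
    (h : ∀ p ∈ latHull S, crsL d p = c → p ∈ latHull (S.filter fun s => c ≤ crs d s)) :
    latHull S ∩ {p | (c : ℝ) ≤ crsL d p} = latHull (S.filter fun s => c ≤ crs d s) := by
  have hS : toReal '' ((S.filter fun s => c ≤ crs d s : Finset _) : Set (Fin 2 → ℤ)) =
      toReal '' (S : Set (Fin 2 → ℤ)) ∩ {s | (c : ℝ) ≤ crsL d s} := by
    ext p
    constructor
    · rintro ⟨s, hs, rfl⟩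
      rw [Finset.mem_coe, Finset.mem_filter] at hs
      exact ⟨⟨s, hs.1, rfl⟩, by simpa [crsL_toReal] using hs.2⟩
    · rintro ⟨⟨s, hs, rfl⟩, hc⟩
      refine ⟨s, ?_, rfl⟩
      rw [Finset.mem_coe, Finset.mem_filter]
      exact ⟨hs, by simpa [crsL_toReal] using hc⟩
  unfold latHull at h ⊢
  rw [hS] at h ⊢
  exact convexHull_inter_halfSpace _ _ _ h

theorem crsL_neg (d : Fin 2 → ℤ) (p : Fin 2 → ℝ) : crsL (-d) p = -crsL d p := by
  simp [crsL_apply]; ring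

theorem crs_neg_left (d p : Fin 2 → ℤ) : crs (-d) p = -crs d p := by
  simp [crs]; ring

theorem latHull_inter_ge {S : Finset (Fin 2 → ℤ)} {d : Fin 2 → ℤ} {c : ℤ}
    (h : ∀ p ∈ latHull S, crsL d p = c → p ∈ latHull (S.filter fun s => crs d s ≤ c)) :
    latHull S ∩ {p | crsL d p ≤ c} = latHull (S.filter fun s => crs d s ≤ c) := by
  have := latHull_inter_le (S := S) (d := -d) (c := -c)
  simp only [crsL_neg, crs_neg_left, neg_le_neg_iff, Int.cast_neg, neg_inj] at this
  exact this h

/-- The valuation property for functions on lattice polytopes with values in an additive group. The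
union `U` of `P` and `Q` is convex because it is a lattice polytope. -/
def IsVal {A : Type*} [AddCommGroup A] (Z : LatticePolytope → A) : Prop :=
  ∀ P Q U I : LatticePolytope, U.carrier = P.carrier ∪ Q.carrier →
    I.carrier = P.carrier ∩ Q.carrier → Z U + Z I = Z P + Z Q

theorem LatticePolytope.convex (P : LatticePolytope) : Convex ℝ P.carrier := by
  obtain ⟨S, -, h⟩ := P.isLattice
  rw [h]; exact convex_convexHull ℝ _

theorem isVal_iff (Z : LatticePolytope → PS) : IsVal Z ↔ IsValuation Z :=
  ⟨fun h P Q U I _ => h P Q U I, fun h P Q U I hU => h P Q U I (hU ▸ U.convex) hU⟩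

section Cut

variable {A : Type*} [AddCommGroup A] {Z : LatticePolytope → A}

/-- A valuation on the convex hull of `S` that is cut along the line `det(d, ·) = c`, if this line
meets the convex hull of `S` in the convex hull of a subset `T` of `S`. -/
theorem IsVal.cut (hZ : IsVal Z) {S T : Finset (Fin 2 → ℤ)} (hTS : T ⊆ S)
    (d : Fin 2 → ℤ) (c : ℤ) (hTc : ∀ t ∈ T, crs d t = c)
    (h : ∀ p ∈ latHull S, crsL d p = c → p ∈ latHull T) :
    ∀ P L R I : LatticePolytope, P.carrier = latHull S →
      L.carrier = latHull (S.filter fun s => c ≤ crs d s) →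
      R.carrier = latHull (S.filter fun s => crs d s ≤ c) → I.carrier = latHull T →
      Z P + Z I = Z L + Z R := by
  intro P L R I hP hL hR hI
  have hTL : T ⊆ S.filter fun s => c ≤ crs d s := fun t ht =>
    Finset.mem_filter.mpr ⟨hTS ht, (hTc t ht).ge⟩
  have hTR : T ⊆ S.filter fun s => crs d s ≤ c := fun t ht =>
    Finset.mem_filter.mpr ⟨hTS ht, (hTc t ht).le⟩
  have h1 := latHull_inter_le (S := S) (d := d) (c := c)
    fun p hp hc => latHull_mono hTL (h p hp hc)
  have h2 := latHull_inter_ge (S := S) (d := d) (c := c)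
    fun p hp hc => latHull_mono hTR (h p hp hc)
  apply hZ L R P I
  · rw [hP, hL, hR, ← h1, ← h2, ← Set.inter_union_distrib_left]
    refine (Set.inter_eq_left.mpr fun p _ => ?_).symm
    exact le_total (c : ℝ) (crsL d p)
  · rw [hI, hL, hR, ← h1, ← h2]
    apply Set.Subset.antisymm
    · intro p hp
      have hc : crsL d p = c := by
        have := latHull_subset (C := {p | crsL d p = c})
          (convex_hyperplane (crsL d).isLinear _)
          (fun t ht => by simp [crsL_toReal, hTc t ht]) hp
        exact this
      exact ⟨⟨latHull_mono hTS hp, hc.ge⟩, ⟨latHull_mono hTS hp, hc.le⟩⟩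
    · rintro p ⟨⟨hp, h3⟩, ⟨-, h4⟩⟩
      exact h p hp (le_antisymm h4 h3)

end Cut

/-- A point of `ℝ²` on the line through two lattice points. -/
theorem exists_of_crsL_eq {u v : Fin 2 → ℤ} (huv : u ≠ v) {p : Fin 2 → ℝ}
    (h : crsL (v - u) p = crs (v - u) u) :
    ∃ t : ℝ, p = toReal u + t • (toReal v - toReal u) := by
  have h' : ((v 0 : ℝ) - u 0) * p 1 - (v 1 - u 1) * p 0 =
      (v 0 - u 0) * u 1 - (v 1 - u 1) * u 0 := by
    have := h
    simp only [crsL_apply, crs, Pi.sub_apply] at this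
    push_cast at this
    exact this
  by_cases h0 : v 0 = u 0
  · have h1 : v 1 ≠ u 1 := by
      intro h1; apply huv; funext i; fin_cases i
      · exact h0.symm
      · exact h1.symm
    have h1' : (v 1 : ℝ) - u 1 ≠ 0 := sub_ne_zero.mpr (by exact_mod_cast h1)
    refine ⟨(p 1 - u 1) / (v 1 - u 1), ?_⟩
    rw [h0] at h'
    funext i
    fin_cases i
    · simp [toReal, h0]
      have : ((v 1 : ℝ) - u 1) * (p 0 - u 0) = 0 := by linarith
      rcases mul_eq_zero.mp this with h | h
      · exact absurd h h1'
      · linarith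
    · simp [toReal]; field_simp; ring
  · have h0' : (v 0 : ℝ) - u 0 ≠ 0 := sub_ne_zero.mpr (by exact_mod_cast h0)
    refine ⟨(p 0 - u 0) / (v 0 - u 0), ?_⟩
    funext i
    fin_cases i
    · simp [toReal]; field_simp; ring
    · simp [toReal]; field_simp; linarith

theorem crsL_add_smul (d u v : Fin 2 → ℤ) (t : ℝ) :
    crsL d (toReal u + t • (toReal v - toReal u)) = crs d u + t * (crs d v - crs d u) := by
  rw [map_add, map_smul, map_sub, crsL_toReal, crsL_toReal, smul_eq_mul]

theorem mem_latHull_pair_of_param {u v : Fin 2 → ℤ} {t : ℝ} (h0 : 0 ≤ t) (h1 : t ≤ 1) :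
    toReal u + t • (toReal v - toReal u) ∈ latHull {u, v} := by
  rw [latHull_pair, segment_eq_image']
  exact ⟨t, ⟨h0, h1⟩, rfl⟩

/-- A line through lattice points `u` and `v` meets a convex lattice polygon in the segment `[u, v]`
if there are half-planes that contain the polygon and have `u`, respectively `v`, in their boundary
and `v`, respectively `u`, in their interior. -/
theorem mem_latHull_pair_of_line {S : Finset (Fin 2 → ℤ)} {u v : Fin 2 → ℤ} (d e : Fin 2 → ℤ)
    (hd : ∀ s ∈ S, crs d u ≤ crs d s) (hdv : crs d u < crs d v)
    (he : ∀ s ∈ S, crs e v ≤ crs e s) (heu : crs e v < crs e u)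
    (p : Fin 2 → ℝ) (hp : p ∈ latHull S) (h : crsL (v - u) p = crs (v - u) u) :
    p ∈ latHull {u, v} := by
  have huv : u ≠ v := by rintro rfl; exact lt_irrefl _ hdv
  obtain ⟨t, rfl⟩ := exists_of_crsL_eq huv h
  have h1 := le_crsL_of_mem hd hp
  have h2 := le_crsL_of_mem he hp
  rw [crsL_add_smul] at h1 h2
  have hdv' : (crs d u : ℝ) < crs d v := by exact_mod_cast hdv
  have heu' : (crs e v : ℝ) < crs e u := by exact_mod_cast heu
  apply mem_latHull_pair_of_param <;> nlinarith

/-! ### Lattice segments -/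

theorem exists_smul_of_crs_eq_zero {g w : Fin 2 → ℤ} (hg : IsCoprime (g 0) (g 1))
    (h : crs g w = 0) : ∃ i : ℤ, w = i • g := by
  obtain ⟨m, n, hmn⟩ := hg
  refine ⟨m * w 0 + n * w 1, ?_⟩
  unfold crs at h
  funext i
  fin_cases i
  · simp; linear_combination (-w 0) * hmn - n * h
  · simp; linear_combination (-w 1) * hmn + m * h

theorem exists_primitive {w : Fin 2 → ℤ} (hw : w ≠ 0) :
    ∃ (g : Fin 2 → ℤ) (k : ℤ), IsCoprime (g 0) (g 1) ∧ 0 < k ∧ w = k • g := by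
  have h : 0 < Int.gcd (w 0) (w 1) := by
    rw [Int.gcd_pos_iff]
    by_contra hc
    push Not at hc
    exact hw (by funext i; fin_cases i; exacts [hc.1, hc.2])
  refine ⟨![w 0 / Int.gcd (w 0) (w 1), w 1 / Int.gcd (w 0) (w 1)], Int.gcd (w 0) (w 1), ?_,
    by exact_mod_cast h, ?_⟩
  · simpa using Int.isCoprime_iff_gcd_eq_one.mpr (Int.gcd_div_gcd_div_gcd h)
  · funext i
    fin_cases i
    · simp [Int.mul_ediv_cancel' (Int.gcd_dvd_left (w 0) (w 1))]
    · simp [Int.mul_ediv_cancel' (Int.gcd_dvd_right (w 0) (w 1))]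

/-- Collinear lattice points span a segment, which is written with a primitive direction `g`. -/
theorem exists_segment_of_collinear {S : Finset (Fin 2 → ℤ)} (hS : S.Nonempty)
    (h : ∀ s ∈ S, ∀ t ∈ S, ∀ r ∈ S, crs (t - s) (r - s) = 0) :
    ∃ (a g : Fin 2 → ℤ) (k : ℕ), IsCoprime (g 0) (g 1) ∧
      latHull S = latHull {a, a + (k : ℤ) • g} := by
  obtain ⟨s, hs⟩ := hS
  by_cases hall : ∀ t ∈ S, t = s
  · refine ⟨s, ![1, 0], 0, by simpa using isCoprime_one_left, ?_⟩
    have : S = {s} := by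
      ext t; simp only [Finset.mem_singleton]
      exact ⟨hall t, fun h => h ▸ hs⟩
    simp [this]
  push Not at hall
  obtain ⟨t, ht, hts⟩ := hall
  obtain ⟨g, k, hg, hk, hgk⟩ := exists_primitive (sub_ne_zero.mpr hts)
  have hpar : ∀ r ∈ S, ∃ i : ℤ, r = s + i • g := by
    intro r hr
    have h0 : crs g (r - s) = 0 := by
      have := h s hs t ht r hr
      rw [hgk] at this
      have h2 : k * crs g (r - s) = 0 := by
        rw [← this]; simp only [crs, Pi.smul_apply, smul_eq_mul]; ring
      exact (mul_eq_zero.mp h2).resolve_left hk.ne'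
    obtain ⟨i, hi⟩ := exists_smul_of_crs_eq_zero hg h0
    exact ⟨i, by rw [← hi]; abel⟩
  choose! i hi using hpar
  obtain ⟨p, hp, hpmin⟩ := S.exists_min_image i ⟨s, hs⟩
  obtain ⟨q, hq, hqmax⟩ := S.exists_max_image i ⟨s, hs⟩
  have hpq := hpmin q hq
  have hq' : q = p + ((i q - i p).toNat : ℤ) • g := by
    rw [Int.toNat_of_nonneg (by omega), sub_smul, eq_sub_of_add_eq' (hi q hq).symm,
      eq_sub_of_add_eq' (hi p hp).symm]
    abel
  refine ⟨p, g, (i q - i p).toNat, hg, ?_⟩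
  rw [← hq']
  apply Set.Subset.antisymm
  · refine latHull_subset (convex_latHull _) fun r hr => ?_
    have h1 := hpmin r hr
    have h2 := hqmax r hr
    rcases hpq.eq_or_lt with h3 | h3
    · have : r = p := by
        have h4 : i r = i p := by omega
        rw [hi r hr, hi p hp, h4]
      rw [this]; exact toReal_mem_latHull (by simp)
    · have h3' : (0 : ℝ) < i q - i p := by
        rw [sub_pos]; exact_mod_cast h3
      have h1' : (i p : ℝ) ≤ i r := by exact_mod_cast h1
      have h2' : (i r : ℝ) ≤ i q := by exact_mod_cast h2
      have : toReal r = toReal p + (((i r : ℝ) - i p) / (i q - i p)) • (toReal q - toReal p) := by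
        have e : ∀ r ∈ S, toReal r = toReal s + (i r : ℝ) • toReal g := by
          intro r hr
          conv_lhs => rw [hi r hr]
          funext j; simp [toReal]
        rw [e r hr, e p hp, e q hq, add_sub_add_left_eq_sub, ← sub_smul, smul_smul,
          div_mul_cancel₀ _ h3'.ne', add_assoc, ← add_smul]
        congr 2; ring
      rw [this]
      exact mem_latHull_pair_of_param (div_nonneg (by linarith) h3'.le)
        ((div_le_one h3').mpr (by linarith))
  · apply latHull_mono
    intro r hr
    simp only [Finset.mem_insert, Finset.mem_singleton] at hr
    rcases hr with rfl | rfl <;> assumption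

/-- The element of `GL(2,ℤ)` with columns `u` and `v` of determinant one. -/
def glOfCols (u v : Fin 2 → ℤ) (h : crs u v = 1) : Matrix.GeneralLinearGroup (Fin 2) ℤ :=
  ⟨!![u 0, v 0; u 1, v 1], !![v 1, -v 0; -u 1, u 0],
    by
      unfold crs at h
      ext i j
      fin_cases i <;> fin_cases j <;> simp [Matrix.mul_apply, Fin.sum_univ_two] <;> linarith,
    by
      unfold crs at h
      ext i j
      fin_cases i <;> fin_cases j <;> simp [Matrix.mul_apply, Fin.sum_univ_two] <;> linarith⟩

theorem glOfCols_mulVec (u v : Fin 2 → ℤ) (h : crs u v = 1) (p : Fin 2 → ℤ) :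
    (glOfCols u v h).1.mulVec p = p 0 • u + p 1 • v := by
  funext i
  fin_cases i <;> simp [glOfCols, Matrix.mulVec, dotProduct, Fin.sum_univ_two] <;> ring

theorem map_carrier_latHull (Φ : Matrix.GeneralLinearGroup (Fin 2) ℤ) (w : Fin 2 → ℤ)
    {P : LatticePolytope} {S : Finset (Fin 2 → ℤ)} (hP : P.carrier = latHull S) :
    (P.map Φ w).carrier = latHull (S.image fun p => Φ.1.mulVec p + w) := by
  change affineMap Φ w '' P.carrier = _
  rw [hP]
  exact affineMap_image_hull Φ w S

theorem origin_carrier : origin.carrier = latHull {0} := rfl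

theorem unitSegment_carrier : unitSegment.carrier = latHull {0, ![1, 0]} := rfl

theorem stdTriangle_carrier : stdTriangle.carrier = latHull {![1, 0], ![0, 1], 0} := rfl

theorem exists_polytope (S : Finset (Fin 2 → ℤ)) (hS : S.Nonempty) :
    ∃ P : LatticePolytope, P.carrier = latHull S := ⟨hull S hS, rfl⟩

theorem exists_eq_origin_map {P : LatticePolytope} {a : Fin 2 → ℤ} (hP : P.carrier = latHull {a}) :
    P = origin.map 1 a := by
  apply LatticePolytope.ext
  rw [hP, map_carrier_latHull 1 a origin_carrier]
  simp

/-- A segment with a primitive direction is equivalent to the unit segment. -/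
theorem exists_eq_unitSegment_map {P : LatticePolytope} {a g : Fin 2 → ℤ}
    (hg : IsCoprime (g 0) (g 1)) (hP : P.carrier = latHull {a, a + g}) :
    ∃ Φ, P = unitSegment.map Φ a := by
  obtain ⟨m, n, hmn⟩ := hg
  have h : crs g ![-n, m] = 1 := by simp [crs]; linarith
  refine ⟨glOfCols g _ h, ?_⟩
  apply LatticePolytope.ext
  rw [hP, map_carrier_latHull _ a unitSegment_carrier]
  congr 1
  simp only [Finset.image_insert, Finset.image_singleton, glOfCols_mulVec]
  simp [add_comm]

/-- A triangle of area `1/2` is equivalent to the standard triangle. -/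
theorem exists_eq_stdTriangle_map {P : LatticePolytope} {a u v : Fin 2 → ℤ}
    (h : crs u v = 1) (hP : P.carrier = latHull {a, a + u, a + v}) :
    ∃ Φ, P = stdTriangle.map Φ a := by
  refine ⟨glOfCols u v h, ?_⟩
  apply LatticePolytope.ext
  rw [hP, map_carrier_latHull _ a stdTriangle_carrier]
  congr 1
  simp only [Finset.image_insert, Finset.image_singleton, glOfCols_mulVec]
  ext p
  simp [add_comm]
  tauto

section Generation

variable {A : Type*} [AddCommGroup A] {Z : LatticePolytope → A} {M : AddSubgroup A}

/-- The values of a valuation on lattice segments lie in the subgroup generated by its values on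
points and unimodular segments: a segment is cut at its lattice points. -/
theorem IsVal.mem_of_segment (hZ : IsVal Z) (h0 : ∀ Φ w, Z (origin.map Φ w) ∈ M)
    (h1 : ∀ Φ w, Z (unitSegment.map Φ w) ∈ M) {g : Fin 2 → ℤ} (hg : IsCoprime (g 0) (g 1))
    (a : Fin 2 → ℤ) (k : ℕ) :
    ∀ P : LatticePolytope, P.carrier = latHull {a, a + (k : ℤ) • g} → Z P ∈ M := by
  induction k with
  | zero =>
    intro P hP
    have : P.carrier = latHull {a} := by simpa using hP
    rw [exists_eq_origin_map this]; exact h0 _ _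
  | succ k ih =>
    intro P hP
    -- cut off the last primitive piece `[b, b + g]`
    set b := a + (k : ℤ) • g with hb
    have hb' : a + ((k + 1 : ℕ) : ℤ) • g = b + g := by
      rw [hb]; push_cast; rw [add_smul, one_smul, add_assoc]
    rw [hb'] at hP
    -- the line `det(d, ·) = const` is perpendicular to `g`
    set d : Fin 2 → ℤ := ![g 1, -g 0] with hd
    have hdp : ∀ p, crs d p = g 1 * p 1 + g 0 * p 0 := by intro p; simp [crs, hd]
    have hpos : 0 < g 1 * g 1 + g 0 * g 0 := by
      have hne : g 0 ≠ 0 ∨ g 1 ≠ 0 := by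
        by_contra hc
        push Not at hc
        rw [hc.1, hc.2] at hg
        exact not_isCoprime_zero_zero hg
      rcases hne with h | h
      · have := mul_self_pos.mpr h
        have := mul_self_nonneg (g 1)
        omega
      · have := mul_self_pos.mpr h
        have := mul_self_nonneg (g 0)
        omega
    have hba : crs d b = crs d a + k * (g 1 * g 1 + g 0 * g 0) := by
      rw [hdp, hdp, hb]; simp; ring
    have hbg : crs d (b + g) = crs d b + (g 1 * g 1 + g 0 * g 0) := by
      rw [hdp, hdp]; simp; ring
    have hk0 : (0 : ℤ) ≤ k * (g 1 * g 1 + g 0 * g 0) := by positivity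
    have hPS : P.carrier = latHull {a, b, b + g} := by
      rw [hP]
      apply Set.Subset.antisymm
      · apply latHull_mono; intro p; simp; tauto
      · refine latHull_subset (convex_latHull _) fun s hs => ?_
        simp only [Finset.mem_insert, Finset.mem_singleton] at hs
        rcases hs with rfl | rfl | rfl
        · exact toReal_mem_latHull (by simp)
        · have : toReal b =
              toReal a + ((k : ℝ) / (k + 1)) • (toReal (b + g) - toReal a) := by
            funext j; simp [toReal, hb]; field_simp; ring
          rw [this]
          refine mem_latHull_pair_of_param (by positivity) ?_
          rw [div_le_one (by positivity)]; linarith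
        · exact toReal_mem_latHull (by simp)
    obtain ⟨I, hI⟩ := exists_polytope {b} (by simp)
    have hfl : ({a, b, b + g} : Finset (Fin 2 → ℤ)).filter (fun s => crs d b ≤ crs d s) =
        {b, b + g} ∨ k = 0 := by
      by_cases hk : k = 0
      · exact Or.inr hk
      left
      have : 0 < (k : ℤ) * (g 1 * g 1 + g 0 * g 0) := by positivity
      rw [Finset.filter_insert, if_neg (by omega), Finset.filter_true_of_mem]
      intro s hs
      simp only [Finset.mem_insert, Finset.mem_singleton] at hs
      rcases hs with rfl | rfl <;> omega
    rcases hfl with hfl | hk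
    swap
    · have hab : b = a := by simp [hb, hk]
      rw [hab] at hP
      obtain ⟨Φ, rfl⟩ := exists_eq_unitSegment_map hg hP
      exact h1 _ _
    have hfr : ({a, b, b + g} : Finset (Fin 2 → ℤ)).filter (fun s => crs d s ≤ crs d b) =
        {a, b} := by
      ext s
      simp only [Finset.mem_filter, Finset.mem_insert, Finset.mem_singleton]
      constructor
      · rintro ⟨rfl | rfl | rfl, h⟩
        · simp
        · simp
        · omega
      · rintro (rfl | rfl)
        · exact ⟨by simp, by omega⟩
        · simp
    obtain ⟨L, hL⟩ := exists_polytope {b, b + g} (by simp)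
    obtain ⟨R, hR⟩ := exists_polytope {a, b} (by simp)
    have hcut := hZ.cut (S := {a, b, b + g}) (T := {b}) (by simp) d (crs d b) (by simp) ?_
      P L R I hPS (by rw [hL, hfl]) (by rw [hR, hfr]) hI
    · obtain ⟨Φ, hΦ⟩ := exists_eq_unitSegment_map hg hL
      have hL' : Z L ∈ M := hΦ ▸ h1 _ _
      have hI' : Z I ∈ M := by rw [exists_eq_origin_map hI]; exact h0 _ _
      rw [eq_sub_of_add_eq hcut]
      exact M.sub_mem (M.add_mem hL' (ih R hR)) hI'
    · intro p hp hpd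
      rw [← hPS, hP, latHull_pair, segment_eq_image'] at hp
      obtain ⟨t, -, rfl⟩ := hp
      simp only at hpd ⊢
      rw [crsL_add_smul] at hpd
      rw [hbg, hba] at hpd
      have hpos' : (0 : ℝ) < g 1 * g 1 + g 0 * g 0 := by exact_mod_cast hpos
      have ht : t * (k + 1) = k := by
        push_cast at hpd
        have : (t * (k + 1) - k) * ((g 1 : ℝ) * g 1 + g 0 * g 0) = 0 := by linear_combination hpd
        rcases mul_eq_zero.mp this with h | h
        · linarith
        · exact absurd h hpos'.ne'
      have : toReal a + t • (toReal (b + g) - toReal a) = toReal b := by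
        funext j
        simp [toReal, hb]
        linear_combination (g j : ℝ) * ht
      rw [this]
      exact toReal_mem_latHull (by simp)

theorem IsVal.mem_of_collinear (hZ : IsVal Z) (h0 : ∀ Φ w, Z (origin.map Φ w) ∈ M)
    (h1 : ∀ Φ w, Z (unitSegment.map Φ w) ∈ M) {S : Finset (Fin 2 → ℤ)}
    (h : ∀ s ∈ S, ∀ t ∈ S, ∀ r ∈ S, crs (t - s) (r - s) = 0) :
    ∀ P : LatticePolytope, P.carrier = latHull S → Z P ∈ M := by
  intro P hP
  have hS : S.Nonempty := by
    rw [Finset.nonempty_iff_ne_empty]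
    rintro rfl
    obtain ⟨T, ⟨t, ht⟩, hT⟩ := P.isLattice
    have : toReal t ∈ P.carrier := by rw [hT]; exact toReal_mem_latHull ht
    rw [hP] at this
    simp [latHull] at this
  obtain ⟨a, g, k, hg, hk⟩ := exists_segment_of_collinear hS h
  exact hZ.mem_of_segment h0 h1 hg a k P (hP.trans hk)

theorem IsVal.mem_of_pair (hZ : IsVal Z) (h0 : ∀ Φ w, Z (origin.map Φ w) ∈ M)
    (h1 : ∀ Φ w, Z (unitSegment.map Φ w) ∈ M) (a b : Fin 2 → ℤ) :
    ∀ P : LatticePolytope, P.carrier = latHull {a, b} → Z P ∈ M := by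
  apply hZ.mem_of_collinear h0 h1
  intro s hs t ht r hr
  simp only [Finset.mem_insert, Finset.mem_singleton] at hs ht hr
  rcases hs with rfl | rfl <;> rcases ht with rfl | rfl <;> rcases hr with rfl | rfl <;>
    simp [crs] <;> ring

end Generation

/-! ### Lattice triangles -/

/-- Twice the signed area of the triangle with vertices `a`, `b`, `c`. -/
def area (a b c : Fin 2 → ℤ) : ℤ := crs (b - a) (c - a)

theorem crs_sub_eq_area (a b c : Fin 2 → ℤ) :
    crs (b - a) c = crs (b - a) a + area a b c := by
  simp only [area, crs, Pi.sub_apply]; ring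

theorem area_rotate (a b c : Fin 2 → ℤ) : area b c a = area a b c := by
  simp only [area, crs, Pi.sub_apply]; ring

theorem area_swap (a b c : Fin 2 → ℤ) : area a c b = -area a b c := by
  simp only [area, crs, Pi.sub_apply]; ring

theorem area_add (a b c p : Fin 2 → ℤ) :
    area p b c = area a b c - area a b p - area a p c := by
  simp only [area, crs, Pi.sub_apply]; ring

theorem area_same (a b : Fin 2 → ℤ) : area a b a = 0 ∧ area a b b = 0 ∧ area a a b = 0 := by
  simp only [area, crs, Pi.sub_apply]; refine ⟨?_, ?_, ?_⟩ <;> ring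

/-- If `det(u, v) ≥ 2`, then there is a lattice vector other than `0` whose coordinates with respect
to `u` and `v`, which are `det(w, v) / det(u, v)` and `det(u, w) / det(u, v)`, lie in `[0, 1)`. -/
theorem exists_lattice_point {u v : Fin 2 → ℤ} (h : 2 ≤ crs u v) :
    ∃ w : Fin 2 → ℤ, 0 ≤ crs w v ∧ crs w v < crs u v ∧ 0 ≤ crs u w ∧ crs u w < crs u v ∧
      ¬ (crs w v = 0 ∧ crs u w = 0) := by
  set n := crs u v with hn
  -- reduction of a lattice vector modulo the lattice spanned by `u` and `v`
  have red : ∀ e : Fin 2 → ℤ, crs (e - (crs e v / n) • u - (crs u e / n) • v) v = crs e v % n ∧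
      crs u (e - (crs e v / n) • u - (crs u e / n) • v) = crs u e % n := by
    intro e
    have h1 := Int.mul_ediv_add_emod (crs e v) n
    have h2 := Int.mul_ediv_add_emod (crs u e) n
    have h3 : ∀ α β : ℤ, crs (e - α • u - β • v) v = crs e v - n * α := by
      intro α β; rw [hn]; simp only [crs, Pi.sub_apply, Pi.smul_apply, smul_eq_mul]; ring
    have h4 : ∀ α β : ℤ, crs u (e - α • u - β • v) = crs u e - n * β := by
      intro α β; rw [hn]; simp only [crs, Pi.sub_apply, Pi.smul_apply, smul_eq_mul]; ring
    rw [h3, h4]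
    constructor <;> omega
  by_contra hcon
  push Not at hcon
  have key : ∀ e : Fin 2 → ℤ, n ∣ crs e v ∧ n ∣ crs u e := by
    intro e
    obtain ⟨r1, r2⟩ := red e
    have := hcon (e - (crs e v / n) • u - (crs u e / n) • v)
    rw [r1, r2] at this
    have := this (Int.emod_nonneg _ (by omega)) (Int.emod_lt_of_pos _ (by omega))
      (Int.emod_nonneg _ (by omega)) (Int.emod_lt_of_pos _ (by omega))
    exact ⟨Int.dvd_of_emod_eq_zero this.1, Int.dvd_of_emod_eq_zero this.2⟩
  -- all entries of `u` and `v` are divisible by `n`, hence `n ^ 2` divides `n`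
  have k0 := key ![1, 0]
  have k1 := key ![0, 1]
  simp only [crs] at k0 k1
  simp at k0 k1
  obtain ⟨⟨α, hα⟩, β, hβ⟩ := k0
  obtain ⟨⟨γ, hγ⟩, δ, hδ⟩ := k1
  have : n * 1 = n * (n * (δ * α - β * γ)) := by
    conv_lhs => rw [mul_one, hn, crs, hα, hβ, hγ, hδ]
    ring
  have h1 := mul_left_cancel₀ (by omega : n ≠ 0) this
  have : n ∣ 1 := ⟨_, h1⟩
  have := Int.le_of_dvd one_pos this
  omega

theorem latHull_insert_of_mem {S : Finset (Fin 2 → ℤ)} {p : Fin 2 → ℤ}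
    (hp : toReal p ∈ latHull S) : latHull (insert p S) = latHull S := by
  apply Set.Subset.antisymm
  · refine latHull_subset (convex_latHull _) fun s hs => ?_
    rcases Finset.mem_insert.mp hs with rfl | hs
    · exact hp
    · exact toReal_mem_latHull hs
  · exact latHull_mono (Finset.subset_insert _ _)

section Generation

variable {A : Type*} [AddCommGroup A] {Z : LatticePolytope → A} {M : AddSubgroup A}

/-- A valuation on a triangle `abc` that is cut from the vertex `c` to a point `p` of `[a, b]`. -/
theorem IsVal.cut_triangle (hZ : IsVal Z) {a b c p : Fin 2 → ℤ} (hp : area a b p = 0)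
    (h0 : 0 < area a p c) (h1 : area a p c < area a b c) :
    ∀ P L R I : LatticePolytope, P.carrier = latHull {a, b, c} → L.carrier = latHull {a, p, c} →
      R.carrier = latHull {p, b, c} → I.carrier = latHull {p, c} → Z P + Z I = Z L + Z R := by
  intro P L R I hP hL hR hI
  have hn : 0 < area a b c := h0.trans h1
  have hpc := crs_sub_eq_area p c
  have ea := hpc a
  have eb := hpc b
  have ec := hpc c
  have h2 := area_add a b c p
  rw [area_rotate] at ea
  rw [area_swap] at eb
  rw [(area_same p c).2.1] at ec
  have hpS : toReal p ∈ latHull {a, b, c} := by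
    have hab : a ≠ b := by
      rintro rfl; rw [(area_same a c).2.2] at hn; omega
    have hpar : crs (b - a) p = crs (b - a) a := by rw [crs_sub_eq_area, hp, add_zero]
    obtain ⟨t, ht⟩ := exists_of_crsL_eq hab (p := toReal p)
      (by rw [crsL_toReal]; exact_mod_cast hpar)
    have hval : crsL (a - c) (toReal p) =
        crs (a - c) a + t * (crs (a - c) b - crs (a - c) a) := by
      rw [ht, crsL_add_smul]
    rw [crsL_toReal] at hval
    have e1 : crs (a - c) p = crs (a - c) a + area a p c := by
      simp only [area, crs, Pi.sub_apply]; ring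
    have e2 : crs (a - c) b = crs (a - c) a + area a b c := by
      simp only [area, crs, Pi.sub_apply]; ring
    rw [e1, e2] at hval
    push_cast at hval
    have h0' : (0 : ℝ) < area a p c := by exact_mod_cast h0
    have h1' : (area a p c : ℝ) < area a b c := by exact_mod_cast h1
    rw [ht]
    exact latHull_mono (by intro s; simp; tauto)
      (mem_latHull_pair_of_param (u := a) (v := b) (t := t) (by nlinarith) (by nlinarith))
  refine hZ.cut (S := insert p {a, b, c}) (T := {p, c}) ?_ (c - p) (crs (c - p) p) ?_ ?_ P L R I
    (by rw [hP, latHull_insert_of_mem hpS]) ?_ ?_ hI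
  · intro s; simp; tauto
  · intro t ht
    simp only [Finset.mem_insert, Finset.mem_singleton] at ht
    rcases ht with rfl | rfl <;> omega
  · have f : ∀ s, crs (b - a) s = crs (b - a) a + area a b s := crs_sub_eq_area a b
    have g : ∀ s, crs (a - b) s = crs (a - b) a - area a b s := by
      intro s; simp only [area, crs, Pi.sub_apply]; ring
    have fa := (area_same a b).1
    have fb := (area_same a b).2.1
    refine mem_latHull_pair_of_line (b - a) (a - b) ?_ ?_ ?_ ?_
    · intro s hs
      rw [f p, f s]
      simp only [Finset.mem_insert, Finset.mem_singleton] at hs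
      rcases hs with rfl | rfl | rfl | rfl <;> omega
    · rw [f p, f c]; omega
    · intro s hs
      rw [g c, g s]
      simp only [Finset.mem_insert, Finset.mem_singleton] at hs
      rcases hs with rfl | rfl | rfl | rfl <;> omega
    · rw [g p, g c]; omega
  · rw [hL]; congr 1
    ext s
    simp only [Finset.mem_filter, Finset.mem_insert, Finset.mem_singleton]
    constructor
    · rintro (rfl | rfl | rfl)
      · exact ⟨by simp, by omega⟩
      · exact ⟨by simp, by omega⟩
      · exact ⟨by simp, by omega⟩
    · rintro ⟨rfl | rfl | rfl | rfl, h⟩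
      · simp
      · simp
      · omega
      · simp
  · rw [hR]; congr 1
    ext s
    simp only [Finset.mem_filter, Finset.mem_insert, Finset.mem_singleton]
    constructor
    · rintro (rfl | rfl | rfl)
      · exact ⟨by simp, by omega⟩
      · exact ⟨by simp, by omega⟩
      · exact ⟨by simp, by omega⟩
    · rintro ⟨rfl | rfl | rfl | rfl, h⟩
      · simp
      · omega
      · simp
      · simp

/-- A valuation on a convex quadrilateral `abqc` that is cut along the diagonal `[a, q]`. -/
theorem IsVal.cut_quadrilateral (hZ : IsVal Z) {a b q c : Fin 2 → ℤ} (h1 : 0 < area a b q)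
    (h2 : 0 < area b q c) (h3 : 0 < area q c a) (h4 : 0 < area c a b) :
    ∀ P L R I : LatticePolytope, P.carrier = latHull {a, b, q, c} →
      L.carrier = latHull {a, q, c} → R.carrier = latHull {a, b, q} →
      I.carrier = latHull {a, q} → Z P + Z I = Z L + Z R := by
  intro P L R I hP hL hR hI
  have ha := crs_sub_eq_area a q
  have eb := ha b
  have ec := ha c
  have eq := ha q
  rw [area_swap] at eb
  rw [(area_same a q).2.1] at eq
  have h3' := area_rotate a q c
  refine hZ.cut (S := {a, b, q, c}) (T := {a, q}) ?_ (q - a) (crs (q - a) a) ?_ ?_ P L R I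
    hP ?_ ?_ hI
  · intro s; simp; tauto
  · intro t ht
    simp only [Finset.mem_insert, Finset.mem_singleton] at ht
    rcases ht with rfl | rfl <;> omega
  · have f : ∀ s, crs (c - b) s = crs (c - b) b + area b c s := crs_sub_eq_area b c
    have g : ∀ s, crs (b - c) s = crs (b - c) b - area b c s := by
      intro s; simp only [area, crs, Pi.sub_apply]; ring
    have fb := (area_same b c).1
    have fc := (area_same b c).2.1
    have fq := area_swap b q c
    have fa := area_rotate c a b
    have fa' := area_rotate a b c
    refine mem_latHull_pair_of_line (b - c) (c - b) ?_ ?_ ?_ ?_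
    · intro s hs
      rw [g a, g s]
      simp only [Finset.mem_insert, Finset.mem_singleton] at hs
      rcases hs with rfl | rfl | rfl | rfl <;> omega
    · rw [g a, g q]; omega
    · intro s hs
      rw [f q, f s]
      simp only [Finset.mem_insert, Finset.mem_singleton] at hs
      rcases hs with rfl | rfl | rfl | rfl <;> omega
    · rw [f a, f q]; omega
  · rw [hL]; congr 1
    ext s
    simp only [Finset.mem_filter, Finset.mem_insert, Finset.mem_singleton]
    constructor
    · rintro (rfl | rfl | rfl)
      · exact ⟨by simp, by omega⟩
      · exact ⟨by simp, by omega⟩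
      · exact ⟨by simp, by omega⟩
    · rintro ⟨rfl | rfl | rfl | rfl, h⟩
      · simp
      · omega
      · simp
      · simp
  · rw [hR]; congr 1
    ext s
    simp only [Finset.mem_filter, Finset.mem_insert, Finset.mem_singleton]
    constructor
    · rintro (rfl | rfl | rfl)
      · exact ⟨by simp, by omega⟩
      · exact ⟨by simp, by omega⟩
      · exact ⟨by simp, by omega⟩
    · rintro ⟨rfl | rfl | rfl | rfl, h⟩
      · simp
      · simp
      · simp
      · omega

/-- The values of a valuation on lattice triangles lie in the subgroup generated by its values on
unimodular simplices. A triangle `abc` of larger area is cut at a lattice point in its boundary, or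
there is a lattice point `q` such that `abqc` is a convex quadrilateral in which all triangles but
`abc` have smaller area than `abc`. -/
theorem IsVal.mem_of_triangle (hZ : IsVal Z) (h0 : ∀ Φ w, Z (origin.map Φ w) ∈ M)
    (h1 : ∀ Φ w, Z (unitSegment.map Φ w) ∈ M) (h2 : ∀ Φ w, Z (stdTriangle.map Φ w) ∈ M) (n : ℕ) :
    ∀ a b c : Fin 2 → ℤ, area a b c = n →
      ∀ P : LatticePolytope, P.carrier = latHull {a, b, c} → Z P ∈ M := by
  induction n using Nat.strong_induction_on with
  | _ n ih =>
  intro a b c hn P hP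
  have ih' : ∀ a b c : Fin 2 → ℤ, 0 ≤ area a b c → area a b c < n →
      ∃ P : LatticePolytope, P.carrier = latHull {a, b, c} ∧ Z P ∈ M := by
    intro a b c h h'
    obtain ⟨P, hP⟩ := exists_polytope {a, b, c} (by simp)
    exact ⟨P, hP, ih (area a b c).toNat (by omega) a b c (by omega) P hP⟩
  have seg : ∀ a b : Fin 2 → ℤ, ∃ P : LatticePolytope, P.carrier = latHull {a, b} ∧ Z P ∈ M := by
    intro a b
    obtain ⟨P, hP⟩ := exists_polytope {a, b} (by simp)
    exact ⟨P, hP, hZ.mem_of_pair h0 h1 a b P hP⟩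
  have edge : ∀ a b c p : Fin 2 → ℤ, area a b c = n → area a b p = 0 → 0 < area a p c →
      area a p c < n → ∀ P : LatticePolytope, P.carrier = latHull {a, b, c} → Z P ∈ M := by
    intro a b c p hn hp hpos hlt P hP
    obtain ⟨L, hL, hLM⟩ := ih' a p c hpos.le hlt
    obtain ⟨R, hR, hRM⟩ := ih' p b c (by rw [area_add a]; omega) (by rw [area_add a]; omega)
    obtain ⟨I, hI, hIM⟩ := seg p c
    rw [eq_sub_of_add_eq (hZ.cut_triangle hp hpos (by omega) P L R I hP hL hR hI)]
    exact M.sub_mem (M.add_mem hLM hRM) hIM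
  -- the quadrilateral `abqc` is cut along `aq` and along `bc`
  have quad : ∀ q : Fin 2 → ℤ, 0 < area a b q → area a b q < n → 0 < area a q c →
      area a q c < n → n < area a b q + area a q c → Z P ∈ M := by
    intro q e1 e2 e3 e4 e5
    have e6 : area b q c = area a b q + area a q c - n := by
      have := area_add a b c q
      rw [hn] at this
      have h := area_swap q b c
      rw [area_rotate] at h
      omega
    obtain ⟨P₁, hP₁, hM₁⟩ := ih' a b q e1.le e2
    obtain ⟨P₂, hP₂, hM₂⟩ := ih' a q c e3.le e4
    obtain ⟨P₃, hP₃, hM₃⟩ := ih' b q c (by omega) (by omega)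
    obtain ⟨I, hI, hIM⟩ := seg a q
    obtain ⟨J, hJ, hJM⟩ := seg b c
    obtain ⟨U, hU⟩ := exists_polytope {a, b, q, c} (by simp)
    have hqca : area q c a = area a q c := area_rotate _ _ _
    have hcab : area c a b = area a b c := by rw [← area_rotate c a b]
    have s1 := hZ.cut_quadrilateral e1 (by omega) (by omega) (by omega) U P₂ P₁ I hU hP₂ hP₁ hI
    have s2 := hZ.cut_quadrilateral (a := b) (b := q) (q := c) (c := a) (by omega) (by omega)
      (by omega) e1 U P P₃ J (by rw [hU]; congr 1; ext; simp; tauto)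
      (by rw [hP]; congr 1; ext; simp; tauto) hP₃ hJ
    have : Z P = Z P₂ + Z P₁ - Z I + Z J - Z P₃ := by
      rw [← s1, add_sub_cancel_right, s2, add_sub_cancel_right]
    rw [this]
    exact M.sub_mem (M.add_mem (M.sub_mem (M.add_mem hM₂ hM₁) hIM) hJM) hM₃
  rcases Nat.lt_or_ge n 2 with hn2 | hn2
  · interval_cases n
    · apply hZ.mem_of_collinear h0 h1 (S := {a, b, c}) _ P hP
      rw [Nat.cast_zero] at hn
      intro s hs t ht r hr
      simp only [Finset.mem_insert, Finset.mem_singleton] at hs ht hr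
      simp only [area, crs, Pi.sub_apply] at hn ⊢
      rcases hs with rfl | rfl | rfl <;> rcases ht with rfl | rfl | rfl <;>
        rcases hr with rfl | rfl | rfl <;> linarith
    · obtain ⟨Φ, rfl⟩ := exists_eq_stdTriangle_map (a := a) (u := b - a) (v := c - a) hn
        (by rw [hP, add_sub_cancel, add_sub_cancel])
      exact h2 _ _
  · obtain ⟨w, k1, k2, k3, k4, k5⟩ := exists_lattice_point (u := b - a) (v := c - a)
      (by rw [← area, hn]; exact_mod_cast hn2)
    have ei : crs w (c - a) = area a (a + w) c := by rw [area, add_sub_cancel_left]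
    have ej : crs (b - a) w = area a b (a + w) := by rw [area, add_sub_cancel_left]
    set p := a + w with hp
    rw [← area, hn] at k2 k4
    rw [ei] at k1 k2 k5
    rw [ej] at k3 k4 k5
    -- `p` is on the edge `ab`, or on the edge `ac`, or on the edge `bc`, or inside the triangle,
    -- where its reflection at the midpoint of `bc` is the fourth vertex of the quadrilateral, or
    -- beyond `bc`
    rcases k3.eq_or_lt with hj | hj
    · exact edge a b c p hn hj.symm (by omega) k2 P hP
    rcases k1.eq_or_lt with hi | hi
    · have e1 := area_rotate a p c
      have e2 := area_rotate c a p
      have e3 := area_rotate c a b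
      have e4 : area c p b = area a b c - area a b p - area a p c := by
        rw [← area_add, ← area_rotate c p b]
      exact edge c a b p (by omega) (by omega) (by omega) (by omega) P
        (by rw [hP]; congr 1; ext; simp; tauto)
    rcases lt_trichotomy (area a b p + area a p c) n with h | h | h
    · have e1 : area a b (b + c - p) = area a b c - area a b p := by
        simp only [area, crs, Pi.sub_apply, Pi.add_apply]; ring
      have e2 : area a (b + c - p) c = area a b c - area a p c := by
        simp only [area, crs, Pi.sub_apply, Pi.add_apply]; ring
      apply quad (b + c - p) <;> omega
    · have e1 := area_rotate a b c
      have e2 : area b c p = area a b c - area a b p - area a p c := by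
        rw [← area_add, ← area_rotate p b c]
      have e3 := area_rotate a b p
      exact edge b c a p (by omega) (by omega) (by omega) (by omega) P
        (by rw [hP]; congr 1; ext; simp; tauto)
    · exact quad p hj k4 hi k2 h

end Generation

/-! ### Valuations are determined by unimodular simplices -/

/-- If `a` lies between `b ∈ C` and another point of the convex set `C`, then `a ∈ C`. -/
theorem Convex.mem_of_add_smul_mem {V : Type*} [AddCommGroup V] [Module ℝ V] {C : Set V}
    (hC : Convex ℝ C) {a b : V} {τ : ℝ} (hτ : τ < 0) (h : a + τ • (b - a) ∈ C) (hb : b ∈ C) :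
    a ∈ C := by
  have h1 : (0 : ℝ) < 1 - τ := by linarith
  have := hC h hb (a := 1 / (1 - τ)) (b := -τ / (1 - τ)) (by positivity)
    (div_nonneg (by linarith) h1.le) (by field_simp; ring)
  convert this using 1
  have e : a = (1 / (1 - τ) * (1 - τ)) • a := by rw [one_div_mul_cancel h1.ne', one_smul]
  conv_lhs => rw [e]
  match_scalars <;> field_simp <;> ring

/-- No point of `S` lies in the convex hull of the others. -/
def IsConvexIndep (S : Finset (Fin 2 → ℤ)) : Prop := ∀ s ∈ S, toReal s ∉ latHull (S.erase s)

/-- A ray from a vertex `a` that points away from another vertex `b` leaves the convex hull. -/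
theorem IsConvexIndep.param_nonneg {S : Finset (Fin 2 → ℤ)} (hS : IsConvexIndep S)
    {a b : Fin 2 → ℤ} (ha : a ∈ S) (hb : b ∈ S) (hab : a ≠ b) {t : ℝ}
    (h : toReal a + t • (toReal b - toReal a) ∈ latHull S) : 0 ≤ t := by
  by_contra ht
  push Not at ht
  have hb' : toReal b ∈ latHull (S.erase a) :=
    toReal_mem_latHull (Finset.mem_erase.mpr ⟨hab.symm, hb⟩)
  have hab' : toReal b - toReal a ≠ 0 := sub_ne_zero.mpr fun h => hab (toReal_injective h.symm)
  have hne : (toReal '' (↑(S.erase a) : Set (Fin 2 → ℤ))).Nonempty :=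
    ⟨toReal b, b, Finset.mem_coe.mpr (Finset.mem_erase.mpr ⟨hab.symm, hb⟩), rfl⟩
  apply hS a ha
  rw [← Finset.insert_erase ha, latHull, Finset.coe_insert, Set.image_insert_eq,
    convexHull_insert hne, mem_convexJoin] at h
  obtain ⟨_, rfl, r, hr, hp⟩ := h
  rw [segment_eq_image'] at hp
  obtain ⟨σ, hσ, hσe⟩ := hp
  simp only [add_right_inj] at hσe
  rcases hσ.1.eq_or_lt with h0 | h0
  · rw [← h0, zero_smul] at hσe
    rcases smul_eq_zero.mp hσe.symm with h | h
    · exact absurd h ht.ne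
    · exact absurd h hab'
  · refine Convex.mem_of_add_smul_mem (convex_latHull (S.erase a)) (b := toReal b) (τ := t / σ)
      (div_neg_of_neg_of_pos ht h0) ?_ hb'
    have : toReal a + (t / σ) • (toReal b - toReal a) = r := by
      rw [div_eq_inv_mul, mul_smul, ← hσe, smul_smul, inv_mul_cancel₀ h0.ne', one_smul]
      abel
    rw [this]
    exact hr

/-- A line through two vertices meets the convex hull in the segment between them. -/
theorem IsConvexIndep.mem_pair {S : Finset (Fin 2 → ℤ)} (hS : IsConvexIndep S)
    {a b : Fin 2 → ℤ} (ha : a ∈ S) (hb : b ∈ S) (hab : a ≠ b) (p : Fin 2 → ℝ)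
    (hp : p ∈ latHull S) (h : crsL (b - a) p = crs (b - a) a) : p ∈ latHull {a, b} := by
  obtain ⟨t, rfl⟩ := exists_of_crsL_eq hab h
  have h0 := hS.param_nonneg ha hb hab hp
  have e : toReal a + t • (toReal b - toReal a) =
      toReal b + (1 - t) • (toReal a - toReal b) := by module
  have h1 := hS.param_nonneg hb ha hab.symm (e ▸ hp)
  exact mem_latHull_pair_of_param h0 (by linarith)

theorem IsConvexIndep.area_ne_zero {S : Finset (Fin 2 → ℤ)} (hS : IsConvexIndep S)
    {a b c : Fin 2 → ℤ} (ha : a ∈ S) (hb : b ∈ S) (hc : c ∈ S) (hab : a ≠ b) (hac : a ≠ c)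
    (hbc : b ≠ c) : area a b c ≠ 0 := by
  intro h
  apply hS c hc
  have := hS.mem_pair ha hb hab (toReal c) (toReal_mem_latHull hc)
    (by rw [crsL_toReal, crs_sub_eq_area, h, add_zero])
  refine latHull_mono ?_ this
  intro s hs
  simp only [Finset.mem_insert, Finset.mem_singleton] at hs
  rcases hs with rfl | rfl
  · exact Finset.mem_erase.mpr ⟨hac, ha⟩
  · exact Finset.mem_erase.mpr ⟨hbc, hb⟩

/-- Among four vertices there are two such that the line through them separates the others. The
signs of `area a b c`, `area a b d` and `area a c d` tell which of the lines `ab`, `ac`, `ad` does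
this. -/
theorem IsConvexIndep.exists_diagonal {S : Finset (Fin 2 → ℤ)} (hS : IsConvexIndep S)
    (hcard : 4 ≤ S.card) :
    ∃ a ∈ S, ∃ b ∈ S, ∃ c ∈ S, ∃ d ∈ S, 0 < area a b c ∧ area a b d < 0 := by
  obtain ⟨T, hT, hT4⟩ := Finset.exists_subset_card_eq hcard
  obtain ⟨a, b, c, d, hab, hac, had, hbc, hbd, hcd, rfl⟩ := Finset.card_eq_four.mp hT4
  have ha : a ∈ S := hT (by simp)
  have hb : b ∈ S := hT (by simp)
  have hc : c ∈ S := hT (by simp)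
  have hd : d ∈ S := hT (by simp)
  have n1 := hS.area_ne_zero ha hb hc hab hac hbc
  have n2 := hS.area_ne_zero ha hb hd hab had hbd
  have n3 := hS.area_ne_zero ha hc hd hac had hcd
  have s1 := area_swap a b c
  have s2 := area_swap a b d
  have s3 := area_swap a c d
  by_cases p1 : 0 < area a b c <;> by_cases p2 : 0 < area a b d <;>
    by_cases p3 : 0 < area a c d
  · exact ⟨a, ha, c, hc, d, hd, b, hb, by omega, by omega⟩
  · exact ⟨a, ha, d, hd, c, hc, b, hb, by omega, by omega⟩
  · exact ⟨a, ha, b, hb, c, hc, d, hd, by omega, by omega⟩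
  · exact ⟨a, ha, b, hb, c, hc, d, hd, by omega, by omega⟩
  · exact ⟨a, ha, b, hb, d, hd, c, hc, by omega, by omega⟩
  · exact ⟨a, ha, b, hb, d, hd, c, hc, by omega, by omega⟩
  · exact ⟨a, ha, d, hd, b, hb, c, hc, by omega, by omega⟩
  · exact ⟨a, ha, c, hc, b, hb, d, hd, by omega, by omega⟩

section Generation

variable {A : Type*} [AddCommGroup A] {Z : LatticePolytope → A} {M : AddSubgroup A}

/-- The values of a valuation lie in the subgroup generated by its values on unimodular
simplices. A polygon with at least four vertices is cut along a diagonal. -/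
theorem IsVal.mem (hZ : IsVal Z) (h0 : ∀ Φ w, Z (origin.map Φ w) ∈ M)
    (h1 : ∀ Φ w, Z (unitSegment.map Φ w) ∈ M) (h2 : ∀ Φ w, Z (stdTriangle.map Φ w) ∈ M)
    (P : LatticePolytope) : Z P ∈ M := by
  suffices H : ∀ (n : ℕ) (S : Finset (Fin 2 → ℤ)), S.card = n → S.Nonempty →
      ∀ P : LatticePolytope, P.carrier = latHull S → Z P ∈ M by
    obtain ⟨S, hS, hP⟩ := P.isLattice
    exact H _ S rfl hS P hP
  intro n
  induction n using Nat.strong_induction_on with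
  | _ n ih =>
  intro S hn hS P hP
  have ih' : ∀ T ⊂ S, T.Nonempty → ∃ P : LatticePolytope, P.carrier = latHull T ∧ Z P ∈ M := by
    intro T hT hT'
    obtain ⟨Q, hQ⟩ := exists_polytope T hT'
    exact ⟨Q, hQ, ih _ (hn ▸ Finset.card_lt_card hT) T rfl hT' Q hQ⟩
  have tri : ∀ a b c : Fin 2 → ℤ, ∀ P : LatticePolytope, P.carrier = latHull {a, b, c} →
      Z P ∈ M := by
    intro a b c P hP
    rcases le_total 0 (area a b c) with h | h
    · exact hZ.mem_of_triangle h0 h1 h2 (area a b c).toNat a b c (by omega) P hP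
    · refine hZ.mem_of_triangle h0 h1 h2 (area a c b).toNat a c b ?_ P ?_
      · rw [area_swap]; omega
      · rw [hP]; congr 1; ext; simp; tauto
  by_cases hind : IsConvexIndep S
  swap
  · unfold IsConvexIndep at hind
    push Not at hind
    obtain ⟨s, hs, hsS⟩ := hind
    have hne : (S.erase s).Nonempty := by
      rw [Finset.nonempty_iff_ne_empty]
      intro h
      simp [latHull, h] at hsS
    obtain ⟨Q, hQ, hQM⟩ := ih' (S.erase s) (Finset.erase_ssubset hs) hne
    have : P = Q := by
      apply LatticePolytope.ext
      rw [hP, hQ, ← latHull_insert_of_mem hsS, Finset.insert_erase hs]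
    rwa [this]
  rcases Nat.lt_or_ge S.card 4 with h4 | h4
  · have hpos := hS.card_pos
    interval_cases hc : S.card
    · obtain ⟨a, rfl⟩ := Finset.card_eq_one.mp hc
      exact tri a a a P (by simpa using hP)
    · obtain ⟨a, b, -, rfl⟩ := Finset.card_eq_two.mp hc
      exact tri a a b P (by simpa using hP)
    · obtain ⟨a, b, c, -, -, -, rfl⟩ := Finset.card_eq_three.mp hc
      exact tri a b c P hP
  · obtain ⟨a, ha, b, hb, c, hc, d, hd, hpos, hneg⟩ := hind.exists_diagonal h4
    have hab : a ≠ b := by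
      rintro rfl; rw [(area_same a c).2.2] at hpos; exact lt_irrefl _ hpos
    have ea := crs_sub_eq_area a b a
    have eb := crs_sub_eq_area a b b
    have ec := crs_sub_eq_area a b c
    have ed := crs_sub_eq_area a b d
    rw [(area_same a b).2.1] at eb
    obtain ⟨L, hL, hLM⟩ := ih' (S.filter fun s => crs (b - a) a ≤ crs (b - a) s)
      (Finset.filter_ssubset.mpr ⟨d, hd, by omega⟩)
      ⟨a, Finset.mem_filter.mpr ⟨ha, le_rfl⟩⟩
    obtain ⟨R, hR, hRM⟩ := ih' (S.filter fun s => crs (b - a) s ≤ crs (b - a) a)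
      (Finset.filter_ssubset.mpr ⟨c, hc, by omega⟩)
      ⟨a, Finset.mem_filter.mpr ⟨ha, le_rfl⟩⟩
    obtain ⟨I, hI⟩ := exists_polytope {a, b} (by simp)
    have hIM := hZ.mem_of_pair h0 h1 a b I hI
    have hcut := hZ.cut (S := S) (T := {a, b}) ?_ (b - a) (crs (b - a) a) ?_
      (hind.mem_pair ha hb hab) P L R I hP hL hR hI
    · rw [eq_sub_of_add_eq hcut]
      exact M.sub_mem (M.add_mem hLM hRM) hIM
    · intro s hs
      simp only [Finset.mem_insert, Finset.mem_singleton] at hs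
      rcases hs with rfl | rfl <;> assumption
    · intro s hs
      simp only [Finset.mem_insert, Finset.mem_singleton] at hs
      rcases hs with rfl | rfl <;> omega

end Generation

theorem affAct_zero (Φ : Matrix.GeneralLinearGroup (Fin 2) ℤ) (w : Fin 2 → ℤ) :
    affAct Φ w 0 = 0 := by
  rw [affAct_eq, ← linActHom_apply, map_zero, mul_zero]

/-- An equivariant valuation is determined by its values on the three unimodular simplices. -/
theorem IsEquivariantValuation.eq_zero {Z : LatticePolytope → PS} (hZ : IsEquivariantValuation Z)
    (h0 : Z origin = 0) (h1 : Z unitSegment = 0) (h2 : Z stdTriangle = 0) (P : LatticePolytope) :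
    Z P = 0 := by
  rw [← AddSubgroup.mem_bot (G := PS)]
  refine ((isVal_iff Z).mpr hZ.1).mem ?_ ?_ ?_ P
  · intro Φ w; rw [hZ.2, h0, affAct_zero]; rfl
  · intro Φ w; rw [hZ.2, h1, affAct_zero]; rfl
  · intro Φ w; rw [hZ.2, h2, affAct_zero]; rfl

theorem finrank_segment (a b : Fin 2 → ℤ) :
    Module.finrank ℝ (vectorSpan ℝ (latHull {a, b})) ≤ 1 := by
  rw [latHull, ← direction_affineSpan, affineSpan_convexHull, direction_affineSpan,
    ← collinear_iff_finrank_le_one]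
  simpa [Set.image_pair] using collinear_pair ℝ (toReal a) (toReal b)

theorem finrank_origin : Module.finrank ℝ (vectorSpan ℝ origin.carrier) ≤ 1 := by
  rw [origin_carrier, ← Finset.pair_eq_singleton]
  exact finrank_segment 0 0

/-- An equivariant valuation is simple if and only if it vanishes on the unimodular simplices of
dimension at most one. -/
theorem IsEquivariantValuation.isSimple_iff {Z : LatticePolytope → PS}
    (hZ : IsEquivariantValuation Z) : IsSimple Z ↔ Z origin = 0 ∧ Z unitSegment = 0 := by
  constructor
  · intro h
    exact ⟨h _ finrank_origin, h _ (finrank_segment _ _)⟩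
  · rintro ⟨h0, h1⟩ P hP
    obtain ⟨S, -, hS⟩ := P.isLattice
    rw [← AddSubgroup.mem_bot (G := PS)]
    refine ((isVal_iff Z).mpr hZ.1).mem_of_collinear (M := ⊥) (S := S) ?_ ?_ ?_ P hS
    · intro Φ w; rw [hZ.2, h0, affAct_zero]; rfl
    · intro Φ w; rw [hZ.2, h1, affAct_zero]; rfl
    · intro s hs t ht r hr
      rw [← collinear_iff_finrank_le_one] at hP
      have hc := hP.subset (show ({toReal s, toReal t, toReal r} : Set _) ⊆ P.carrier by
        rw [hS]
        rintro _ (rfl | rfl | rfl)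
        exacts [toReal_mem_latHull hs, toReal_mem_latHull ht, toReal_mem_latHull hr])
      obtain ⟨v, hv⟩ := (collinear_iff_of_mem (p₀ := toReal s) (by simp)).mp hc
      obtain ⟨α, hα⟩ := hv (toReal t) (by simp)
      obtain ⟨β, hβ⟩ := hv (toReal r) (by simp)
      have e : ∀ i, (t i : ℝ) = α * v i + s i := fun i => by simpa [toReal] using congrFun hα i
      have e' : ∀ i, (r i : ℝ) = β * v i + s i := fun i => by simpa [toReal] using congrFun hβ i
      have : ((crs (t - s) (r - s) : ℤ) : ℝ) = 0 := by
        simp only [crs, Pi.sub_apply]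
        push_cast
        rw [e, e, e', e']
        ring
      exact_mod_cast this

/-! ### Greatest points in linear orders and sums over lattice points -/

/-- The cone of nonnegative vectors of a total order on `ℝ²` that is compatible with addition and
with multiplication by nonnegative scalars. -/
structure IsTotalCone (C : Set (Fin 2 → ℝ)) : Prop where
  add_mem : ∀ v ∈ C, ∀ w ∈ C, v + w ∈ C
  smul_mem : ∀ t : ℝ, 0 ≤ t → ∀ v ∈ C, t • v ∈ C
  antisymm : ∀ v ∈ C, -v ∈ C → v = 0
  total : ∀ v, v ∈ C ∨ -v ∈ C

/-- `s` is a lattice point and the greatest point of `P` in the order with cone `C`. -/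
def IsTop (C : Set (Fin 2 → ℝ)) (P : LatticePolytope) (s : Fin 2 → ℤ) : Prop :=
  toReal s ∈ P.carrier ∧ ∀ p ∈ P.carrier, toReal s - p ∈ C

open Classical in
/-- The greatest point of a lattice polytope in the order with total cone `C`, which is one of its
vertices. -/
def top (C : Set (Fin 2 → ℝ)) (P : LatticePolytope) : Fin 2 → ℤ :=
  if h : ∃ s, IsTop C P s then h.choose else 0

namespace IsTotalCone

variable {C : Set (Fin 2 → ℝ)}

theorem zero_mem (hC : IsTotalCone C) : (0 : Fin 2 → ℝ) ∈ C := by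
  rcases hC.total 0 with h | h
  · exact h
  · simpa using h

theorem convex_setOf_sub_mem (hC : IsTotalCone C) (s : Fin 2 → ℝ) : Convex ℝ {p | s - p ∈ C} := by
  intro p hp q hq a b ha hb hab
  have := hC.add_mem _ (hC.smul_mem a ha _ hp) _ (hC.smul_mem b hb _ hq)
  have e : s - (a • p + b • q) = a • (s - p) + b • (s - q) := by
    have : s = (a + b) • s := by rw [hab, one_smul]
    conv_lhs => rw [this]
    module
  change s - (a • p + b • q) ∈ C
  rwa [e]

theorem isTop_of_finset (hC : IsTotalCone C) {P : LatticePolytope} {S : Finset (Fin 2 → ℤ)}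
    (hP : P.carrier = latHull S) {s : Fin 2 → ℤ} (hs : s ∈ S)
    (h : ∀ r ∈ S, toReal s - toReal r ∈ C) : IsTop C P s := by
  refine ⟨hP ▸ toReal_mem_latHull hs, fun p hp => ?_⟩
  rw [hP] at hp
  exact latHull_subset (hC.convex_setOf_sub_mem (toReal s)) h hp

theorem exists_greatest (hC : IsTotalCone C) {S : Finset (Fin 2 → ℤ)} (hS : S.Nonempty) :
    ∃ s ∈ S, ∀ r ∈ S, toReal s - toReal r ∈ C := by
  induction hS using Finset.Nonempty.cons_induction with
  | singleton a => exact ⟨a, by simp, by simpa using hC.zero_mem⟩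
  | cons a S ha hS ih =>
    obtain ⟨s, hs, h⟩ := ih
    rcases hC.total (toReal s - toReal a) with h1 | h1
    · refine ⟨s, Finset.mem_cons_of_mem hs, fun r hr => ?_⟩
      rcases Finset.mem_cons.mp hr with rfl | hr
      · exact h1
      · exact h r hr
    · refine ⟨a, Finset.mem_cons_self _ _, fun r hr => ?_⟩
      rcases Finset.mem_cons.mp hr with rfl | hr
      · simpa using hC.zero_mem
      · have := hC.add_mem _ h1 _ (h r hr)
        rwa [neg_sub, sub_add_sub_cancel] at this

theorem exists_isTop (hC : IsTotalCone C) (P : LatticePolytope) : ∃ s, IsTop C P s := by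
  obtain ⟨S, hS, hP⟩ := P.isLattice
  obtain ⟨s, hs, h⟩ := hC.exists_greatest hS
  exact ⟨s, hC.isTop_of_finset hP hs h⟩

theorem isTop_top (hC : IsTotalCone C) (P : LatticePolytope) : IsTop C P (top C P) := by
  have h := hC.exists_isTop P
  rw [top, dif_pos h]
  exact h.choose_spec

theorem eq_of_isTop (hC : IsTotalCone C) {P : LatticePolytope} {s : Fin 2 → ℤ}
    (hs : IsTop C P s) : top C P = s := by
  have ht := hC.isTop_top P
  have h := hC.antisymm _ (hs.2 _ ht.1) (by rw [neg_sub]; exact ht.2 _ hs.1)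
  exact toReal_injective (sub_eq_zero.mp h).symm

theorem top_mem (hC : IsTotalCone C) {P : LatticePolytope} {S : Finset (Fin 2 → ℤ)}
    (hS : S.Nonempty) (hP : P.carrier = latHull S) : top C P ∈ S := by
  obtain ⟨s, hs, h⟩ := hC.exists_greatest hS
  rwa [hC.eq_of_isTop (hC.isTop_of_finset hP hs h)]

end IsTotalCone

theorem LatticePolytope.isClosed (P : LatticePolytope) : IsClosed P.carrier := by
  obtain ⟨S, -, h⟩ := P.isLattice
  rw [h]
  exact (S.finite_toSet.image toReal).isClosed_convexHull ℝ

/-- If the greatest point `p` of `P` is at least the greatest point `q` of `Q` and `P ∪ Q` is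
convex, then `q ∈ P`: the points of the segment from `q` to `p` are greater than `q`, hence not in
`Q`, and `P` is closed. -/
theorem IsTotalCone.top_of_le {C : Set (Fin 2 → ℝ)} (hC : IsTotalCone C)
    {P Q U I : LatticePolytope} (hU : U.carrier = P.carrier ∪ Q.carrier)
    (hI : I.carrier = P.carrier ∩ Q.carrier) (h : toReal (top C P) - toReal (top C Q) ∈ C) :
    top C U = top C P ∧ top C I = top C Q := by
  have hp := hC.isTop_top P
  have hq := hC.isTop_top Q
  set p := top C P
  set q := top C Q
  constructor
  · apply hC.eq_of_isTop
    refine ⟨hU ▸ Or.inl hp.1, fun r hr => ?_⟩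
    rw [hU] at hr
    rcases hr with hr | hr
    · exact hp.2 r hr
    · have := hC.add_mem _ h _ (hq.2 r hr)
      rwa [sub_add_sub_cancel] at this
  · apply hC.eq_of_isTop
    refine ⟨?_, fun r hr => ?_⟩
    swap
    · rw [hI] at hr; exact hq.2 r hr.2
    rw [hI]
    refine ⟨?_, hq.1⟩
    by_cases hpq : toReal p = toReal q
    · rw [← hpq]; exact hp.1
    have hseg : ∀ t : ℝ, t ∈ Set.Ioc (0 : ℝ) 1 →
        AffineMap.lineMap (toReal q) (toReal p) t ∈ P.carrier := by
      intro t ht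
      have hmem : AffineMap.lineMap (toReal q) (toReal p) t ∈ U.carrier :=
        U.convex.lineMap_mem (hU ▸ Or.inr hq.1) (hU ▸ Or.inl hp.1) ⟨ht.1.le, ht.2⟩
      rw [hU] at hmem
      rcases hmem with hm | hm
      · exact hm
      · exfalso
        have h1 := hC.smul_mem (t⁻¹) (inv_nonneg.mpr ht.1.le) _ (hq.2 _ hm)
        have h2 : t⁻¹ • (toReal q - AffineMap.lineMap (toReal q) (toReal p) t) =
            -(toReal p - toReal q) := by
          rw [AffineMap.lineMap_apply, vsub_eq_sub, vadd_eq_add, sub_add_cancel_right, smul_neg,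
            smul_smul, inv_mul_cancel₀ ht.1.ne', one_smul]
        rw [h2] at h1
        exact hpq (sub_eq_zero.mp (hC.antisymm _ h h1))
    have hlim : Filter.Tendsto (fun t : ℝ => AffineMap.lineMap (toReal q) (toReal p) t)
        (nhdsWithin 0 (Set.Ioi 0)) (nhds (toReal q)) := by
      have hc : Continuous (fun t : ℝ => AffineMap.lineMap (toReal q) (toReal p) t) :=
        AffineMap.lineMap_continuous
      have := hc.tendsto 0
      rw [AffineMap.lineMap_apply_zero] at this
      exact this.mono_left nhdsWithin_le_nhds
    refine P.isClosed.mem_of_tendsto hlim ?_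
    filter_upwards [Ioc_mem_nhdsGT (zero_lt_one' ℝ)] with t ht
    exact hseg t ht

/-- Every function of the greatest point is a valuation. -/
theorem IsTotalCone.isVal {C : Set (Fin 2 → ℝ)} (hC : IsTotalCone C) {A : Type*} [AddCommGroup A]
    (h : (Fin 2 → ℤ) → A) : IsVal fun P => h (top C P) := by
  intro P Q U I hU hI
  rcases hC.total (toReal (top C P) - toReal (top C Q)) with h1 | h1
  · obtain ⟨e1, e2⟩ := hC.top_of_le hU hI h1
    simp only [e1, e2]
  · rw [neg_sub] at h1
    obtain ⟨e1, e2⟩ := hC.top_of_le (by rw [hU, Set.union_comm]) (by rw [hI, Set.inter_comm]) h1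
    simp only [e1, e2]
    exact add_comm _ _

/-- The lattice points of a lattice polytope. -/
def latticePoints (P : LatticePolytope) : Set (Fin 2 → ℤ) := {p | toReal p ∈ P.carrier}

theorem finite_latticePoints (P : LatticePolytope) : (latticePoints P).Finite := by
  obtain ⟨S, -, h⟩ := P.isLattice
  obtain ⟨N, hN⟩ := (S.finite_toSet.image fun s : Fin 2 → ℤ => ∑ i, |s i|).bddAbove
  refine (Set.finite_Icc (fun _ : Fin 2 => -N) (fun _ => N)).subset ?_
  intro p hp
  have hsub : P.carrier ⊆ {v | ∀ i, |v i| ≤ (N : ℝ)} := by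
    rw [h]
    refine latHull_subset ?_ ?_
    · intro v hv w hw a b ha hb hab i
      have h1 := hv i
      have h2 := hw i
      rw [abs_le] at h1 h2 ⊢
      simp only [Pi.add_apply, Pi.smul_apply, smul_eq_mul]
      have hb' : b = 1 - a := by linarith
      subst hb'
      constructor <;> nlinarith
    · intro s hs i
      have h1 : ∑ i, |s i| ≤ N := hN ⟨s, hs, rfl⟩
      have h2 : |s i| ≤ ∑ i, |s i| :=
        Finset.single_le_sum (f := fun i => |s i|) (fun i _ => abs_nonneg _) (Finset.mem_univ i)
      have : |s i| ≤ N := h2.trans h1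
      simp only [toReal]
      exact_mod_cast this
  have hb := hsub hp
  rw [Set.mem_Icc, Pi.le_def, Pi.le_def]
  have : ∀ i, |p i| ≤ N := fun i => by
    have := hb i
    simp only [toReal] at this
    exact_mod_cast this
  exact ⟨fun i => (abs_le.mp (this i)).1, fun i => (abs_le.mp (this i)).2⟩

/-- The sum of `exp(p)` over all lattice points `p` of a lattice polytope. -/
def latticePointSum (P : LatticePolytope) : PS := ∑ᶠ p ∈ latticePoints P, expV p

theorem isVal_latticePointSum : IsVal latticePointSum := by
  intro P Q U I hU hI
  have h1 : latticePoints U = latticePoints P ∪ latticePoints Q := by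
    ext p; simp [latticePoints, hU]
  have h2 : latticePoints I = latticePoints P ∩ latticePoints Q := by
    ext p; simp [latticePoints, hI]
  rw [latticePointSum, latticePointSum, h1, h2]
  exact finsum_mem_union_inter (finite_latticePoints P) (finite_latticePoints Q)

theorem affineMap_toReal (Φ : Matrix.GeneralLinearGroup (Fin 2) ℤ) (w p : Fin 2 → ℤ) :
    affineMap Φ w (toReal p) = toReal (Φ.1.mulVec p + w) := by
  funext i
  fin_cases i <;> simp [affineMap, toReal]

theorem mulVec_inv_mulVec (Φ : Matrix.GeneralLinearGroup (Fin 2) ℤ) (p : Fin 2 → ℤ) :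
    Φ.1.mulVec (Φ⁻¹.1.mulVec p) = p := by
  rw [Matrix.mulVec_mulVec, ← Units.val_mul, mul_inv_cancel]
  simp

theorem mulVec_injective (Φ : Matrix.GeneralLinearGroup (Fin 2) ℤ) :
    Function.Injective Φ.1.mulVec := by
  intro p q h
  have := congrArg Φ⁻¹.1.mulVec h
  simpa only [Matrix.mulVec_mulVec, ← Units.val_mul, inv_mul_cancel, Units.val_one,
    Matrix.one_mulVec] using this

theorem affineMap_injective (Φ : Matrix.GeneralLinearGroup (Fin 2) ℤ) (w : Fin 2 → ℤ) :
    Function.Injective (affineMap Φ w) := by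
  intro v v' h
  have h1 : (Φ.1.map (Int.cast : ℤ → ℝ)).mulVec v = (Φ.1.map (Int.cast : ℤ → ℝ)).mulVec v' :=
    add_right_cancel h
  have h2 : (Φ⁻¹.1.map (Int.cast : ℤ → ℝ)) * (Φ.1.map (Int.cast : ℤ → ℝ)) = 1 := by
    refine (Matrix.map_mul (f := Int.castRingHom ℝ)).symm.trans ?_
    rw [Units.inv_mul]
    exact Matrix.map_one _ (map_zero _) (map_one _)
  have := congrArg (Φ⁻¹.1.map (Int.cast : ℤ → ℝ)).mulVec h1
  simpa only [Matrix.mulVec_mulVec, h2, Matrix.one_mulVec] using this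

theorem latticePoints_map (Φ : Matrix.GeneralLinearGroup (Fin 2) ℤ) (w : Fin 2 → ℤ)
    (P : LatticePolytope) :
    latticePoints (P.map Φ w) = (fun p => Φ.1.mulVec p + w) '' latticePoints P := by
  ext p
  constructor
  · rintro ⟨v, hv, hvp⟩
    have hp : p = Φ.1.mulVec (Φ⁻¹.1.mulVec (p - w)) + w := by
      rw [mulVec_inv_mulVec, sub_add_cancel]
    refine ⟨Φ⁻¹.1.mulVec (p - w), ?_, hp.symm⟩
    rw [hp, ← affineMap_toReal] at hvp
    have := affineMap_injective Φ w hvp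
    change toReal _ ∈ P.carrier
    rwa [← this]
  · rintro ⟨q, hq, rfl⟩
    exact ⟨toReal q, hq, affineMap_toReal Φ w q⟩

theorem isEquivariant_latticePointSum : IsEquivariant latticePointSum := by
  intro Φ w P
  have hinj : Function.Injective fun p => Φ.1.mulVec p + w :=
    (add_left_injective w).comp (mulVec_injective Φ)
  rw [latticePointSum, latticePoints_map, finsum_mem_image hinj.injOn, affAct_eq, latticePointSum,
    ← linActHom_apply]
  have := (linActHom Φ : PS →+* PS).toAddMonoidHom.map_finsum_mem expV (finite_latticePoints P)
  simp only [RingHom.toAddMonoidHom_eq_coe, AddMonoidHom.coe_coe, RingHom.coe_coe] at this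
  rw [this, mul_finsum_mem' _ _ (finite_latticePoints P)]
  refine finsum_mem_congr rfl fun p _ => ?_
  rw [linActHom_apply, linAct_expV, expV_add, mul_comm]

theorem isEquivariantValuation_latticePointSum : IsEquivariantValuation latticePointSum :=
  ⟨(isVal_iff _).mp isVal_latticePointSum, isEquivariant_latticePointSum⟩

theorem latticePointSum_eq_sum {P : LatticePolytope} {S : Finset (Fin 2 → ℤ)}
    (hP : P.carrier = latHull S) (h : ∀ p, toReal p ∈ latHull S → p ∈ S) :
    latticePointSum P = ∑ p ∈ S, expV p := by
  have : latticePoints P = S := by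
    ext p
    simp only [latticePoints, hP, Set.mem_ofPred_eq, Finset.mem_coe]
    exact ⟨h p, fun hp => toReal_mem_latHull hp⟩
  rw [latticePointSum, this, finsum_mem_coe_finset]

theorem le_crs_of_mem {S : Finset (Fin 2 → ℤ)} (d : Fin 2 → ℤ) (c : ℤ)
    (h : ∀ s ∈ S, c ≤ crs d s) {p : Fin 2 → ℤ} (hp : toReal p ∈ latHull S) : c ≤ crs d p := by
  have := le_crsL_of_mem h hp
  rw [crsL_toReal] at this
  exact_mod_cast this

theorem latticePointSum_stdTriangle :
    latticePointSum stdTriangle = 1 + expV ![1, 0] + expV ![0, 1] := by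
  rw [latticePointSum_eq_sum stdTriangle_carrier, Finset.sum_insert (by decide),
    Finset.sum_insert (by decide), Finset.sum_singleton, expV_zero]
  · ring
  · intro p hp
    have h1 := le_crs_of_mem ![1, 0] 0 (by decide) hp
    have h2 := le_crs_of_mem ![0, -1] 0 (by decide) hp
    have h3 := le_crs_of_mem ![-1, 1] (-1) (by decide) hp
    simp [crs] at h1 h2 h3
    have h : (p 0 = 1 ∧ p 1 = 0) ∨ (p 0 = 0 ∧ p 1 = 1) ∨ (p 0 = 0 ∧ p 1 = 0) := by omega
    simp only [Finset.mem_insert, Finset.mem_singleton]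
    rcases h with h | h | h
    · left; funext i; fin_cases i; exacts [h.1, h.2]
    · right; left; funext i; fin_cases i; exacts [h.1, h.2]
    · right; right; funext i; fin_cases i; exacts [h.1, h.2]

theorem latticePointSum_unitSegment : latticePointSum unitSegment = 1 + expV ![1, 0] := by
  rw [latticePointSum_eq_sum unitSegment_carrier, Finset.sum_insert (by decide),
    Finset.sum_singleton, expV_zero]
  · intro p hp
    have h1 := le_crs_of_mem ![1, 0] 0 (by decide) hp
    have h1' := le_crs_of_mem ![-1, 0] 0 (by decide) hp
    have h2 := le_crs_of_mem ![0, -1] 0 (by decide) hp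
    have h3 := le_crs_of_mem ![0, 1] (-1) (by decide) hp
    simp [crs] at h1 h1' h2 h3
    have h : (p 0 = 0 ∧ p 1 = 0) ∨ (p 0 = 1 ∧ p 1 = 0) := by omega
    simp only [Finset.mem_insert, Finset.mem_singleton]
    rcases h with h | h
    · left; funext i; fin_cases i; exacts [h.1, h.2]
    · right; funext i; fin_cases i; exacts [h.1, h.2]

theorem latticePointSum_origin : latticePointSum origin = 1 := by
  rw [latticePointSum_eq_sum origin_carrier, Finset.sum_singleton, expV_zero]
  intro p hp
  have h1 := le_crs_of_mem ![1, 0] 0 (by decide) hp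
  have h1' := le_crs_of_mem ![-1, 0] 0 (by decide) hp
  have h2 := le_crs_of_mem ![0, -1] 0 (by decide) hp
  have h3 := le_crs_of_mem ![0, 1] 0 (by decide) hp
  simp [crs] at h1 h1' h2 h3
  rw [Finset.mem_singleton]
  funext i
  fin_cases i
  · exact le_antisymm h3 h2
  · exact le_antisymm h1' h1

/-! ### Sums over boundary edges -/

/-- The nonnegative vectors of the order on `ℝ²` that compares first by the linear functional
`det(·, d)` and then in the direction `e`, which is meant to be `d` or `-d`. If a polygon is to the
left of an edge with direction `d`, then the greatest points for `e = d` and `e = -d` are the end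
point and the starting point of this edge. -/
def edgeCone (d e : Fin 2 → ℤ) : Set (Fin 2 → ℝ) :=
  {v | crsL d v < 0 ∨ ∃ t : ℝ, 0 ≤ t ∧ v = t • toReal e}

theorem toReal_neg (d : Fin 2 → ℤ) : toReal (-d) = -toReal d := by
  funext i; simp [toReal]

theorem toReal_sub (d e : Fin 2 → ℤ) : toReal (d - e) = toReal d - toReal e := by
  funext i; simp [toReal]

theorem toReal_ne_zero {d : Fin 2 → ℤ} (hd : d ≠ 0) : toReal d ≠ 0 := by
  intro h
  apply hd
  apply toReal_injective
  rw [h]; funext i; simp [toReal]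

theorem crsL_self (d : Fin 2 → ℤ) : crsL d (toReal d) = 0 := by
  rw [crsL_toReal]; simp [crs]; ring

theorem exists_smul_of_crsL_eq_zero {d : Fin 2 → ℤ} (hd : d ≠ 0) {v : Fin 2 → ℝ}
    (h : crsL d v = 0) : ∃ t : ℝ, v = t • toReal d := by
  obtain ⟨t, ht⟩ := exists_of_crsL_eq (u := 0) (v := d) hd.symm (p := v)
    (by rw [sub_zero, h]; simp [crs])
  have h0 : toReal 0 = 0 := by funext i; simp [toReal]
  exact ⟨t, by rw [ht, h0]; simp⟩

theorem isTotalCone_edgeCone {d e : Fin 2 → ℤ} (hd : d ≠ 0) (he : e = d ∨ e = -d) :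
    IsTotalCone (edgeCone d e) := by
  have hce : crsL d (toReal e) = 0 := by
    rcases he with rfl | rfl
    · exact crsL_self _
    · rw [toReal_neg, map_neg, crsL_self, neg_zero]
  have he0 : toReal e ≠ 0 := by
    rcases he with rfl | rfl
    · exact toReal_ne_zero hd
    · exact toReal_ne_zero (neg_ne_zero.mpr hd)
  constructor
  · rintro v (hv | ⟨s, hs, rfl⟩) w (hw | ⟨t, ht, rfl⟩)
    · left; rw [map_add]; linarith
    · left; rw [map_add, map_smul, hce]; simpa using hv
    · left; rw [map_add, map_smul, hce]; simpa using hw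
    · right; exact ⟨s + t, by linarith, by rw [add_smul]⟩
  · rintro t ht v (hv | ⟨s, hs, rfl⟩)
    · rcases ht.eq_or_lt with rfl | ht
      · right; exact ⟨0, le_rfl, by simp⟩
      · left; rw [map_smul, smul_eq_mul]; exact mul_neg_of_pos_of_neg ht hv
    · right; exact ⟨t * s, mul_nonneg ht hs, by rw [mul_smul]⟩
  · rintro v (hv | ⟨s, hs, rfl⟩) (hw | ⟨t, ht, hw⟩)
    · rw [map_neg] at hw; linarith
    · have := congrArg (crsL d) hw
      rw [map_neg, map_smul, hce, smul_zero] at this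
      linarith
    · rw [map_neg, map_smul, hce] at hw
      simp at hw
    · rw [neg_eq_iff_add_eq_zero, ← add_smul, smul_eq_zero] at hw
      have : s + t = 0 := hw.resolve_right he0
      have : s = 0 := by linarith
      rw [this, zero_smul]
  · intro v
    rcases lt_trichotomy (crsL d v) 0 with h | h | h
    · exact Or.inl (Or.inl h)
    · obtain ⟨t, rfl⟩ := exists_smul_of_crsL_eq_zero hd h
      have key : ∀ t : ℝ, 0 ≤ t → t • toReal e ∈ edgeCone d e := fun t ht => Or.inr ⟨t, ht, rfl⟩
      rcases he with rfl | rfl <;> rcases le_total 0 t with ht | ht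
      · exact Or.inl (key t ht)
      · right; rw [← neg_smul]; exact key (-t) (by linarith)
      · right; have := key t ht; rwa [toReal_neg, smul_neg] at this
      · left; have := key (-t) (by linarith); rwa [toReal_neg, smul_neg, neg_smul, neg_neg] at this
    · right; left; rw [map_neg]; linarith

/-- The end point of the edge of direction `d` of a polygon to its left. -/
def edgeEnd (d : Fin 2 → ℤ) (P : LatticePolytope) : Fin 2 → ℤ := top (edgeCone d d) P

/-- The starting point of the edge of direction `d` of a polygon to its left. -/
def edgeStart (d : Fin 2 → ℤ) (P : LatticePolytope) : Fin 2 → ℤ := top (edgeCone d (-d)) P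

/-- The difference of the exponentials of the end points of the edge of direction `d`, which is zero
if there is no edge with this direction. -/
def edgeDiff (d : Fin 2 → ℤ) (P : LatticePolytope) : PS :=
  expV (edgeEnd d P) - expV (edgeStart d P)

theorem isVal_edgeDiff {d : Fin 2 → ℤ} (hd : d ≠ 0) : IsVal (edgeDiff d) := by
  intro P Q U I hU hI
  have h1 := (isTotalCone_edgeCone hd (Or.inl rfl)).isVal expV P Q U I hU hI
  have h2 := (isTotalCone_edgeCone hd (Or.inr rfl)).isVal expV P Q U I hU hI
  simp only [edgeDiff, edgeEnd, edgeStart]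
  linear_combination h1 - h2

theorem ne_zero_of_isCoprime {d : Fin 2 → ℤ} (hd : IsCoprime (d 0) (d 1)) : d ≠ 0 := by
  rintro rfl
  exact not_isCoprime_zero_zero hd

/-- The edge of a primitive direction `d`, which may be a single vertex, is a multiple of `d`. -/
theorem edgeEnd_sub_edgeStart {d : Fin 2 → ℤ} (hd : IsCoprime (d 0) (d 1)) (P : LatticePolytope) :
    ∃ k : ℤ, 0 ≤ k ∧ edgeEnd d P - edgeStart d P = k • d := by
  have hd0 := ne_zero_of_isCoprime hd
  have h1 := (isTotalCone_edgeCone hd0 (Or.inl rfl)).isTop_top P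
  have h2 := (isTotalCone_edgeCone hd0 (Or.inr rfl)).isTop_top P
  have e1 := h1.2 _ h2.1
  have e2 := h2.2 _ h1.1
  change toReal (edgeEnd d P) - toReal (edgeStart d P) ∈ _ at e1
  change toReal (edgeStart d P) - toReal (edgeEnd d P) ∈ _ at e2
  rw [← toReal_sub] at e1 e2
  have hneg : edgeStart d P - edgeEnd d P = -(edgeEnd d P - edgeStart d P) := by abel
  rw [hneg, toReal_neg] at e2
  have hc : ∀ t : ℝ, crsL d (t • toReal d) = 0 := by
    intro t; rw [map_smul, crsL_self, smul_zero]
  have key : ∃ t : ℝ, 0 ≤ t ∧ toReal (edgeEnd d P - edgeStart d P) = t • toReal d := by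
    rcases e2 with e2 | ⟨t, ht, h⟩
    · rcases e1 with e1 | ⟨t, ht, h⟩
      · rw [map_neg] at e2; linarith
      · exact ⟨t, ht, h⟩
    · exact ⟨t, ht, by rw [toReal_neg, smul_neg, neg_inj] at h; exact h⟩
  obtain ⟨t, ht, h⟩ := key
  have h0 : crs d (edgeEnd d P - edgeStart d P) = 0 := by
    have := hc t
    rw [← h, crsL_toReal] at this
    exact_mod_cast this
  obtain ⟨k, hk⟩ := exists_smul_of_crs_eq_zero hd h0
  refine ⟨k, ?_, hk⟩
  rw [hk] at h
  have h' : (k : ℝ) • toReal d = t • toReal d := by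
    rw [← h]; funext i; simp [toReal]
  have := smul_left_injective ℝ (toReal_ne_zero hd0) h'
  have h3 : (0 : ℝ) ≤ k := by
    have h4 : (k : ℝ) = t := this
    rw [h4]; exact ht
  exact_mod_cast h3

theorem eq_of_smul_eq_smul {d d' : Fin 2 → ℤ} (hd : IsCoprime (d 0) (d 1))
    (hd' : IsCoprime (d' 0) (d' 1)) {k k' : ℤ} (hk : 0 < k) (hk' : 0 < k')
    (h : k • d = k' • d') : d = d' := by
  have e : ∀ i, k * d i = k' * d' i := fun i => by simpa using congrFun h i
  have key : ∀ {d d' : Fin 2 → ℤ} {k k' : ℤ}, IsCoprime (d 0) (d 1) →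
      (∀ i, k * d i = k' * d' i) → k' ∣ k := by
    intro d d' k k' ⟨m, n, hmn⟩ e
    refine ⟨m * d' 0 + n * d' 1, ?_⟩
    linear_combination (-k) * hmn + m * e 0 + n * e 1
  have h1 := key hd e
  have h2 := key hd' (fun i => (e i).symm)
  have : k = k' := Int.dvd_antisymm hk.le hk'.le h2 h1
  subst this
  funext i
  exact mul_left_cancel₀ hk.ne' (e i)

/-- The primitive lattice vectors. -/
def primitive : Set (Fin 2 → ℤ) := {d | IsCoprime (d 0) (d 1)}

/-- A polygon has finitely many edges, because an edge is determined by its end points. -/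
theorem finite_edgeDiff_ne_zero (P : LatticePolytope) :
    (primitive ∩ {d | edgeDiff d P ≠ 0}).Finite := by
  have hfin := (finite_latticePoints P).prod (finite_latticePoints P)
  refine Set.Finite.of_finite_image (f := fun d => (edgeEnd d P, edgeStart d P))
    (hfin.subset ?_) ?_
  · rintro _ ⟨d, ⟨hd, -⟩, rfl⟩
    have hd0 := ne_zero_of_isCoprime hd
    exact ⟨((isTotalCone_edgeCone hd0 (Or.inl rfl)).isTop_top P).1,
      ((isTotalCone_edgeCone hd0 (Or.inr rfl)).isTop_top P).1⟩
  · rintro d ⟨hd, hne⟩ d' ⟨hd', hne'⟩ h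
    simp only [Prod.mk.injEq] at h
    have pos : ∀ d, IsCoprime (d 0) (d 1) → edgeDiff d P ≠ 0 →
        ∃ k : ℤ, 0 < k ∧ edgeEnd d P - edgeStart d P = k • d := by
      intro d hd hne
      obtain ⟨k, hk, h⟩ := edgeEnd_sub_edgeStart hd P
      refine ⟨k, lt_of_le_of_ne hk ?_, h⟩
      rintro rfl
      rw [zero_smul, sub_eq_zero] at h
      exact hne (by rw [edgeDiff, h, sub_self])
    obtain ⟨k, hk, e⟩ := pos d hd hne
    obtain ⟨k', hk', e'⟩ := pos d' hd' hne'
    rw [← h.1, ← h.2, e] at e'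
    exact eq_of_smul_eq_smul hd hd' hk hk' e'

theorem det_eq (Φ : Matrix.GeneralLinearGroup (Fin 2) ℤ) :
    Φ.1.det = Φ.1 0 0 * Φ.1 1 1 - Φ.1 0 1 * Φ.1 1 0 := Matrix.det_fin_two _

theorem det_eq_one_or (Φ : Matrix.GeneralLinearGroup (Fin 2) ℤ) :
    Φ.1.det = 1 ∨ Φ.1.det = -1 := by
  have h : IsUnit Φ.1.det := (Matrix.isUnit_iff_isUnit_det _).mp Φ.isUnit
  exact Int.isUnit_iff.mp h

theorem crs_mulVec (Φ : Matrix.GeneralLinearGroup (Fin 2) ℤ) (u v : Fin 2 → ℤ) :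
    crs (Φ.1.mulVec u) (Φ.1.mulVec v) = Φ.1.det * crs u v := by
  rw [det_eq]
  simp only [crs, Matrix.mulVec, dotProduct, Fin.sum_univ_two]
  ring

theorem isCoprime_mulVec (Φ : Matrix.GeneralLinearGroup (Fin 2) ℤ) {d : Fin 2 → ℤ}
    (hd : IsCoprime (d 0) (d 1)) : IsCoprime (Φ.1.mulVec d 0) (Φ.1.mulVec d 1) := by
  obtain ⟨m, n, hmn⟩ := hd
  have h1 : crs d ![-n, m] = 1 := by simp [crs]; linarith
  have h := crs_mulVec Φ d ![-n, m]
  rw [h1, mul_one] at h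
  refine ⟨Φ.1.det * Φ.1.mulVec ![-n, m] 1, -Φ.1.det * Φ.1.mulVec ![-n, m] 0, ?_⟩
  have h2 : Φ.1.det * Φ.1.det = 1 := by rcases det_eq_one_or Φ with h | h <;> rw [h] <;> rfl
  rw [crs] at h
  linear_combination Φ.1.det * h + h2

/-- Elements of determinant `-1` reverse the direction of the edges of a polygon to their left. -/
theorem mapsTo_edgeCone (Φ : Matrix.GeneralLinearGroup (Fin 2) ℤ) (d e : Fin 2 → ℤ)
    {v : Fin 2 → ℝ} (hv : v ∈ edgeCone d e) :
    (Φ.1.map (Int.cast : ℤ → ℝ)).mulVec v ∈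
      edgeCone (Φ.1.det • Φ.1.mulVec d) (Φ.1.mulVec e) := by
  rcases hv with hv | ⟨t, ht, rfl⟩
  · left
    have h2 : (Φ.1.det : ℝ) * Φ.1.det = 1 := by
      rcases det_eq_one_or Φ with h | h <;> rw [h] <;> norm_num
    have : crsL (Φ.1.det • Φ.1.mulVec d) ((Φ.1.map (Int.cast : ℤ → ℝ)).mulVec v) =
        (Φ.1.det : ℝ) * Φ.1.det * crsL d v := by
      have hdet : (Φ.1.det : ℝ) = Φ.1 0 0 * Φ.1 1 1 - Φ.1 0 1 * Φ.1 1 0 := by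
        rw [det_eq]; push_cast; ring
      generalize Φ.1.det = δ at hdet ⊢
      simp only [crsL_apply, Matrix.mulVec, dotProduct, Fin.sum_univ_two, Pi.smul_apply,
        smul_eq_mul, Matrix.map_apply, Int.cast_mul, Int.cast_add]
      rw [hdet]
      ring
    rw [this, h2, one_mul]
    exact hv
  · right
    refine ⟨t, ht, ?_⟩
    rw [Matrix.mulVec_smul]
    congr 1
    have := affineMap_toReal Φ 0 e
    rw [add_zero] at this
    rw [← this]
    funext i
    simp [affineMap, toReal]

theorem IsTop.map {d e : Fin 2 → ℤ} {P : LatticePolytope} {s : Fin 2 → ℤ}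
    (h : IsTop (edgeCone d e) P s) (Φ : Matrix.GeneralLinearGroup (Fin 2) ℤ) (w : Fin 2 → ℤ) :
    IsTop (edgeCone (Φ.1.det • Φ.1.mulVec d) (Φ.1.mulVec e)) (P.map Φ w) (Φ.1.mulVec s + w) := by
  refine ⟨⟨toReal s, h.1, affineMap_toReal Φ w s⟩, ?_⟩
  rintro _ ⟨p, hp, rfl⟩
  rw [← affineMap_toReal]
  have := mapsTo_edgeCone Φ d e (h.2 p hp)
  rw [Matrix.mulVec_sub] at this
  simpa only [affineMap, add_sub_add_right_eq_sub] using this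

theorem edgeDiff_map (Φ : Matrix.GeneralLinearGroup (Fin 2) ℤ) (w : Fin 2 → ℤ)
    {d : Fin 2 → ℤ} (hd : d ≠ 0) (P : LatticePolytope) :
    edgeDiff (Φ.1.det • Φ.1.mulVec d) (P.map Φ w) =
      Φ.1.det * (expV w * linAct Φ (edgeDiff d P)) := by
  have h1 := ((isTotalCone_edgeCone hd (Or.inl rfl)).isTop_top P).map Φ w
  have h2 := ((isTotalCone_edgeCone hd (Or.inr rfl)).isTop_top P).map Φ w
  change IsTop _ _ (Φ.1.mulVec (edgeEnd d P) + w) at h1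
  change IsTop _ _ (Φ.1.mulVec (edgeStart d P) + w) at h2
  have hΦd : Φ.1.mulVec d ≠ 0 := fun h => hd (mulVec_injective Φ (by rw [h, Matrix.mulVec_zero]))
  have hlin : linAct Φ (edgeDiff d P) =
      expV (Φ.1.mulVec (edgeEnd d P)) - expV (Φ.1.mulVec (edgeStart d P)) := by
    rw [edgeDiff, ← linActHom_apply, map_sub, linActHom_apply, linActHom_apply, linAct_expV,
      linAct_expV]
  rw [hlin, edgeDiff, edgeEnd, edgeStart]
  rw [Matrix.mulVec_neg] at h2
  rcases det_eq_one_or Φ with h | h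
  · rw [h, one_smul] at h1 h2 ⊢
    rw [(isTotalCone_edgeCone hΦd (Or.inl rfl)).eq_of_isTop h1,
      (isTotalCone_edgeCone hΦd (Or.inr rfl)).eq_of_isTop h2, expV_add, expV_add]
    push_cast; ring
  · rw [h, neg_one_smul] at h1 h2 ⊢
    rw [neg_neg, (isTotalCone_edgeCone (neg_ne_zero.mpr hΦd) (Or.inl rfl)).eq_of_isTop h2,
      (isTotalCone_edgeCone (neg_ne_zero.mpr hΦd) (Or.inr (neg_neg _).symm)).eq_of_isTop h1,
      expV_add, expV_add]
    push_cast; ring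

instance : IsDomain PS := NoZeroDivisors.to_isDomain _

/-- The field of fractions of `ℚ[[x,y]]`. -/
abbrev Frac : Type := FractionRing PS

theorem linActHom_injective (Φ : Matrix.GeneralLinearGroup (Fin 2) ℤ) :
    Function.Injective (linActHom Φ : PS →+* PS) := by
  intro f g h
  apply linAct_injective Φ
  rw [← linActHom_apply, ← linActHom_apply]
  exact h

/-- The action of `GL(2,ℤ)` on the field of fractions of `ℚ[[x,y]]`. -/
def fracAct (Φ : Matrix.GeneralLinearGroup (Fin 2) ℤ) : Frac →+* Frac :=
  IsFractionRing.map (linActHom_injective Φ)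

theorem fracAct_algebraMap (Φ : Matrix.GeneralLinearGroup (Fin 2) ℤ) (f : PS) :
    fracAct Φ (algebraMap PS Frac f) = algebraMap PS Frac (linAct Φ f) := by
  rw [← linActHom_apply]
  exact IsLocalization.map_eq
    (nonZeroDivisors_le_comap_nonZeroDivisors_of_injective _ (linActHom_injective Φ)) f

/-- The sum of `φ(d) (exp(b) - exp(a))` over the boundary edges `[a, b]` of a polygon, oriented
counterclockwise, where `d` is the primitive direction of `b - a`. A segment has two edges of
opposite direction. -/
def loopSum (φ : (Fin 2 → ℤ) → Frac) (P : LatticePolytope) : Frac :=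
  ∑ᶠ d ∈ primitive, φ d * algebraMap PS Frac (edgeDiff d P)

theorem finite_loopSum (φ : (Fin 2 → ℤ) → Frac) (P : LatticePolytope) :
    (primitive ∩ Function.support fun d => φ d * algebraMap PS Frac (edgeDiff d P)).Finite := by
  refine (finite_edgeDiff_ne_zero P).subset ?_
  rintro d ⟨hd, h⟩
  refine ⟨hd, fun h0 => h ?_⟩
  simp only [h0, map_zero, mul_zero]

theorem isVal_loopSum (φ : (Fin 2 → ℤ) → Frac) : IsVal (loopSum φ) := by
  intro P Q U I hU hI
  simp only [loopSum]
  rw [← finsum_mem_add_distrib' (finite_loopSum φ U) (finite_loopSum φ I),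
    ← finsum_mem_add_distrib' (finite_loopSum φ P) (finite_loopSum φ Q)]
  refine finsum_mem_congr rfl fun d hd => ?_
  rw [← mul_add, ← mul_add, ← map_add, ← map_add,
    isVal_edgeDiff (ne_zero_of_isCoprime hd) P Q U I hU hI]

theorem bijOn_primitive (Φ : Matrix.GeneralLinearGroup (Fin 2) ℤ) :
    Set.BijOn (fun d => Φ.1.det • Φ.1.mulVec d) primitive primitive := by
  have hprim : ∀ (Φ : Matrix.GeneralLinearGroup (Fin 2) ℤ) (d), d ∈ primitive →
      Φ.1.det • Φ.1.mulVec d ∈ primitive := by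
    intro Φ d hd
    have := isCoprime_mulVec Φ hd
    rcases det_eq_one_or Φ with h | h
    · rw [h, one_smul]; exact this
    · rw [h, neg_one_smul]; exact this.neg_neg
  have h2 : Φ.1.det * Φ.1.det = 1 := by rcases det_eq_one_or Φ with h | h <;> rw [h] <;> rfl
  refine ⟨hprim Φ, ?_, ?_⟩
  · intro d _ d' _ h
    have := congrArg (Φ.1.det • ·) h
    simp only [smul_smul, h2, one_smul] at this
    exact mulVec_injective Φ this
  · intro d hd
    refine ⟨Φ⁻¹.1.mulVec (Φ.1.det • d), ?_, ?_⟩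
    · have hd' : Φ.1.det • d ∈ primitive := by
        rcases det_eq_one_or Φ with h | h
        · rw [h, one_smul]; exact hd
        · rw [h, neg_one_smul]; exact IsCoprime.neg_neg hd
      exact isCoprime_mulVec Φ⁻¹ hd'
    · simp only [mulVec_inv_mulVec, smul_smul, h2, one_smul]

/-- The image of the boundary of a polygon is the boundary of the image, with the orientation
reversed by elements of determinant `-1`. -/
theorem loopSum_map (φ : (Fin 2 → ℤ) → Frac) (Φ : Matrix.GeneralLinearGroup (Fin 2) ℤ)
    (w : Fin 2 → ℤ) (P : LatticePolytope) :
    loopSum φ (P.map Φ w) = algebraMap PS Frac (expV w) * ∑ᶠ d ∈ primitive,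
      (Φ.1.det : Frac) * φ (Φ.1.det • Φ.1.mulVec d) *
        fracAct Φ (algebraMap PS Frac (edgeDiff d P)) := by
  rw [mul_finsum_mem, loopSum]
  symm
  refine finsum_mem_eq_of_bijOn _ (bijOn_primitive Φ) fun d hd => ?_
  rw [edgeDiff_map Φ w (ne_zero_of_isCoprime hd), fracAct_algebraMap, map_mul, map_mul, map_intCast]
  ring

theorem fracAct_loopSum (φ : (Fin 2 → ℤ) → Frac) (Φ : Matrix.GeneralLinearGroup (Fin 2) ℤ)
    (P : LatticePolytope) :
    fracAct Φ (loopSum φ P) = ∑ᶠ d ∈ primitive,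
      fracAct Φ (φ d) * fracAct Φ (algebraMap PS Frac (edgeDiff d P)) := by
  have := (fracAct Φ).toAddMonoidHom.map_finsum_mem' (finite_loopSum φ P)
  simp only [RingHom.toAddMonoidHom_eq_coe, AddMonoidHom.coe_coe, map_mul] at this
  exact this

theorem toReal_mem_edgeCone {d v : Fin 2 → ℤ} (hd : d ≠ 0) (e : Fin 2 → ℤ) (he : e = d ∨ e = -d)
    (h : crs d v < 0 ∨ crs d v = 0 ∧ 0 ≤ e 0 * v 0 + e 1 * v 1) : toReal v ∈ edgeCone d e := by
  rcases h with h | ⟨h, h'⟩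
  · left; rw [crsL_toReal]; exact_mod_cast h
  · have hce : crsL e (toReal v) = 0 := by
      rcases he with rfl | rfl
      · rw [crsL_toReal, h, Int.cast_zero]
      · rw [crsL_neg, crsL_toReal, h, Int.cast_zero, neg_zero]
    have he0 : e ≠ 0 := by
      rcases he with rfl | rfl
      · exact hd
      · exact neg_ne_zero.mpr hd
    obtain ⟨t, ht⟩ := exists_smul_of_crsL_eq_zero he0 hce
    refine Or.inr ⟨t, ?_, ht⟩
    have h0 := congrFun ht 0
    have h1 := congrFun ht 1
    simp only [toReal, Pi.smul_apply, smul_eq_mul] at h0 h1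
    have h'' : (0 : ℝ) ≤ e 0 * v 0 + e 1 * v 1 := by exact_mod_cast h'
    rw [h0, h1] at h''
    have hpos : (0 : ℝ) < e 0 * e 0 + e 1 * e 1 := by
      have : e 0 ≠ 0 ∨ e 1 ≠ 0 := by
        by_contra hc
        push Not at hc
        exact he0 (by funext i; fin_cases i; exacts [hc.1, hc.2])
      rcases this with h | h
      · have : (0 : ℝ) < e 0 * e 0 := mul_self_pos.mpr (by exact_mod_cast h)
        nlinarith [mul_self_nonneg (e 1 : ℝ)]
      · have : (0 : ℝ) < e 1 * e 1 := mul_self_pos.mpr (by exact_mod_cast h)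
        nlinarith [mul_self_nonneg (e 0 : ℝ)]
    by_contra ht0
    push Not at ht0
    nlinarith

/-- The edge of direction `d` of the convex hull of `S` is from `a` to `b` if these are extreme
among the points of `S`. -/
theorem edgeDiff_eq {P : LatticePolytope} {S : Finset (Fin 2 → ℤ)} (hP : P.carrier = latHull S)
    {d : Fin 2 → ℤ} (hd : d ≠ 0) (a b : Fin 2 → ℤ) (ha : a ∈ S) (hb : b ∈ S)
    (ha' : ∀ r ∈ S, crs d (a - r) < 0 ∨
      crs d (a - r) = 0 ∧ 0 ≤ (-d) 0 * (a - r) 0 + (-d) 1 * (a - r) 1)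
    (hb' : ∀ r ∈ S, crs d (b - r) < 0 ∨
      crs d (b - r) = 0 ∧ 0 ≤ d 0 * (b - r) 0 + d 1 * (b - r) 1) :
    edgeDiff d P = expV b - expV a := by
  have h1 := isTotalCone_edgeCone hd (Or.inl (rfl : d = d))
  have h2 := isTotalCone_edgeCone hd (Or.inr (rfl : -d = -d))
  rw [edgeDiff, edgeEnd, edgeStart,
    h1.eq_of_isTop (h1.isTop_of_finset hP hb fun r hr => toReal_sub b r ▸
      toReal_mem_edgeCone hd d (Or.inl rfl) (hb' r hr)),
    h2.eq_of_isTop (h2.isTop_of_finset hP ha fun r hr => toReal_sub a r ▸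
      toReal_mem_edgeCone hd (-d) (Or.inr rfl) (ha' r hr))]

/-! ### Equivariance of sums over boundary edges -/

theorem exists_sub_eq_of_edgeDiff_ne_zero {P : LatticePolytope} {S : Finset (Fin 2 → ℤ)}
    (hS : S.Nonempty) (hP : P.carrier = latHull S) {d : Fin 2 → ℤ} (hd : d ∈ primitive)
    (h : edgeDiff d P ≠ 0) :
    ∃ a ∈ S, ∃ b ∈ S, a ≠ b ∧ ∃ k : ℤ, 0 < k ∧ k • d = b - a := by
  have hd0 := ne_zero_of_isCoprime hd
  have hne : edgeStart d P ≠ edgeEnd d P := by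
    intro he
    exact h (by rw [edgeDiff, he, sub_self])
  obtain ⟨k, hk, e⟩ := edgeEnd_sub_edgeStart hd P
  refine ⟨_, (isTotalCone_edgeCone hd0 (Or.inr rfl)).top_mem hS hP, _,
    (isTotalCone_edgeCone hd0 (Or.inl rfl)).top_mem hS hP, hne, k, lt_of_le_of_ne hk ?_, e.symm⟩
  rintro rfl
  rw [zero_smul, sub_eq_zero] at e
  exact hne e.symm

theorem loopSum_origin (φ : (Fin 2 → ℤ) → Frac) : loopSum φ origin = 0 := by
  rw [loopSum]
  refine finsum_mem_of_eqOn_zero fun d hd => ?_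
  by_contra h
  have hne : edgeDiff d origin ≠ 0 := fun h0 => h (by simp [h0])
  obtain ⟨a, ha, b, hb, hab, -⟩ :=
    exists_sub_eq_of_edgeDiff_ne_zero (by simp) origin_carrier hd hne
  rw [Finset.mem_singleton] at ha hb
  exact hab (ha.trans hb.symm)

/-- A sum over the edges as a sum over a finite set of directions that contains the primitive
direction of each difference of vertices. -/
theorem loopSum_eq_sum (φ : (Fin 2 → ℤ) → Frac) {P : LatticePolytope} {S : Finset (Fin 2 → ℤ)}
    (hS : S.Nonempty) (hP : P.carrier = latHull S) (D : Finset (Fin 2 → ℤ))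
    (hD : ∀ d ∈ D, d ∈ primitive)
    (h : ∀ a ∈ S, ∀ b ∈ S, a ≠ b → b - a ∈ D) :
    loopSum φ P = ∑ d ∈ D, φ d * algebraMap PS Frac (edgeDiff d P) := by
  rw [loopSum]
  apply finsum_mem_eq_sum_of_inter_support_eq
  ext d
  simp only [Set.mem_inter_iff, Function.mem_support, Finset.mem_coe, and_congr_left_iff]
  intro hne
  refine ⟨fun hd => ?_, hD d⟩
  have hne : edgeDiff d P ≠ 0 := fun h0 => hne (by simp [h0])
  obtain ⟨a, ha, b, hb, hab, k, hk, e⟩ := exists_sub_eq_of_edgeDiff_ne_zero hS hP hd hne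
  have hmem := h a ha b hb hab
  rw [eq_of_smul_eq_smul hd (hD _ hmem) hk one_pos (by rw [e, one_smul])]
  exact hmem

theorem loopSum_unitSegment (φ : (Fin 2 → ℤ) → Frac) :
    loopSum φ unitSegment =
      (φ ![1, 0] - φ ![-1, 0]) * algebraMap PS Frac (expV ![1, 0] - 1) := by
  rw [loopSum_eq_sum φ (by simp) unitSegment_carrier {![1, 0], ![-1, 0]} ?_ (by decide),
    Finset.sum_insert (by decide), Finset.sum_singleton,
    edgeDiff_eq unitSegment_carrier (by decide) 0 ![1, 0] (by decide) (by decide) (by decide)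
      (by decide),
    edgeDiff_eq unitSegment_carrier (by decide) ![1, 0] 0 (by decide) (by decide) (by decide)
      (by decide), expV_zero, map_sub, map_sub]
  · ring
  · intro d hd
    simp only [Finset.mem_insert, Finset.mem_singleton] at hd
    rcases hd with rfl | rfl
    exacts [⟨1, 0, by decide⟩, ⟨-1, 0, by decide⟩]

theorem loopSum_stdTriangle (φ : (Fin 2 → ℤ) → Frac) :
    loopSum φ stdTriangle = φ ![1, 0] * algebraMap PS Frac (expV ![1, 0] - 1) +
      φ ![-1, 1] * algebraMap PS Frac (expV ![0, 1] - expV ![1, 0]) +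
      φ ![0, -1] * algebraMap PS Frac (1 - expV ![0, 1]) := by
  rw [loopSum_eq_sum φ (by simp) stdTriangle_carrier
    {![1, 0], ![-1, 1], ![0, -1], ![-1, 0], ![1, -1], ![0, 1]} ?_ (by decide),
    Finset.sum_insert (by decide), Finset.sum_insert (by decide), Finset.sum_insert (by decide),
    Finset.sum_insert (by decide), Finset.sum_insert (by decide), Finset.sum_singleton,
    edgeDiff_eq stdTriangle_carrier (by decide) 0 ![1, 0] (by decide) (by decide) (by decide)
      (by decide),
    edgeDiff_eq stdTriangle_carrier (by decide) ![1, 0] ![0, 1] (by decide) (by decide) (by decide)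
      (by decide),
    edgeDiff_eq stdTriangle_carrier (by decide) ![0, 1] 0 (by decide) (by decide) (by decide)
      (by decide),
    edgeDiff_eq stdTriangle_carrier (by decide) ![0, 1] ![0, 1] (by decide) (by decide) (by decide)
      (by decide),
    edgeDiff_eq stdTriangle_carrier (by decide) 0 0 (by decide) (by decide) (by decide)
      (by decide),
    edgeDiff_eq stdTriangle_carrier (by decide) ![1, 0] ![1, 0] (by decide) (by decide) (by decide)
      (by decide), expV_zero, sub_self, sub_self, sub_self, map_zero]
  · ring
  · intro d hd
    simp only [Finset.mem_insert, Finset.mem_singleton] at hd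
    rcases hd with rfl | rfl | rfl | rfl | rfl | rfl
    exacts [⟨1, 0, by decide⟩, ⟨0, 1, by decide⟩, ⟨0, -1, by decide⟩, ⟨-1, 0, by decide⟩,
      ⟨1, 0, by decide⟩, ⟨0, 1, by decide⟩]

theorem det_mul_det (Φ : Matrix.GeneralLinearGroup (Fin 2) ℤ) :
    (Φ.1.det : Frac) * (Φ.1.det : Frac) = 1 := by
  rcases det_eq_one_or Φ with h | h <;> rw [h] <;> norm_num

/-- The boundary of a polygon is a closed loop. -/
theorem loopSum_one (P : LatticePolytope) : loopSum (fun _ => 1) P = 0 := by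
  -- the property is preserved by affine maps and holds for the unimodular simplices
  have hmap : ∀ Φ w P, loopSum (fun _ => 1) P = 0 →
      loopSum (fun _ => 1) (LatticePolytope.map Φ w P) = 0 := by
    intro Φ w P h
    have h1 := fracAct_loopSum (fun _ => 1) Φ P
    rw [h, map_zero] at h1
    rw [loopSum_map]
    have : ∀ d, (Φ.1.det : Frac) * 1 * fracAct Φ (algebraMap PS Frac (edgeDiff d P)) =
        (Φ.1.det : Frac) * (fracAct Φ 1 * fracAct Φ (algebraMap PS Frac (edgeDiff d P))) := by
      intro d; rw [map_one]; ring
    simp only [this]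
    rw [← mul_finsum_mem, ← h1, mul_zero, mul_zero]
  rw [← AddSubgroup.mem_bot (G := Frac)]
  refine (isVal_loopSum _).mem ?_ ?_ ?_ P <;> intro Φ w <;> rw [AddSubgroup.mem_bot] <;>
    apply hmap
  · exact loopSum_origin _
  · rw [loopSum_unitSegment]; ring
  · rw [loopSum_stdTriangle, map_sub, map_sub, map_sub]; ring

/-- If `φ` is equivariant up to a sign and up to constants, then the sum over the edges is
equivariant, because the constants cancel on closed loops. -/
theorem loopSum_equivariant {φ : (Fin 2 → ℤ) → Frac}
    {κ : Matrix.GeneralLinearGroup (Fin 2) ℤ → Frac}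
    (h : ∀ (Φ : Matrix.GeneralLinearGroup (Fin 2) ℤ), ∀ d ∈ primitive,
      φ (Φ.1.det • Φ.1.mulVec d) = Φ.1.det * fracAct Φ (φ d) + κ Φ)
    (Φ : Matrix.GeneralLinearGroup (Fin 2) ℤ) (w : Fin 2 → ℤ) (P : LatticePolytope) :
    loopSum φ (P.map Φ w) = algebraMap PS Frac (expV w) * fracAct Φ (loopSum φ P) := by
  have hclosed : ∑ᶠ d ∈ primitive, fracAct Φ (algebraMap PS Frac (edgeDiff d P)) = 0 := by
    have h1 := fracAct_loopSum (fun _ => 1) Φ P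
    rw [loopSum_one, map_zero] at h1
    simpa using h1.symm
  have hfin : ∀ c : (Fin 2 → ℤ) → Frac, (primitive ∩ Function.support fun d =>
      c d * fracAct Φ (algebraMap PS Frac (edgeDiff d P))).Finite := by
    intro c
    refine (finite_edgeDiff_ne_zero P).subset ?_
    rintro d ⟨hd, h⟩
    refine ⟨hd, fun h0 => h ?_⟩
    simp only [h0, map_zero, mul_zero]
  rw [loopSum_map, fracAct_loopSum]
  congr 1
  have hterm : ∀ d ∈ primitive, (Φ.1.det : Frac) * φ (Φ.1.det • Φ.1.mulVec d) *
      fracAct Φ (algebraMap PS Frac (edgeDiff d P)) =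
      fracAct Φ (φ d) * fracAct Φ (algebraMap PS Frac (edgeDiff d P)) +
        (Φ.1.det * κ Φ) * fracAct Φ (algebraMap PS Frac (edgeDiff d P)) := by
    intro d hd
    rw [h Φ d hd]
    linear_combination (fracAct Φ (φ d) * fracAct Φ (algebraMap PS Frac (edgeDiff d P))) *
      det_mul_det Φ
  rw [finsum_mem_congr rfl hterm, finsum_mem_add_distrib' (hfin _) (hfin _), ← mul_finsum_mem,
    hclosed, mul_zero, add_zero]

theorem algebraMap_injective : Function.Injective (algebraMap PS Frac) :=
  IsFractionRing.injective PS Frac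

/-- An equivariant valuation with values in the field of fractions takes values in `ℚ[[x,y]]` if its
values on unimodular simplices are power series. -/
theorem exists_equivariantValuation {W : LatticePolytope → Frac} (hW : IsVal W)
    (hE : ∀ Φ w P, W (LatticePolytope.map Φ w P) = algebraMap PS Frac (expV w) * fracAct Φ (W P))
    {f₀ f₁ f₂ : PS} (h₀ : W origin = algebraMap PS Frac f₀)
    (h₁ : W unitSegment = algebraMap PS Frac f₁) (h₂ : W stdTriangle = algebraMap PS Frac f₂) :
    ∃ Z : LatticePolytope → PS, IsEquivariantValuation Z ∧ Z origin = f₀ ∧ Z unitSegment = f₁ ∧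
      Z stdTriangle = f₂ := by
  have hmem : ∀ P, W P ∈ (algebraMap PS Frac).toAddMonoidHom.range := by
    have hmap : ∀ P f, W P = algebraMap PS Frac f → ∀ Φ w,
        W (LatticePolytope.map Φ w P) ∈ (algebraMap PS Frac).toAddMonoidHom.range := by
      intro P f h Φ w
      refine ⟨expV w * linAct Φ f, ?_⟩
      rw [hE, h, fracAct_algebraMap, ← map_mul]
      rfl
    exact hW.mem (hmap _ _ h₀) (hmap _ _ h₁) (hmap _ _ h₂)
  choose Z hZ using hmem
  have hZ' : ∀ P, algebraMap PS Frac (Z P) = W P := hZ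
  refine ⟨Z, ⟨(isVal_iff Z).mp ?_, ?_⟩, ?_, ?_, ?_⟩
  · intro P Q U I hU hI
    apply algebraMap_injective
    rw [map_add, map_add, hZ', hZ', hZ', hZ', hW P Q U I hU hI]
  · intro Φ w P
    apply algebraMap_injective
    rw [hZ', hE, ← hZ', affAct_eq, map_mul, fracAct_algebraMap]
  · exact algebraMap_injective ((hZ' _).trans h₀)
  · exact algebraMap_injective ((hZ' _).trans h₁)
  · exact algebraMap_injective ((hZ' _).trans h₂)

/-! ### Power series in one variable and shears -/

/-- The power series `h` with `h(t) = exp(t) h(-t)`, which are the values of equivariant valuations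
on the unit segment. -/
def IsSegmentSymm (h : PowerSeries ℚ) : Prop :=
  h = PowerSeries.exp ℚ * PowerSeries.rescale (-1) h

/-- The power series `g(t²) exp(t / 2)`. -/
def segmentSeries1 (g : PowerSeries ℚ) : PowerSeries ℚ :=
  PowerSeries.subst (PowerSeries.X ^ 2 : PowerSeries ℚ) g *
    PowerSeries.rescale (1 / 2) (PowerSeries.exp ℚ)

theorem rescale_subst_X_sq (g : PowerSeries ℚ) :
    PowerSeries.rescale (-1) (PowerSeries.subst (PowerSeries.X ^ 2 : PowerSeries ℚ) g) =
      PowerSeries.subst (PowerSeries.X ^ 2 : PowerSeries ℚ) g := by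
  ext n
  rw [PowerSeries.coeff_rescale, PowerSeries.coeff_subst_X_pow two_ne_zero]
  split_ifs with h
  · rw [(even_iff_two_dvd.mpr h).neg_one_pow, one_mul]
  · rw [mul_zero]

theorem isSegmentSymm_segmentSeries1 (g : PowerSeries ℚ) : IsSegmentSymm (segmentSeries1 g) := by
  have h1 := PowerSeries.exp_mul_exp_eq_exp_add (A := ℚ) 1 (-1 / 2)
  rw [PowerSeries.rescale_one, RingHom.id_apply] at h1
  rw [IsSegmentSymm, segmentSeries1, map_mul, rescale_subst_X_sq, PowerSeries.rescale_rescale,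
    mul_left_comm]
  norm_num at h1 ⊢
  exact Or.inl h1.symm

/-- The power series `exp(-t / 2) h(t)` is even. -/
theorem IsSegmentSymm.exists_eq {h : PowerSeries ℚ} (hh : IsSegmentSymm h) :
    ∃ g, h = segmentSeries1 g := by
  set k := h * PowerSeries.rescale (-1 / 2) (PowerSeries.exp ℚ) with hk
  have h1 := PowerSeries.exp_mul_exp_eq_exp_add (A := ℚ) 1 (-1 / 2)
  have h2 := PowerSeries.exp_mul_exp_eq_exp_add (A := ℚ) (-1 / 2) (1 / 2)
  rw [PowerSeries.rescale_one, RingHom.id_apply] at h1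
  have heven : PowerSeries.rescale (-1) k = k := by
    conv_rhs => rw [hk, hh]
    rw [hk, map_mul, PowerSeries.rescale_rescale]
    norm_num at h1 ⊢
    rw [mul_right_comm, h1, mul_comm]
  refine ⟨PowerSeries.mk fun n => PowerSeries.coeff (2 * n) k, ?_⟩
  have hsub : PowerSeries.subst (PowerSeries.X ^ 2 : PowerSeries ℚ)
      (PowerSeries.mk fun n => PowerSeries.coeff (2 * n) k) = k := by
    ext n
    rw [PowerSeries.coeff_subst_X_pow two_ne_zero]
    split_ifs with hn
    · rw [PowerSeries.coeff_mk, Nat.mul_div_cancel' hn]; rfl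
    · have := congrArg (PowerSeries.coeff n) heven
      rw [PowerSeries.coeff_rescale,
        (Nat.not_even_iff_odd.mp (fun he => hn he.two_dvd)).neg_one_pow] at this
      linarith
  rw [segmentSeries1, hsub, hk, mul_assoc, h2]
  norm_num

theorem segmentSeries_eq (g : PowerSeries ℚ) :
    segmentSeries g = linSub1 ![1, 0] (segmentSeries1 g) := by
  have hx : PowerSeries.HasSubst (x : PS) := x_eq_lin ▸ hasSubst_lin_one _
  rw [segmentSeries1, map_mul, linSub1_eq, linSub1_eq, ← x_eq_lin, segmentSeries]
  congr 1
  · rw [sub1, sub1, PowerSeries.subst_comp_subst_apply (PowerSeries.HasSubst.X_pow two_ne_zero) hx,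
      PowerSeries.subst_pow hx, PowerSeries.subst_X hx]
  · rw [expS, sub1, sub1, PowerSeries.rescale_eq_subst,
      PowerSeries.subst_comp_subst_apply (PowerSeries.HasSubst.smul_X' _) hx,
      PowerSeries.subst_smul hx, PowerSeries.subst_X hx]

theorem linSub1_injective : Function.Injective (linSub1 ![1, 0]) := by
  intro f g h
  ext n
  have := congrArg (MvPowerSeries.coeff (Finsupp.single 0 n)) h
  rw [linSub1_eq, linSub1_eq, ← x_eq_lin, sub1, sub1, x, PowerSeries.coeff_subst_single,
    PowerSeries.coeff_subst_single] at this
  simpa using this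

theorem linSub1_rescale_neg_one (v : Fin 2 → ℤ) (h : PowerSeries ℚ) :
    linSub1 v (PowerSeries.rescale (-1) h) = linSub1 (-v) h := by
  rw [linSub1_eq, linSub1_eq, sub1, sub1, PowerSeries.rescale_eq_subst,
    PowerSeries.subst_comp_subst_apply (PowerSeries.HasSubst.smul_X' _) (hasSubst_lin_one v),
    PowerSeries.subst_smul (hasSubst_lin_one v), PowerSeries.subst_X (hasSubst_lin_one v), lin_neg,
    neg_one_smul]

theorem isSegmentSymm_iff (h : PowerSeries ℚ) :
    IsSegmentSymm h ↔ linSub1 ![1, 0] h = expV ![1, 0] * linSub1 ![-1, 0] h := by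
  have : linSub1 ![1, 0] (PowerSeries.exp ℚ * PowerSeries.rescale (-1) h) =
      expV ![1, 0] * linSub1 ![-1, 0] h := by
    rw [map_mul, linSub1_rescale_neg_one]; simp [expV]
  rw [IsSegmentSymm, ← linSub1_injective.eq_iff, this]

theorem IsSegmentSymm.linSub1_eq {h : PowerSeries ℚ} (hh : IsSegmentSymm h) (v : Fin 2 → ℤ) :
    linSub1 v h = expV v * linSub1 (-v) h := by
  conv_lhs => rw [hh]
  rw [map_mul, linSub1_rescale_neg_one]; rfl

/-- The coefficients of the image of a monomial under the shear `y ↦ x + y`. -/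
theorem coeff_shear (d e : Fin 2 →₀ ℕ) :
    MvPowerSeries.coeff e (x ^ d 0 * (x + y) ^ d 1) =
      if d 0 ≤ e 0 ∧ e 0 + e 1 = d 0 + d 1 then ((d 1).choose (e 1) : ℚ) else 0 := by
  have h : x ^ d 0 * (x + y) ^ d 1 =
      ((MvPolynomial.monomial (Finsupp.single 0 (d 0)) (1 : ℚ) *
        (MvPolynomial.X 0 + MvPolynomial.X 1) ^ d 1 : MvPolynomial (Fin 2) ℚ) : PS) := by
    rw [← MvPolynomial.X_pow_eq_monomial]
    push_cast
    rfl
  rw [h, MvPolynomial.coeff_coe, MvPolynomial.coeff_monomial_mul', MvPolynomial.coeff_add_pow]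
  have hsub0 : (e - Finsupp.single 0 (d 0) : Fin 2 →₀ ℕ) 0 = e 0 - d 0 := by simp
  have hsub1 : (e - Finsupp.single 0 (d 0) : Fin 2 →₀ ℕ) 1 = e 1 := by simp
  rw [hsub0, hsub1]
  simp only [Finsupp.single_le_iff]
  by_cases h0 : d 0 ≤ e 0
  · by_cases h1 : e 0 + e 1 = d 0 + d 1
    · have h2 : e 0 - d 0 + e 1 = d 1 := by omega
      rw [if_pos h0, if_pos (Finset.HasAntidiagonal.mem_antidiagonal.mpr h2),
        if_pos (And.intro h0 h1), one_mul, Nat.cast_inj, ← h2]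
      exact Nat.choose_symm_add
    · rw [if_pos h0, if_neg, if_neg (fun h => h1 (And.right h)), Nat.cast_zero, mul_zero]
      intro h
      have h2 : e 0 - d 0 + e 1 = d 1 := Finset.HasAntidiagonal.mem_antidiagonal.mp h
      omega
  · rw [if_neg h0, if_neg (fun h => h0 (And.left h))]

/-- Power series that are invariant under the shear `y ↦ x + y` are power series in `x`. -/
theorem exists_linSub1_eq_of_shear {f : PS} (hf : linSub ![1, 0] ![1, 1] f = f) :
    ∃ h, f = linSub1 ![1, 0] h := by
  have hexp : ∀ e, MvPowerSeries.coeff e f = ∑ᶠ d : Fin 2 →₀ ℕ, MvPowerSeries.coeff d f •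
      MvPowerSeries.coeff e (x ^ d 0 * (x + y) ^ d 1) := by
    intro e
    conv_lhs => rw [← hf, linSub_eq, sub, MvPowerSeries.coeff_subst (hasSubst_lin _ _)]
    refine finsum_congr fun d => ?_
    congr 2
    rw [Finsupp.prod_fintype _ _ (by simp), Fin.prod_univ_two]
    simp [lin]
  -- Induction on the exponent `m` of `x`: in the coefficient of `x^(m+1) y^n` of `f(x, x + y)`,
  -- only the monomials `x^m y^(n+1)` and `x^(m+1) y^n` of `f` remain, and the first one has the
  -- factor `n + 1`.
  have key : ∀ m : ℕ, ∀ d : Fin 2 →₀ ℕ, d 0 = m → d 1 ≠ 0 → MvPowerSeries.coeff d f = 0 := by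
    intro m
    induction m using Nat.strong_induction_on with
    | _ m ih =>
    intro d hd0 hd1
    obtain ⟨n, hn⟩ := Nat.exists_eq_succ_of_ne_zero hd1
    set e : Fin 2 →₀ ℕ := Finsupp.single 0 (m + 1) + Finsupp.single 1 n with he
    have he0 : e 0 = m + 1 := by simp [he]
    have he1 : e 1 = n := by simp [he]
    have hde : d ≠ e := fun h => by rw [h] at hd0; omega
    have h := hexp e
    rw [finsum_eq_sum_of_support_subset (s := {d, e}) _ ?_, Finset.sum_pair hde, coeff_shear,
      coeff_shear, if_pos ⟨by omega, by omega⟩, if_pos ⟨by omega, by omega⟩, he1, hn,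
      Nat.choose_self] at h
    · simp only [smul_eq_mul, Nat.cast_one, mul_one, right_eq_add, mul_eq_zero, Nat.cast_eq_zero,
        Nat.succ_eq_add_one, Nat.choose_succ_self_right] at h
      exact h.resolve_right (by omega)
    · intro b hb
      simp only [Function.mem_support, coeff_shear] at hb
      split_ifs at hb with hc
      · rcases Nat.lt_or_ge (b 0) m with hlt | hge
        · exact absurd (by rw [ih _ hlt b rfl (by omega), zero_smul]) hb
        · have : b 0 = m ∨ b 0 = m + 1 := by omega
          rcases this with h | h
          · have : b = d := by ext i; fin_cases i <;> simp <;> omega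
            simp [this]
          · have : b = e := by ext i; fin_cases i <;> simp <;> omega
            simp [this]
      · simp at hb
  refine ⟨PowerSeries.mk fun n => MvPowerSeries.coeff (Finsupp.single 0 n) f, ?_⟩
  ext e
  rw [linSub1_eq, ← x_eq_lin, sub1, x, PowerSeries.coeff_subst_single]
  split_ifs with h
  · rw [PowerSeries.coeff_mk, ← h]
  · apply key (e 0) e rfl
    intro h1
    apply h
    ext i; fin_cases i
    · simp
    · simpa using h1

theorem linSub1_zero (h : PowerSeries ℚ) :
    linSub1 0 h = MvPowerSeries.C (PowerSeries.constantCoeff h) := by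
  rw [linSub1_eq, sub1, lin_zero, PowerSeries.subst_zero_eq_C_constantCoeff]
  simp

/-- The power series `f` is divisible by `y` if `f(x, 0) = 0`. -/
theorem y_dvd_of_linSub_eq_zero {f : PS} (hf : linSub ![1, 0] 0 f = 0) : y ∣ f := by
  rw [y, MvPowerSeries.X_dvd_iff]
  intro e he
  have h := congrArg (MvPowerSeries.coeff e) hf
  rw [linSub_eq, sub, MvPowerSeries.coeff_subst (hasSubst_lin _ _), finsum_eq_single _ e] at h
  · rw [Finsupp.prod_fintype _ _ (by simp), Fin.prod_univ_two, he] at h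
    have h2 : MvPowerSeries.coeff e (MvPowerSeries.X (0 : Fin 2) ^ e 0 : PS) = 1 := by
      rw [MvPowerSeries.coeff_X_pow, if_pos]
      ext i; fin_cases i
      · simp
      · simpa using he
    simpa [lin, x, h2] using h
  · intro d hd
    rw [Finsupp.prod_fintype _ _ (by simp), Fin.prod_univ_two]
    by_cases hd1 : d 1 = 0
    · have h2 : MvPowerSeries.coeff e (MvPowerSeries.X (0 : Fin 2) ^ d 0 : PS) = 0 := by
        rw [MvPowerSeries.coeff_X_pow, if_neg]
        rintro rfl
        apply hd
        ext i; fin_cases i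
        · simp
        · simpa using hd1
      simp [lin, x, hd1, h2]
    · simp [hd1]

/-! ### Values on points and segments -/

theorem map_eq_of_image_eq {Φ : Matrix.GeneralLinearGroup (Fin 2) ℤ} {w : Fin 2 → ℤ}
    {P Q : LatticePolytope} {S S' : Finset (Fin 2 → ℤ)} (hP : P.carrier = latHull S)
    (hQ : Q.carrier = latHull S') (h : (S.image fun p => Φ.1.mulVec p + w) = S') :
    P.map Φ w = Q := by
  apply LatticePolytope.ext
  rw [map_carrier_latHull Φ w hP, h, hQ]

/-- The reflection that exchanges the coordinates. -/
def swapGL : Matrix.GeneralLinearGroup (Fin 2) ℤ :=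
  ⟨!![0, 1; 1, 0], !![0, 1; 1, 0], by decide, by decide⟩

/-- The reflection that changes the sign of the second coordinate. -/
def conjGL : Matrix.GeneralLinearGroup (Fin 2) ℤ :=
  ⟨!![1, 0; 0, -1], !![1, 0; 0, -1], by decide, by decide⟩

/-- The reflection that changes the sign of the first coordinate. -/
def negFstGL : Matrix.GeneralLinearGroup (Fin 2) ℤ :=
  ⟨!![-1, 0; 0, 1], !![-1, 0; 0, 1], by decide, by decide⟩

/-- The shear that fixes `e₁` and maps `e₂` to `e₁ + e₂`. -/
def shearGL : Matrix.GeneralLinearGroup (Fin 2) ℤ :=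
  ⟨!![1, 1; 0, 1], !![1, -1; 0, 1], by decide, by decide⟩

theorem linAct_swapGL (f : PS) : linAct swapGL f = linSub ![0, 1] ![1, 0] f := linAct_eq _ _

theorem linAct_conjGL (f : PS) : linAct conjGL f = linSub ![1, 0] ![0, -1] f := linAct_eq _ _

theorem linAct_shearGL (f : PS) : linAct shearGL f = linSub ![1, 0] ![1, 1] f := linAct_eq _ _

theorem IsEquivariantValuation.add {Z Z' : LatticePolytope → PS} (hZ : IsEquivariantValuation Z)
    (hZ' : IsEquivariantValuation Z') : IsEquivariantValuation (Z + Z') := by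
  refine ⟨fun P Q U I hc hU hI => ?_, fun Φ w P => ?_⟩
  · have h1 := hZ.1 P Q U I hc hU hI
    have h2 := hZ'.1 P Q U I hc hU hI
    simp only [Pi.add_apply]
    linear_combination h1 + h2
  · rw [Pi.add_apply, hZ.2, hZ'.2, Pi.add_apply]
    simp only [affAct_eq, ← linActHom_apply, map_add]
    ring

theorem IsEquivariantValuation.smul {Z : LatticePolytope → PS} (hZ : IsEquivariantValuation Z)
    (c : ℚ) : IsEquivariantValuation (c • Z) := by
  refine ⟨fun P Q U I hc hU hI => ?_, fun Φ w P => ?_⟩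
  · simp only [Pi.smul_apply]
    rw [← smul_add, hZ.1 P Q U I hc hU hI, smul_add]
  · rw [Pi.smul_apply, hZ.2, Pi.smul_apply]
    simp only [affAct_eq, ← linActHom_apply, map_smul]
    rw [mul_smul_comm]

theorem IsEquivariantValuation.sub {Z Z' : LatticePolytope → PS} (hZ : IsEquivariantValuation Z)
    (hZ' : IsEquivariantValuation Z') : IsEquivariantValuation (Z - Z') := by
  have := hZ.add (hZ'.smul (-1))
  rwa [neg_one_smul, ← sub_eq_add_neg] at this

theorem IsEquivariantValuation.linAct_eq_of_map_eq {Z : LatticePolytope → PS}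
    (hZ : IsEquivariantValuation Z) {Φ : Matrix.GeneralLinearGroup (Fin 2) ℤ}
    {w : Fin 2 → ℤ} {P Q : LatticePolytope} (h : P.map Φ w = Q) :
    expV w * linAct Φ (Z P) = Z Q := by
  rw [← affAct_eq, ← hZ.2, h]

/-- The value at the origin is constant because it is invariant under `GL(2,ℤ)`. -/
theorem IsEquivariantValuation.exists_origin_eq {Z : LatticePolytope → PS}
    (hZ : IsEquivariantValuation Z) : ∃ c : ℚ, Z origin = MvPowerSeries.C c := by
  have hinv : ∀ Φ, linAct Φ (Z origin) = Z origin := by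
    intro Φ
    have := hZ.linAct_eq_of_map_eq (Φ := Φ) (w := 0)
      (map_eq_of_image_eq origin_carrier origin_carrier (by simp))
    rwa [expV_zero, one_mul] at this
  obtain ⟨h, hh⟩ := exists_linSub1_eq_of_shear ((linAct_shearGL _).symm.trans (hinv shearGL))
  have h2 := hinv swapGL
  rw [hh, linAct_swapGL, linSub_linSub1] at h2
  -- `h(x) = h(y)`, and `y = 0` gives the claim
  have h3 := congrArg (linSub ![1, 0] 0) h2
  rw [linSub_linSub1, linSub_linSub1] at h3
  simp at h3
  rw [linSub1_zero] at h3
  exact ⟨_, hh.trans h3.symm⟩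

/-- The value on `[o, e₁]` is a power series in `x` by invariance under a shear, and the reflection
of the segment at its midpoint gives the functional equation. -/
theorem IsEquivariantValuation.exists_unitSegment_eq {Z : LatticePolytope → PS}
    (hZ : IsEquivariantValuation Z) :
    ∃ h : PowerSeries ℚ, IsSegmentSymm h ∧ Z unitSegment = linSub1 ![1, 0] h := by
  have h1 := hZ.linAct_eq_of_map_eq (Φ := shearGL) (w := 0)
    (map_eq_of_image_eq unitSegment_carrier unitSegment_carrier (by decide))
  rw [expV_zero, one_mul, linAct_shearGL] at h1
  obtain ⟨h, hh⟩ := exists_linSub1_eq_of_shear h1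
  refine ⟨h, ?_, hh⟩
  have h2 := hZ.linAct_eq_of_map_eq (Φ := negFstGL) (w := ![1, 0])
    (map_eq_of_image_eq unitSegment_carrier unitSegment_carrier (by decide))
  have h3 : negFstGL.1.mulVec ![1, 0] = ![-1, 0] := by decide
  rw [hh, linAct_linSub1, h3] at h2
  exact (isSegmentSymm_iff h).mpr h2.symm

theorem boundaryPart_linSub1 (h : PowerSeries ℚ) : boundaryPart (linSub1 ![1, 0] h) =
    (1 / 2 : ℚ) • linSub1 ![1, 0] h + (1 / 2 : ℚ) • linSub1 ![0, 1] h +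
      (1 / 2 : ℚ) • (expV ![1, 0] * linSub1 ![-1, 1] h) := by
  have hx : -x = lin ![-1, 0] := by simp [lin]
  have hyx : lin ![-1, 0] + y = lin ![-1, 1] := by simp [lin]
  rw [boundaryPart, hx, hyx, y_eq_lin, x_eq_lin, expS_lin, ← linSub_eq, ← linSub_eq,
    linSub_linSub1, linSub_linSub1]
  simp

/-- The function `h(d) / (2 (e^d - 1))` of a direction `d`. It is odd and has no further
constraints, and its sum over the edges has the value `h` on the unit segment. -/
def segmentSymbol (h : PowerSeries ℚ) (d : Fin 2 → ℤ) : Frac :=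
  algebraMap PS Frac (linSub1 d h) / (2 * algebraMap PS Frac (expV d - 1))

theorem two_ne_zero_frac : (2 : Frac) ≠ 0 := by
  have := algebraRat.charZero Frac
  exact two_ne_zero

theorem algebraMap_expV_sub_one_ne_zero {d : Fin 2 → ℤ} (hd : d ≠ 0) :
    algebraMap PS Frac (expV d - 1) ≠ 0 :=
  fun h => expV_sub_one_ne_zero hd (algebraMap_injective (h.trans (map_zero _).symm))

theorem segmentSymbol_mul {h : PowerSeries ℚ} {d : Fin 2 → ℤ} (hd : d ≠ 0) :
    segmentSymbol h d * algebraMap PS Frac (expV d - 1) =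
      algebraMap PS Frac ((1 / 2 : ℚ) • linSub1 d h) := by
  have h1 := algebraMap_expV_sub_one_ne_zero hd
  have h2 : (2 : Frac) * algebraMap PS Frac ((1 / 2 : ℚ) • linSub1 d h) =
      algebraMap PS Frac (linSub1 d h) := by
    rw [two_mul, ← map_add, ← add_smul]
    norm_num
  rw [segmentSymbol, ← h2, mul_div_mul_left _ _ two_ne_zero_frac, div_mul_cancel₀ _ h1]

theorem segmentSymbol_neg {h : PowerSeries ℚ} (hh : IsSegmentSymm h) {d : Fin 2 → ℤ} (hd : d ≠ 0) :
    segmentSymbol h (-d) = -segmentSymbol h d := by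
  have h1 := algebraMap_expV_sub_one_ne_zero hd
  have h2 := algebraMap_expV_sub_one_ne_zero (neg_ne_zero.mpr hd)
  have h3 : expV d * expV (-d) = 1 := by rw [← expV_add, add_neg_cancel, expV_zero]
  have h4 := congrArg (algebraMap PS Frac) (hh.linSub1_eq d)
  have h5 := congrArg (algebraMap PS Frac) h3
  rw [map_mul] at h4 h5
  rw [map_one] at h5
  rw [segmentSymbol, segmentSymbol, ← neg_div, div_eq_div_iff (mul_ne_zero two_ne_zero_frac h2)
    (mul_ne_zero two_ne_zero_frac h1), h4,
    map_sub, map_sub, map_one]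
  linear_combination 2 * algebraMap PS Frac (linSub1 (-d) h) * h5

theorem fracAct_segmentSymbol (h : PowerSeries ℚ) (Φ : Matrix.GeneralLinearGroup (Fin 2) ℤ)
    (d : Fin 2 → ℤ) : fracAct Φ (segmentSymbol h d) = segmentSymbol h (Φ.1.mulVec d) := by
  rw [segmentSymbol, map_div₀, map_mul, map_ofNat, fracAct_algebraMap, fracAct_algebraMap,
    linAct_linSub1, ← linActHom_apply, map_sub, map_one, linActHom_apply, linAct_expV]
  rfl

/-- Equivariant valuations with prescribed values on the segment and the value `0` at the
origin, obtained from half of the value on each boundary edge of a polygon. -/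
theorem IsSegmentSymm.exists_valuation {h : PowerSeries ℚ} (hh : IsSegmentSymm h) :
    ∃ Z, IsEquivariantValuation Z ∧ Z origin = 0 ∧ Z unitSegment = linSub1 ![1, 0] h ∧
      Z stdTriangle = boundaryPart (linSub1 ![1, 0] h) := by
  refine exists_equivariantValuation (isVal_loopSum (segmentSymbol h))
    (loopSum_equivariant (κ := 0) ?_) ?_ ?_ ?_
  · intro Φ d hd
    have hd0 := ne_zero_of_isCoprime (isCoprime_mulVec Φ hd)
    rw [fracAct_segmentSymbol]
    rcases det_eq_one_or Φ with h1 | h1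
    · rw [h1]; simp
    · rw [h1, neg_one_smul, segmentSymbol_neg hh hd0]; simp
  · rw [loopSum_origin, map_zero]
  · have h1 : (![-1, 0] : Fin 2 → ℤ) = -![1, 0] := by decide
    rw [loopSum_unitSegment, h1, segmentSymbol_neg hh (by decide), sub_neg_eq_add, add_mul,
      segmentSymbol_mul (by decide), ← map_add, ← add_smul]
    norm_num
  · have h1 : (![0, -1] : Fin 2 → ℤ) = -![0, 1] := by decide
    have h2 : expV ![0, 1] - expV ![1, 0] = expV ![1, 0] * (expV ![-1, 1] - 1) := by
      rw [mul_sub, ← expV_add]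
      norm_num
    have h3 : (1 : PS) - expV ![0, 1] = -(expV ![0, 1] - 1) := by ring
    rw [loopSum_stdTriangle, h1, segmentSymbol_neg hh (by decide), h2, h3, map_neg, neg_mul_neg,
      map_mul, mul_left_comm, segmentSymbol_mul (by decide), segmentSymbol_mul (by decide),
      segmentSymbol_mul (by decide), ← map_mul, ← map_add, ← map_add, boundaryPart_linSub1,
      mul_smul_comm]
    congr 1
    ring

theorem isSegmentSymm_one_add_exp : IsSegmentSymm (1 + PowerSeries.exp ℚ) := by
  rw [isSegmentSymm_iff, map_add, map_add, map_one, map_one]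
  change 1 + expV _ = expV _ * (1 + expV _)
  have h : (![1, 0] + ![-1, 0] : Fin 2 → ℤ) = 0 := by decide
  rw [mul_add, ← expV_add, h, expV_zero, mul_one, add_comm]

theorem IsSegmentSymm.sub_smul {h k : PowerSeries ℚ} (hh : IsSegmentSymm h) (hk : IsSegmentSymm k)
    (c : ℚ) : IsSegmentSymm (h - c • k) := by
  rw [isSegmentSymm_iff] at *
  rw [map_sub, map_sub, map_smul, map_smul, hh, hk, mul_sub, mul_smul_comm]

/-- Equivariant valuations with prescribed values on the origin and the segment. The value at the
origin is adjusted by a multiple of the sum of `exp` over the lattice points. -/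
theorem IsSegmentSymm.exists_valuation_origin {h : PowerSeries ℚ} (hh : IsSegmentSymm h) (c : ℚ) :
    ∃ Z, IsEquivariantValuation Z ∧ Z origin = MvPowerSeries.C c ∧
      Z unitSegment = linSub1 ![1, 0] h ∧ Z stdTriangle = boundaryPart (linSub1 ![1, 0] h) := by
  obtain ⟨Z, hZ, h0, h1, h2⟩ := (hh.sub_smul isSegmentSymm_one_add_exp c).exists_valuation
  refine ⟨Z + c • latticePointSum, hZ.add (isEquivariantValuation_latticePointSum.smul c), ?_, ?_,
    ?_⟩
  · rw [Pi.add_apply, Pi.smul_apply, h0, latticePointSum_origin, zero_add,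
      MvPowerSeries.smul_eq_C_mul, mul_one]
  · rw [Pi.add_apply, Pi.smul_apply, h1, latticePointSum_unitSegment, map_sub, map_smul, map_add,
      map_one]
    exact sub_add_cancel _ _
  · have h3 : expV ![1, 0] * expV ![-1, 1] = expV ![0, 1] := by
      rw [← expV_add]; norm_num
    rw [Pi.add_apply, Pi.smul_apply, h2, latticePointSum_stdTriangle, boundaryPart_linSub1,
      boundaryPart_linSub1]
    simp only [map_sub, map_smul, map_add, map_one]
    change (1 / 2 : ℚ) • (_ - c • (1 + expV _)) + (1 / 2 : ℚ) • (_ - c • (1 + expV _)) +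
      (1 / 2 : ℚ) • (_ * (_ - c • (1 + expV _))) + _ = _
    rw [mul_sub, mul_smul_comm, mul_add, mul_one, h3]
    module

/-! ### The value of a simple valuation on the standard triangle -/

theorem linSub_congr {u v u' v' : Fin 2 → ℤ} (hu : u = u') (hv : v = v') (f : PS) :
    linSub u v f = linSub u' v' f := by rw [hu, hv]

/-- The power series `σ` that are symmetric, even in each variable, and satisfy
`(x + y) σ(x, y) = y σ(x, x + y) + x σ(y, x + y)`. They correspond to admissible power series by
`ϱ(x, y) = σ(x, x + y)`. -/
structure IsSymbol (σ : PS) : Prop where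
  swap : linSub ![0, 1] ![1, 0] σ = σ
  even : linSub ![1, 0] ![0, -1] σ = σ
  rel : (x + y) * σ = y * linSub ![1, 0] ![1, 1] σ + x * linSub ![0, 1] ![1, 1] σ

namespace IsSymbol

theorem linSub_comm {σ : PS} (hσ : IsSymbol σ) (u v : Fin 2 → ℤ) : linSub u v σ = linSub v u σ := by
  conv_lhs => rw [← hσ.swap, linSub_linSub]
  exact linSub_congr (by simp) (by simp) σ

theorem linSub_neg_right {σ : PS} (hσ : IsSymbol σ) (u v : Fin 2 → ℤ) :
    linSub u (-v) σ = linSub u v σ := by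
  conv_rhs => rw [← hσ.even, linSub_linSub]
  exact linSub_congr (by simp) (by simp) σ

theorem linSub_neg_left {σ : PS} (hσ : IsSymbol σ) (u v : Fin 2 → ℤ) :
    linSub (-u) v σ = linSub u v σ := by
  rw [hσ.linSub_comm, hσ.linSub_neg_right, hσ.linSub_comm]

theorem linSub_rel {σ : PS} (hσ : IsSymbol σ) (u v : Fin 2 → ℤ) : (lin u + lin v) * linSub u v σ =
    lin v * linSub u (u + v) σ + lin u * linSub v (u + v) σ := by
  have h := congrArg (linSub u v) hσ.rel
  rw [map_mul, map_add, map_add, map_mul, map_mul, linSub_x, linSub_y, linSub_linSub,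
    linSub_linSub] at h
  simpa using h

end IsSymbol

theorem linSub_shear_cancel (f : PS) : linSub ![1, 0] ![1, 1] (linSub ![1, 0] ![-1, 1] f) = f := by
  rw [linSub_linSub]
  exact (linSub_congr (by decide) (by decide) f).trans (linSub_id f)

theorem linSub_shear_injective : Function.Injective (linSub ![1, 0] ![1, 1]) := by
  intro f g h
  have := congrArg (linSub ![1, 0] ![-1, 1]) h
  rw [linSub_linSub, linSub_linSub] at this
  have e : ∀ f : PS, linSub ((![1, 0] : Fin 2 → ℤ) 0 • ![1, 0] + (![1, 0] : Fin 2 → ℤ) 1 • ![-1, 1])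
      ((![1, 1] : Fin 2 → ℤ) 0 • ![1, 0] + (![1, 1] : Fin 2 → ℤ) 1 • ![-1, 1]) f = f :=
    fun f => (linSub_congr (by decide) (by decide) f).trans (linSub_id f)
  rwa [e, e] at this

theorem forall_mem_D4_iff (ϱ : PS) :
    (∀ Φ ∈ D4, linAct Φ ϱ = ϱ) ↔ linAct genA ϱ = ϱ ∧ linAct genB ϱ = ϱ := by
  constructor
  · intro h
    exact ⟨h _ (Subgroup.subset_closure (by simp)), h _ (Subgroup.subset_closure (by simp))⟩
  · rintro ⟨hA, hB⟩ Φ hΦ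
    induction hΦ using Subgroup.closure_induction with
    | mem Φ hΦ =>
      rcases hΦ with rfl | hΦ
      · exact hA
      · rw [Set.mem_singleton_iff.mp hΦ]; exact hB
    | one => exact linAct_one ϱ
    | mul Φ Ψ _ _ h1 h2 => rw [linAct_mul, h2, h1]
    | inv Φ _ h => rw [← h, ← linAct_mul, inv_mul_cancel, linAct_one, h]

/-- The change of variables `ϱ(x, y) = σ(x, x + y)` turns the invariance under the generators of
`D₄` into the symmetry of `σ` and its evenness in `y`. -/
theorem admissible_iff (σ : PS) : Admissible (linSub ![1, 0] ![1, 1] σ) ↔ IsSymbol σ := by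
  have hA : linAct genA (linSub ![1, 0] ![1, 1] σ) =
      linSub ![1, 0] ![1, 1] (linSub ![0, 1] ![1, 0] σ) := by
    rw [linAct_linSub, linSub_linSub]
    exact linSub_congr (by decide) (by decide) σ
  have hB : linAct genB (linSub ![1, 0] ![1, 1] σ) =
      linSub ![1, 0] ![1, 1] (linSub ![1, 0] ![0, -1] σ) := by
    rw [linAct_linSub, linSub_linSub]
    exact linSub_congr (by decide) (by decide) σ
  have h11 : x + y = lin ![1, 1] := by simp [lin]
  have hR : (2 * x + y) * linSub ![1, 0] ![1, 1] σ =
        (x + y) * sub (linSub ![1, 0] ![1, 1] σ) x (x + y) +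
          x * sub (linSub ![1, 0] ![1, 1] σ) (x + y) x ↔
      linSub ![1, 0] ![1, 1] ((x + y) * σ) = linSub ![1, 0] ![1, 1]
        (y * linSub ![1, 0] ![1, 1] σ + x * linSub ![0, 1] ![1, 1] σ) := by
    have h21 : lin ![1, 0] + lin ![1, 1] = 2 * x + y := by simp [lin]; ring
    have e1 : linSub ![1, 0] ![1, 1] (linSub ![1, 0] ![1, 1] σ) = linSub ![1, 0] ![2, 1] σ := by
      rw [linSub_linSub]; exact linSub_congr (by decide) (by decide) σ
    have e2 : linSub ![1, 1] ![1, 0] (linSub ![1, 0] ![1, 1] σ) = linSub ![1, 1] ![2, 1] σ := by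
      rw [linSub_linSub]; exact linSub_congr (by decide) (by decide) σ
    have e3 : linSub ![1, 0] ![1, 1] (linSub ![0, 1] ![1, 1] σ) = linSub ![1, 1] ![2, 1] σ := by
      rw [linSub_linSub]; exact linSub_congr (by decide) (by decide) σ
    rw [map_mul, map_add, map_add, map_mul, map_mul, linSub_x, linSub_y, h21, h11, e1, e3,
      x_eq_lin, ← linSub_eq, ← linSub_eq, e1, e2]
  rw [Admissible, forall_mem_D4_iff, hA, hB, hR, linSub_shear_injective.eq_iff,
    linSub_shear_injective.eq_iff, linSub_shear_injective.eq_iff]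
  exact ⟨fun h => ⟨h.1.1, h.1.2, h.2⟩, fun h => ⟨⟨h.swap, h.even⟩, h.rel⟩⟩

theorem isTriangleSeries_iff (σ f : PS) : IsTriangleSeries (linSub ![1, 0] ![1, 1] σ) f ↔
    y * f = expV ![1, 0] * linSub1 ![-1, 1] expQuot * linSub ![-1, 1] ![0, 1] σ -
      linSub1 ![1, 0] expQuot * σ := by
  have h1 : y - x = lin ![-1, 1] := by simp [lin]; ring
  have e1 : linSub ![-1, 1] ![1, 0] (linSub ![1, 0] ![1, 1] σ) = linSub ![-1, 1] ![0, 1] σ := by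
    rw [linSub_linSub]; exact linSub_congr (by decide) (by decide) σ
  have e2 : linSub ![1, 0] ![-1, 1] (linSub ![1, 0] ![1, 1] σ) = σ := by
    rw [linSub_linSub]
    exact (linSub_congr (by decide) (by decide) σ).trans (linSub_id σ)
  rw [IsTriangleSeries, h1, x_eq_lin, ← linSub_eq, ← linSub_eq, ← linSub1_eq, ← linSub1_eq,
    expS_lin, e1, e2]

theorem isSegmentSymm_expQuot : IsSegmentSymm expQuot := by
  have h1 := lin_mul_expQuot ![1, 0]
  have h2 := lin_mul_expQuot ![-1, 0]
  have h3 : (![1, 0] : Fin 2 → ℤ) + ![-1, 0] = 0 := by decide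
  have h4 : expV ![1, 0] * expV ![-1, 0] = 1 := by rw [← expV_add, h3, expV_zero]
  have h5 : lin ![1, 0] + lin ![-1, 0] = 0 := by rw [← lin_add, h3, lin_zero]
  rw [isSegmentSymm_iff]
  apply mul_left_cancel₀ (lin_ne_zero (v := ![1, 0]) (by decide))
  linear_combination h1 + h4 + expV ![1, 0] * h2 -
    expV ![1, 0] * linSub1 ![-1, 0] expQuot * h5

/-- The numerator vanishes at `y = 0` because `σ(-x, 0) = σ(x, 0)`. -/
theorem IsSymbol.exists_isTriangleSeries {σ : PS} (hσ : IsSymbol σ) :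
    ∃ f, IsTriangleSeries (linSub ![1, 0] ![1, 1] σ) f := by
  have hdvd : y ∣ expV ![1, 0] * linSub1 ![-1, 1] expQuot * linSub ![-1, 1] ![0, 1] σ -
      linSub1 ![1, 0] expQuot * σ := by
    apply y_dvd_of_linSub_eq_zero
    have h1 := (isSegmentSymm_iff _).mp isSegmentSymm_expQuot
    have h2 := hσ.linSub_neg_left ![1, 0] 0
    rw [map_sub, map_mul, map_mul, map_mul, expV, linSub_linSub1, linSub_linSub1, linSub_linSub1,
      linSub_linSub]
    simp at h2 ⊢
    rw [h2, sub_eq_zero, h1]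
    rfl
  obtain ⟨f, hf⟩ := hdvd
  exact ⟨f, (isTriangleSeries_iff σ f).mpr hf.symm⟩

/-- The value on the unit square is recovered from the value on `T`, because the square is the union
of `T` and its reflection at the centre of the square. -/
theorem IsSymbol.add_reflection {σ f : PS} (hσ : IsSymbol σ)
    (hf : IsTriangleSeries (linSub ![1, 0] ![1, 1] σ) f) :
    f + expV ![1, 1] * linSub ![-1, 0] ![0, -1] f =
      linSub1 ![1, 0] expQuot * linSub1 ![0, 1] expQuot * σ := by
  rw [isTriangleSeries_iff] at hf
  have hneg := congrArg (linSub ![-1, 0] ![0, -1]) hf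
  have hy : lin ![0, -1] = -y := by simp [lin]
  have e1 : linSub ![-1, 0] ![0, -1] (linSub ![-1, 1] ![0, 1] σ) = linSub ![-1, 1] ![0, 1] σ := by
    rw [linSub_linSub, ← hσ.linSub_neg_left, ← hσ.linSub_neg_right]
    exact linSub_congr (by decide) (by decide) σ
  have e2 : linSub ![-1, 0] ![0, -1] σ = σ := by
    rw [← hσ.linSub_neg_left, ← hσ.linSub_neg_right]
    exact (linSub_congr (by decide) (by decide) σ).trans (linSub_id σ)
  have e3 : linSub ![-1, 0] ![0, -1] (expV ![1, 0]) = expV ![-1, 0] := by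
    rw [expV, linSub_linSub1]; simp [expV]
  have e4 : linSub ![-1, 0] ![0, -1] (linSub1 ![-1, 1] expQuot) = linSub1 ![1, -1] expQuot := by
    rw [linSub_linSub1]; simp
  have e5 : linSub ![-1, 0] ![0, -1] (linSub1 ![1, 0] expQuot) = linSub1 ![-1, 0] expQuot := by
    rw [linSub_linSub1]; simp
  rw [map_mul, map_sub, map_mul, map_mul, map_mul, linSub_y, hy, e1, e2, e3, e4, e5] at hneg
  have h1 : linSub1 ![1, 0] expQuot = expV ![1, 0] * linSub1 ![-1, 0] expQuot :=
    isSegmentSymm_expQuot.linSub1_eq ![1, 0] |>.trans (by simp)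
  have h2 : linSub1 ![-1, 1] expQuot = expV ![-1, 1] * linSub1 ![1, -1] expQuot :=
    isSegmentSymm_expQuot.linSub1_eq ![-1, 1] |>.trans (by simp)
  have h3 : y * linSub1 ![0, 1] expQuot = expV ![0, 1] - 1 := y_eq_lin ▸ lin_mul_expQuot ![0, 1]
  have h4 : expV ![1, 1] = expV ![1, 0] * expV ![0, 1] := by rw [← expV_add]; simp
  have h5 : expV ![1, 0] * expV ![-1, 1] = expV ![0, 1] := by rw [← expV_add]; simp
  have h6 : expV ![1, 0] * expV ![-1, 0] = 1 := by
    rw [← expV_add, ← expV_zero]; congr 1; decide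
  apply mul_left_cancel₀ (y_eq_lin ▸ lin_ne_zero (v := ![0, 1]) (by decide) : y ≠ 0)
  rw [h2] at hf
  linear_combination hf - expV ![1, 1] * hneg - linSub1 ![1, 0] expQuot * σ * h3 +
    (linSub1 ![1, -1] expQuot * linSub ![-1, 1] ![0, 1] σ) * (h5 - expV ![-1, 0] * h4 -
      expV ![0, 1] * h6) + linSub1 ![-1, 0] expQuot * σ * h4 - expV ![0, 1] * σ * h1

theorem IsSymbol.eq_of_isTriangleSeries {σ τ f : PS} (hσ : IsSymbol σ) (hτ : IsSymbol τ)
    (h1 : IsTriangleSeries (linSub ![1, 0] ![1, 1] σ) f)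
    (h2 : IsTriangleSeries (linSub ![1, 0] ![1, 1] τ) f) : σ = τ := by
  have h := (hσ.add_reflection h1).symm.trans (hτ.add_reflection h2)
  exact mul_left_cancel₀ (mul_ne_zero (isUnit_linSub1_expQuot _).ne_zero
    (isUnit_linSub1_expQuot _).ne_zero) h

/-- The unit square. -/
def unitSquare : LatticePolytope := hull {0, ![1, 0], ![1, 1], ![0, 1]} (by simp)

theorem unitSquare_carrier : unitSquare.carrier = latHull {0, ![1, 0], ![1, 1], ![0, 1]} := rfl

theorem linAct_glOfCols {u v : Fin 2 → ℤ} (h : crs u v = 1) (f : PS) :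
    linAct (glOfCols u v h) f = linSub u v f := by
  rw [linAct_eq]
  apply linSub_congr <;> (funext i; fin_cases i <;> rfl)

/-- Relations between the values `t` on `T`, `F` on the other half of the unit square, `U` and `D`
on the halves of the square for the other diagonal, and `Q` on the square, and between their images,
for an equivariant valuation that vanishes on segments. -/
theorem IsEquivariantValuation.exists_square_relations {Z : LatticePolytope → PS}
    (hZ : IsEquivariantValuation Z) (h0 : Z unitSegment = 0) :
    ∃ Q U D F : PS, Q = U + D ∧ Q = Z stdTriangle + F ∧
      linSub ![1, 0] ![1, 1] Q = D + expV ![1, 0] * U ∧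
      linSub ![1, 1] ![0, 1] Q = U + expV ![0, 1] * D ∧
      expV ![1, 0] * linSub ![-1, 1] ![0, 1] Q = F + expV ![0, 1] * Z stdTriangle ∧
      linSub ![0, 1] ![1, 0] Q = Q ∧ expV ![0, 1] * linSub ![1, 0] ![0, -1] Q = Q := by
  obtain ⟨t, ht⟩ : ∃ t, t = Z stdTriangle := ⟨_, rfl⟩
  obtain ⟨Q, hQ⟩ : ∃ Q, Q = Z unitSquare := ⟨_, rfl⟩
  rw [← ht]
  have hval := (isVal_iff Z).mpr hZ.1
  have tri : ∀ (Φ : Matrix.GeneralLinearGroup (Fin 2) ℤ) (w u v : Fin 2 → ℤ) {P : LatticePolytope}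
      {S : Finset (Fin 2 → ℤ)}, P.carrier = latHull S →
      ({![1, 0], ![0, 1], 0} : Finset (Fin 2 → ℤ)).image (fun p => Φ.1.mulVec p + w) = S →
      ![Φ.1 0 0, Φ.1 1 0] = u → ![Φ.1 0 1, Φ.1 1 1] = v → Z P = expV w * linSub u v t := by
    intro Φ w u v P S hP hS hu hv
    rw [← hZ.linAct_eq_of_map_eq (map_eq_of_image_eq stdTriangle_carrier hP hS), linAct_eq, hu, hv,
      ht]
  have seg : ∀ {u v : Fin 2 → ℤ} (h : crs u v = 1) (w : Fin 2 → ℤ) {P : LatticePolytope}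
      {S : Finset (Fin 2 → ℤ)}, P.carrier = latHull S →
      ({0, ![1, 0]} : Finset (Fin 2 → ℤ)).image
        (fun p => (glOfCols u v h).1.mulVec p + w) = S → Z P = 0 := by
    intro u v h w P S hP hS
    rw [← hZ.linAct_eq_of_map_eq (map_eq_of_image_eq unitSegment_carrier hP hS), h0,
      linAct_glOfCols, map_zero, mul_zero]
  obtain ⟨PT, hPT⟩ := exists_polytope {![1, 0], ![1, 1], ![0, 1]} (by simp)
  obtain ⟨PD, hPD⟩ := exists_polytope {0, ![1, 0], ![1, 1]} (by simp)
  obtain ⟨PU, hPU⟩ := exists_polytope {0, ![1, 1], ![0, 1]} (by simp)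
  obtain ⟨PI, hPI⟩ := exists_polytope {0, ![1, 1]} (by simp)
  obtain ⟨PJ, hPJ⟩ := exists_polytope {![1, 0], ![0, 1]} (by simp)
  have hsq : unitSquare.carrier = latHull {![1, 0], ![1, 1], ![0, 1], 0} := by
    rw [unitSquare_carrier]; congr 1; decide
  have hT : stdTriangle.carrier = latHull {![1, 0], ![0, 1], 0} := rfl
  -- the two diagonals of the square
  have c1 : Q = Z PU + Z PD := by
    have := hval.cut_quadrilateral (a := 0) (b := ![1, 0]) (q := ![1, 1]) (c := ![0, 1])
      (by decide) (by decide) (by decide) (by decide) unitSquare PU PD PI unitSquare_carrier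
      hPU hPD hPI
    rwa [← hQ, seg (u := ![1, 1]) (v := ![0, 1]) (by decide) 0 hPI (by decide), add_zero] at this
  have c2 : Q = t + Z PT := by
    have := hval.cut_quadrilateral (a := ![1, 0]) (b := ![1, 1]) (q := ![0, 1]) (c := 0)
      (by decide) (by decide) (by decide) (by decide) unitSquare stdTriangle PT PJ hsq
      hT hPT hPJ
    rwa [← hQ, ← ht, seg (u := ![-1, 1]) (v := ![-1, 0]) (by decide) ![1, 0] hPJ (by decide),
      add_zero] at this
  have cT : Z PT = expV ![1, 1] * linSub ![-1, 0] ![0, -1] t :=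
    tri (glOfCols ![-1, 0] ![0, -1] (by decide)) ![1, 1] _ _ hPT (by decide)
      (by decide) (by decide)
  have cT' : Z PT = expV ![1, 0] * linSub ![-1, 1] ![0, 1] t :=
    tri ⟨!![-1, 0; 1, 1], !![-1, 0; 1, 1], by decide, by decide⟩ ![1, 0] _ _ hPT (by decide)
      (by decide) (by decide)
  have ct : t = expV ![0, 1] * linSub ![1, -1] ![0, -1] t :=
    ht.trans <| tri ⟨!![1, 0; -1, -1], !![1, 0; -1, -1], by decide, by decide⟩ ![0, 1] _ _
      hT (by decide) (by decide) (by decide)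
  have cD : Z PD = expV 0 * linSub ![1, 0] ![1, 1] t :=
    tri (glOfCols ![1, 0] ![1, 1] (by decide)) 0 _ _ hPD (by decide)
      (by decide) (by decide)
  have cD' : Z PD = expV ![1, 1] * linSub ![-1, -1] ![0, -1] t :=
    tri (glOfCols ![-1, -1] ![0, -1] (by decide)) ![1, 1] _ _ hPD (by decide)
      (by decide) (by decide)
  have cU : Z PU = expV 0 * linSub ![1, 1] ![0, 1] t :=
    tri (glOfCols ![1, 1] ![0, 1] (by decide)) 0 _ _ hPU (by decide)
      (by decide) (by decide)
  have cU' : Z PU = expV ![1, 1] * linSub ![-1, 0] ![-1, -1] t :=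
    tri (glOfCols ![-1, 0] ![-1, -1] (by decide)) ![1, 1] _ _ hPU (by decide)
      (by decide) (by decide)
  rw [expV_zero, one_mul] at cD cU
  -- the parallelograms that arise from the square by shears are cut along diagonals
  have hA : linSub ![1, 0] ![1, 1] Q = Z PD + expV ![1, 0] * Z PU := by
    have e : expV ![1, 0] * expV ![1, 1] = expV ![2, 1] := by rw [← expV_add]; simp
    rw [c2, map_add, ← cD, cT, map_mul, linSub_linSub, expV, linSub_linSub1, cU', ← mul_assoc, e]
    congr 2
  have hB : linSub ![1, 1] ![0, 1] Q = Z PU + expV ![0, 1] * Z PD := by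
    have e : expV ![0, 1] * expV ![1, 1] = expV ![1, 2] := by rw [← expV_add]; simp
    rw [c2, map_add, ← cU, cT, map_mul, linSub_linSub, expV, linSub_linSub1, cD', ← mul_assoc, e]
    congr 2
  have hG : expV ![1, 0] * linSub ![-1, 1] ![0, 1] Q = Z PT + expV ![0, 1] * t := by
    have e : expV ![1, 0] * expV ![-1, 2] = expV ![0, 1] * expV ![0, 1] := by
      rw [← expV_add, ← expV_add]; simp
    have e2 : linSub ![-1, 1] ![0, 1] (linSub ![-1, 0] ![0, -1] t) =
        linSub ![1, -1] ![0, -1] t := by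
      rw [linSub_linSub]; exact linSub_congr (by decide) (by decide) t
    have e3 : linSub ![-1, 1] ![0, 1] (expV ![1, 1]) = expV ![-1, 2] := by
      rw [expV, linSub_linSub1]; simp [expV]
    rw [c2, map_add, mul_add, ← cT', cT, map_mul, e2, e3]
    linear_combination linSub ![1, -1] ![0, -1] t * e - expV ![0, 1] * ct
  have hswap : linSub ![0, 1] ![1, 0] Q = Q := by
    have := hZ.linAct_eq_of_map_eq (Φ := swapGL) (w := 0)
      (map_eq_of_image_eq unitSquare_carrier unitSquare_carrier (by decide))
    rwa [← hQ, expV_zero, one_mul, linAct_swapGL] at this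
  have hconj : expV ![0, 1] * linSub ![1, 0] ![0, -1] Q = Q := by
    have := hZ.linAct_eq_of_map_eq (Φ := conjGL) (w := ![0, 1])
      (map_eq_of_image_eq unitSquare_carrier unitSquare_carrier (by decide))
    rwa [← hQ, linAct_conjGL] at this
  exact ⟨Q, Z PU, Z PD, Z PT, c1, c2, hA, hB, hG, hswap, hconj⟩

/-- The value of a simple equivariant valuation on `T` comes from a symbol `σ`, whose product with
`((e^x - 1) / x) ((e^y - 1) / y)` is the value on the unit square. -/
theorem IsEquivariantValuation.exists_isSymbol {Z : LatticePolytope → PS}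
    (hZ : IsEquivariantValuation Z) (h0 : Z unitSegment = 0) :
    ∃ σ, IsSymbol σ ∧ IsTriangleSeries (linSub ![1, 0] ![1, 1] σ) (Z stdTriangle) := by
  obtain ⟨Q, U, D, F, c1, c2, hA, hB, hG, hswap, hconj⟩ := hZ.exists_square_relations h0
  generalize Z stdTriangle = t at *
  obtain ⟨σ, hσ⟩ : linSub1 ![1, 0] expQuot * linSub1 ![0, 1] expQuot ∣ Q :=
    ((isUnit_linSub1_expQuot _).mul (isUnit_linSub1_expQuot _)).dvd
  have n10 := (isUnit_linSub1_expQuot ![1, 0]).ne_zero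
  have n01 := (isUnit_linSub1_expQuot ![0, 1]).ne_zero
  have n11 := (isUnit_linSub1_expQuot ![1, 1]).ne_zero
  have hsub : ∀ u v, linSub u v Q = linSub1 u expQuot * linSub1 v expQuot * linSub u v σ := by
    intro u v
    rw [hσ, map_mul, map_mul, linSub_linSub1, linSub_linSub1]
    simp
  -- the relations between the values, divided by the units, are the relations for `σ`
  have q10 := x_eq_lin ▸ lin_mul_expQuot ![1, 0]
  have q01 := y_eq_lin ▸ lin_mul_expQuot ![0, 1]
  have q11 := lin_mul_expQuot ![1, 1]
  have hl : lin ![1, 1] = x + y := by simp [lin]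
  have h11 : expV ![1, 1] = expV ![1, 0] * expV ![0, 1] := by rw [← expV_add]; simp
  rw [hl, h11] at q11
  rw [hsub] at hA hB hG hswap hconj
  have sswap : linSub ![0, 1] ![1, 0] σ = σ := by
    apply mul_left_cancel₀ (mul_ne_zero n01 n10)
    rw [hswap, hσ]; ring
  refine ⟨σ, ⟨sswap, ?_, ?_⟩, ?_⟩
  · have h := isSegmentSymm_expQuot.linSub1_eq ![0, 1]
    rw [show -![0, 1] = (![0, -1] : Fin 2 → ℤ) by decide] at h
    apply mul_left_cancel₀ (mul_ne_zero n10 n01)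
    rw [← hσ, ← hconj, h]
    ring
  · have hs : linSub ![0, 1] ![1, 1] σ = linSub ![1, 1] ![0, 1] σ := by
      conv_lhs => rw [← sswap, linSub_linSub]
      exact linSub_congr (by decide) (by decide) σ
    rw [hs]
    apply mul_left_cancel₀ (mul_ne_zero (mul_ne_zero n10 n01) n11)
    linear_combination (expV ![1, 0] * expV ![0, 1] - 1) * (c1 - hσ) -
      (expV ![0, 1] - 1) * hA - (expV ![1, 0] - 1) * hB +
      linSub1 ![1, 0] expQuot * linSub1 ![0, 1] expQuot * σ * q11 -
      linSub1 ![1, 0] expQuot * linSub1 ![1, 1] expQuot * linSub ![1, 0] ![1, 1] σ * q01 -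
      linSub1 ![1, 1] expQuot * linSub1 ![0, 1] expQuot * linSub ![1, 1] ![0, 1] σ * q10
  · rw [isTriangleSeries_iff]
    apply mul_left_cancel₀ n01
    linear_combination t * q01 - hG + c2 - hσ

/-! ### Potentials on the Farey graph and simple valuations -/

/-- A function `c` on pairs of lattice vectors up to sign that is additive along the triangles with
vertices `±u`, `±(u + v)`, `±v` of the Farey complex, where `u`, `v` is an oriented basis of the
lattice. -/
structure IsFareyCocycle {A : Type*} [AddCommGroup A] (c : (Fin 2 → ℤ) → (Fin 2 → ℤ) → A) :
    Prop where
  neg_right : ∀ u v, c u (-v) = c u v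
  swap : ∀ u v, c v u = -c u v
  add : ∀ u v, crs u v = 1 → c u v = c u (u + v) + c (u + v) v

/-- The value at `p u + q v` of the potential of `c` that vanishes at `u`, for coprime `p` and `q`,
computed by the subtractive Euclidean algorithm. -/
def fareyPotential {A : Type*} [AddCommGroup A] (c : (Fin 2 → ℤ) → (Fin 2 → ℤ) → A)
    (u v : Fin 2 → ℤ) (p q : ℕ) : A :=
  if p = 0 then c u v
  else if q = 0 then 0
  else if q ≤ p then fareyPotential c u (u + v) (p - q) q
  else c u (u + v) + fareyPotential c (u + v) v p (q - p)
termination_by p + q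

theorem crs_smul_add (u v : Fin 2 → ℤ) (a b c d : ℤ) :
    crs (a • u + b • v) (c • u + d • v) = (a * d - b * c) * crs u v := by
  simp [crs]; ring

section FareyPotential

variable {A : Type*} [AddCommGroup A] {c : (Fin 2 → ℤ) → (Fin 2 → ℤ) → A}

theorem fareyPotential_zero_left (u v : Fin 2 → ℤ) (q : ℕ) :
    fareyPotential c u v 0 q = c u v := by
  rw [fareyPotential, if_pos rfl]

theorem fareyPotential_zero_right (u v : Fin 2 → ℤ) {p : ℕ} (hp : p ≠ 0) :
    fareyPotential c u v p 0 = 0 := by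
  rw [fareyPotential, if_neg hp, if_pos rfl]

theorem fareyPotential_of_le (u v : Fin 2 → ℤ) {p q : ℕ} (hp : p ≠ 0) (h : q ≤ p) :
    fareyPotential c u v p q = fareyPotential c u (u + v) (p - q) q := by
  rcases eq_or_ne q 0 with rfl | hq
  · rw [fareyPotential_zero_right _ _ hp, Nat.sub_zero, fareyPotential_zero_right _ _ hp]
  · rw [fareyPotential, if_neg hp, if_neg hq, if_pos h]

theorem IsFareyCocycle.fareyPotential_of_ge (hc : IsFareyCocycle c) {u v : Fin 2 → ℤ}
    (huv : crs u v = 1) {p q : ℕ} (hq : q ≠ 0) (h : p ≤ q) :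
    fareyPotential c u v p q = c u (u + v) + fareyPotential c (u + v) v p (q - p) := by
  rcases eq_or_ne p 0 with rfl | hp
  · rw [fareyPotential_zero_left, fareyPotential_zero_left, hc.add u v huv]
  · rcases h.eq_or_lt with rfl | h
    · rw [fareyPotential_of_le _ _ hp le_rfl, Nat.sub_self, fareyPotential_zero_left,
        fareyPotential_zero_right _ _ hp, add_zero]
    · rw [fareyPotential, if_neg hp, if_neg hq, if_neg (not_le.mpr h)]

/-- The difference of the potential at two vectors of an oriented basis. The Euclidean algorithm
takes the same steps for both vectors until they are `u` and `v`. -/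
theorem IsFareyCocycle.fareyPotential_sub_aux (hc : IsFareyCocycle c) (n : ℕ) :
    ∀ (u v : Fin 2 → ℤ) (p q r s : ℕ), p + q + r + s = n → crs u v = 1 → p * s = q * r + 1 →
      fareyPotential c u v r s - fareyPotential c u v p q =
        c ((p : ℤ) • u + (q : ℤ) • v) ((r : ℤ) • u + (s : ℤ) • v) := by
  induction n using Nat.strong_induction_on with
  | _ n ih =>
    intro u v p q r s hn huv h
    have hp : p ≠ 0 := by rintro rfl; omega
    have hs : s ≠ 0 := by rintro rfl; omega
    have h1 : crs u (u + v) = 1 := by rw [← huv]; simp [crs]; ring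
    have h2 : crs (u + v) v = 1 := by rw [← huv]; simp [crs]; ring
    rcases Nat.lt_or_ge r s with hrs | hrs
    · rcases Nat.lt_or_ge q p with hqp | hqp
      · -- the point `u + v` is strictly between the two vectors, which are `u` and `v`
        have h3 : (q + 1) * (r + 1) ≤ p * s := Nat.mul_le_mul hqp hrs
        have hq0 : q = 0 := by nlinarith
        have hr0 : r = 0 := by nlinarith
        subst hq0 hr0
        have hps : p * s = 1 := by omega
        have hp1 := Nat.eq_one_of_mul_eq_one_right hps
        have hs1 := Nat.eq_one_of_mul_eq_one_left hps
        subst hp1 hs1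
        rw [fareyPotential_zero_left, fareyPotential_zero_right _ _ one_ne_zero]
        simp
      · obtain ⟨q, rfl⟩ := Nat.exists_eq_add_of_le hqp
        obtain ⟨s, rfl⟩ := Nat.exists_eq_add_of_le hrs.le
        have := ih _ (by omega) (u + v) v p q r s rfl h2 (by nlinarith)
        rw [hc.fareyPotential_of_ge huv hs (by omega), hc.fareyPotential_of_ge huv (by omega) hqp,
          add_sub_add_left_eq_sub, Nat.add_sub_cancel_left, Nat.add_sub_cancel_left, this]
        congr 1 <;> push_cast <;> module
    · have hqp : q ≤ p := by
        by_contra hlt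
        push Not at hlt
        have : p * s ≤ q * r := Nat.mul_le_mul hlt.le hrs
        omega
      obtain ⟨p, rfl⟩ := Nat.exists_eq_add_of_le hqp
      obtain ⟨r, rfl⟩ := Nat.exists_eq_add_of_le hrs
      have := ih _ (by omega) u (u + v) p q r s rfl h1 (by nlinarith)
      rw [fareyPotential_of_le u v hp hqp, fareyPotential_of_le u v (by omega) hrs,
        Nat.add_sub_cancel_left, Nat.add_sub_cancel_left, this]
      congr 1 <;> push_cast <;> module

theorem IsFareyCocycle.fareyPotential_sub (hc : IsFareyCocycle c) {u v a b : Fin 2 → ℤ}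
    (huv : crs u v = 1) {p q r s : ℕ}
    (ha : a = (p : ℤ) • u + (q : ℤ) • v ∨ a = -((p : ℤ) • u + (q : ℤ) • v))
    (hb : b = (r : ℤ) • u + (s : ℤ) • v ∨ b = -((r : ℤ) • u + (s : ℤ) • v))
    (hab : crs a b = 1) :
    fareyPotential c u v r s - fareyPotential c u v p q = c a b := by
  have hneg : ∀ u v, c (-u) v = c u v := by
    intro u v
    rw [hc.swap v, hc.neg_right, hc.swap u, neg_neg]
  have hcab : c a b = c ((p : ℤ) • u + (q : ℤ) • v) ((r : ℤ) • u + (s : ℤ) • v) := by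
    rcases ha with rfl | rfl <;> rcases hb with rfl | rfl <;>
      first | rfl | simp only [hneg, hc.neg_right]
  have hdet : ((p : ℤ) * s - q * r) = 1 ∨ ((p : ℤ) * s - q * r) = -1 := by
    have h := crs_smul_add u v p q r s
    rw [huv, mul_one] at h
    rw [← h]
    have n1 : ∀ u v, crs (-u) v = -crs u v := by intro u v; simp [crs]; ring
    have n2 : ∀ u v, crs u (-v) = -crs u v := by intro u v; simp [crs]; ring
    rcases ha with rfl | rfl <;> rcases hb with rfl | rfl <;>
      first | exact Or.inl hab | (simp only [n1, n2] at hab; omega)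
  rw [hcab]
  rcases hdet with h | h
  · exact hc.fareyPotential_sub_aux _ u v p q r s rfl huv (by zify; linarith)
  · have := hc.fareyPotential_sub_aux _ u v r s p q rfl huv (by zify; linarith)
    rw [hc.swap, ← this, neg_sub]

/-- Cocycles on the Farey complex have potentials, because this complex is a tree of triangles. -/
theorem IsFareyCocycle.exists_potential (hc : IsFareyCocycle c) :
    ∃ φ : (Fin 2 → ℤ) → A, (∀ d, φ (-d) = φ d) ∧ ∀ a b, crs a b = 1 → φ b - φ a = c a b := by
  -- the first and third quadrant, and the second and fourth quadrant
  let φ : (Fin 2 → ℤ) → A := fun d =>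
    if 0 ≤ d 0 * d 1 then fareyPotential c ![1, 0] ![0, 1] (d 0).natAbs (d 1).natAbs
    else c ![1, 0] ![0, 1] + fareyPotential c ![0, 1] ![-1, 0] (d 1).natAbs (d 0).natAbs
  have h1 : ∀ d, 0 ≤ d 0 * d 1 →
      φ d = fareyPotential c ![1, 0] ![0, 1] (d 0).natAbs (d 1).natAbs := fun d h => if_pos h
  -- both formulas agree on the axes
  have h2 : ∀ d, d ≠ 0 → d 0 * d 1 ≤ 0 → φ d = c ![1, 0] ![0, 1] +
      fareyPotential c ![0, 1] ![-1, 0] (d 1).natAbs (d 0).natAbs := by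
    intro d hd h
    rcases h.eq_or_lt with h | h
    · rw [h1 d h.ge]
      rcases eq_or_ne (d 0) 0 with h0 | h0
      · have h3 : d 1 ≠ 0 := fun h3 => hd (by funext i; fin_cases i; exacts [h0, h3])
        rw [h0, Int.natAbs_zero, fareyPotential_zero_left,
          fareyPotential_zero_right _ _ (Int.natAbs_ne_zero.mpr h3), add_zero]
      · have h3 : d 1 = 0 := (mul_eq_zero.mp h).resolve_left h0
        have h4 : (![-1, 0] : Fin 2 → ℤ) = -![1, 0] := by decide
        rw [h3, Int.natAbs_zero, fareyPotential_zero_left,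
          fareyPotential_zero_right _ _ (Int.natAbs_ne_zero.mpr h0), h4, hc.neg_right,
          hc.swap ![1, 0], add_neg_cancel]
    · exact if_neg (not_le.mpr h)
  have e1 : ∀ d : Fin 2 → ℤ, 0 ≤ d 0 * d 1 →
      d = ((d 0).natAbs : ℤ) • ![1, 0] + ((d 1).natAbs : ℤ) • ![0, 1] ∨
      d = -(((d 0).natAbs : ℤ) • ![1, 0] + ((d 1).natAbs : ℤ) • ![0, 1]) := by
    intro d h
    rcases mul_nonneg_iff.mp h with ⟨h0, h1⟩ | ⟨h0, h1⟩
    · left; funext i; fin_cases i <;> simp [abs_of_nonneg, h0, h1]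
    · right; funext i; fin_cases i <;> simp [abs_of_nonpos, h0, h1]
  have e2 : ∀ d : Fin 2 → ℤ, d 0 * d 1 ≤ 0 →
      d = ((d 1).natAbs : ℤ) • ![0, 1] + ((d 0).natAbs : ℤ) • ![-1, 0] ∨
      d = -(((d 1).natAbs : ℤ) • ![0, 1] + ((d 0).natAbs : ℤ) • ![-1, 0]) := by
    intro d h
    rcases mul_nonpos_iff.mp h with ⟨h0, h1⟩ | ⟨h0, h1⟩
    · right; funext i; fin_cases i <;> simp [abs_of_nonneg, abs_of_nonpos, h0, h1]
    · left; funext i; fin_cases i <;> simp [abs_of_nonneg, abs_of_nonpos, h0, h1]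
  refine ⟨φ, fun d => by simp [φ], fun a b hab => ?_⟩
  have ha0 : a ≠ 0 := by rintro rfl; simp [crs] at hab
  have hb0 : b ≠ 0 := by rintro rfl; simp [crs] at hab
  -- no unimodular pair has vectors in the interiors of two adjacent quadrants
  have hquad : (0 ≤ a 0 * a 1 ∧ 0 ≤ b 0 * b 1) ∨ (a 0 * a 1 ≤ 0 ∧ b 0 * b 1 ≤ 0) := by
    by_contra hcon
    have h3 : a 0 * a 1 * (b 0 * b 1) < 0 := by
      rcases lt_trichotomy (a 0 * a 1) 0 with h | h | h <;>
        rcases lt_trichotomy (b 0 * b 1) 0 with h' | h' | h' <;>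
        first
          | exact mul_neg_of_neg_of_pos h h'
          | exact mul_neg_of_pos_of_neg h h'
          | exact absurd (by constructor <;> omega) (not_or.mp hcon).1
    have h4 : (a 0 * b 1) * (a 1 * b 0) < 0 := by linarith
    have h5 : a 0 * b 1 = a 1 * b 0 + 1 := by rw [crs] at hab; linarith
    rw [h5] at h4
    rcases lt_or_ge (a 1 * b 0) 0 with h6 | h6 <;> nlinarith
  rcases hquad with ⟨ha, hb⟩ | ⟨ha, hb⟩
  · rw [h1 a ha, h1 b hb]
    exact hc.fareyPotential_sub (by decide) (e1 a ha) (e1 b hb) hab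
  · rw [h2 a ha0 ha, h2 b hb0 hb, add_sub_add_left_eq_sub]
    exact hc.fareyPotential_sub (by decide) (e2 a ha) (e2 b hb) hab

end FareyPotential

/-- The Farey graph is connected: a function that is constant along its edges is constant on
primitive vectors. -/
theorem eq_of_crs_eq_one {A : Type*} {δ : (Fin 2 → ℤ) → A} (h : ∀ a b, crs a b = 1 → δ a = δ b)
    {d : Fin 2 → ℤ} (hd : d ∈ primitive) : δ d = δ ![1, 0] := by
  obtain ⟨n, hn⟩ : ∃ n, n = (d 1).natAbs := ⟨_, rfl⟩
  induction n using Nat.strong_induction_on generalizing d with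
  | _ n ih =>
    obtain ⟨k, m, hkm⟩ := id hd
    rcases eq_or_ne (d 1) 0 with h0 | h0
    · rw [h0, mul_zero, add_zero] at hkm
      rcases Int.eq_one_or_neg_one_of_mul_eq_one (by rw [mul_comm]; exact hkm) with h1 | h1
      · congr 1; funext i; fin_cases i; exacts [h1, h0]
      · have : d = ![-1, 0] := by funext i; fin_cases i; exacts [h1, h0]
        rw [this, h ![1, 0] ![0, 1] (by decide), h ![0, 1] ![-1, 0] (by decide)]
    · -- a neighbour of `d` whose second coordinate is smaller
      have hw : crs d ![-m - (k / d 1) * d 0, k % d 1] = 1 := by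
        simp only [crs, Matrix.cons_val_zero, Matrix.cons_val_one]
        linear_combination hkm + d 0 * Int.emod_add_mul_ediv k (d 1)
      have hlt : (k % d 1).natAbs < n := by
        have := Int.emod_nonneg k h0
        have := Int.emod_lt_abs k h0
        rw [Int.abs_eq_natAbs] at this
        omega
      rw [h _ _ hw]
      refine ih _ hlt ?_ rfl
      refine ⟨-d 1, d 0, ?_⟩
      rw [crs] at hw
      linarith

namespace IsSymbol

/-- The rational function `σ(u, v) / (u v)` of the linear forms of `u` and `v`. -/
def quot (σ : PS) (u v : Fin 2 → ℤ) : Frac :=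
  algebraMap PS Frac (linSub u v σ) / (algebraMap PS Frac (lin u) * algebraMap PS Frac (lin v))

theorem fracAct_quot (σ : PS) (Φ : Matrix.GeneralLinearGroup (Fin 2) ℤ) (u v : Fin 2 → ℤ) :
    fracAct Φ (quot σ u v) = quot σ (Φ.1.mulVec u) (Φ.1.mulVec v) := by
  simp only [quot, map_div₀, map_mul, fracAct_algebraMap, linAct_linSub, linAct_lin]

theorem algebraMap_lin_ne_zero {v : Fin 2 → ℤ} (hv : v ≠ 0) : algebraMap PS Frac (lin v) ≠ 0 :=
  fun h => lin_ne_zero hv (algebraMap_injective (h.trans (map_zero _).symm))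

theorem quot_comm {σ : PS} (hσ : IsSymbol σ) (u v : Fin 2 → ℤ) : quot σ v u = quot σ u v := by
  rw [quot, quot, hσ.linSub_comm, mul_comm]

theorem quot_neg_right {σ : PS} (hσ : IsSymbol σ) (u v : Fin 2 → ℤ) :
    quot σ u (-v) = -quot σ u v := by
  rw [quot, quot, hσ.linSub_neg_right, lin_neg, map_neg, mul_neg, div_neg]

theorem quot_add {σ : PS} (hσ : IsSymbol σ) {u v : Fin 2 → ℤ} (huv : crs u v = 1) :
    quot σ u v = quot σ u (u + v) + quot σ (u + v) v := by
  have hu : u ≠ 0 := by rintro rfl; simp [crs] at huv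
  have hv : v ≠ 0 := by rintro rfl; simp [crs] at huv
  have hw : u + v ≠ 0 := by
    intro h
    rw [eq_neg_of_add_eq_zero_left h] at huv
    simp [crs, mul_comm] at huv
  have h := congrArg (algebraMap PS Frac) (hσ.linSub_rel u v)
  rw [← lin_add, hσ.linSub_comm v] at h
  simp only [map_mul, map_add] at h
  rw [quot, quot, quot]
  have := algebraMap_lin_ne_zero hu
  have := algebraMap_lin_ne_zero hv
  have := algebraMap_lin_ne_zero hw
  field_simp
  linear_combination h

/-- The cocycle `det(u, v) σ(u, v) / (u v)`. -/
theorem isFareyCocycle {σ : PS} (hσ : IsSymbol σ) :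
    IsFareyCocycle fun u v => (crs u v : Frac) * quot σ u v where
  neg_right u v := by
    have : crs u (-v) = -crs u v := by simp [crs]; ring
    rw [this, hσ.quot_neg_right]; push_cast; ring
  swap u v := by
    have : crs v u = -crs u v := by simp [crs]; ring
    rw [this, hσ.quot_comm]; push_cast; ring
  add u v huv := by
    have h1 : crs u (u + v) = 1 := by rw [← huv]; simp [crs]; ring
    have h2 : crs (u + v) v = 1 := by rw [← huv]; simp [crs]; ring
    rw [huv, h1, h2, hσ.quot_add huv]; push_cast; ring

/-- A potential `φ` of the cocycle is equivariant up to constants, because the Farey graph is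
connected. Therefore the sum over the edges of a polygon with coefficients `φ` is equivariant. -/
theorem exists_valuation {σ f : PS} (hσ : IsSymbol σ)
    (hf : IsTriangleSeries (linSub ![1, 0] ![1, 1] σ) f) :
    ∃ Z, IsEquivariantValuation Z ∧ Z origin = 0 ∧ Z unitSegment = 0 ∧ Z stdTriangle = f := by
  obtain ⟨φ, heven, hφ⟩ := hσ.isFareyCocycle.exists_potential
  -- both `φ ∘ Φ` and the image of `φ` are potentials of the same cocycle, up to the sign of `det Φ`
  have hconst : ∀ (Φ : Matrix.GeneralLinearGroup (Fin 2) ℤ), ∀ d ∈ primitive,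
      φ (Φ.1.mulVec d) - Φ.1.det * fracAct Φ (φ d) =
        φ (Φ.1.mulVec ![1, 0]) - Φ.1.det * fracAct Φ (φ ![1, 0]) := by
    intro Φ d hd
    refine eq_of_crs_eq_one (δ := fun d => φ (Φ.1.mulVec d) - Φ.1.det * fracAct Φ (φ d)) ?_ hd
    intro a b hab
    have h1 := congrArg (fracAct Φ) (hφ a b hab)
    simp only [map_sub, map_mul, map_intCast, fracAct_quot] at h1
    have h2 : φ (Φ.1.mulVec b) - φ (Φ.1.mulVec a) =
        Φ.1.det * quot σ (Φ.1.mulVec a) (Φ.1.mulVec b) := by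
      have hcrs := crs_mulVec Φ a b
      rw [hab, mul_one] at hcrs
      rcases det_eq_one_or Φ with h | h
      · rw [hφ _ _ (hcrs.trans h), hcrs]
      · have : crs (Φ.1.mulVec b) (Φ.1.mulVec a) = 1 := by
          have e : ∀ u v, crs v u = -crs u v := by intro u v; simp [crs]; ring
          rw [e, hcrs, h]; rfl
        rw [← neg_sub, hφ _ _ this, this, h, hσ.quot_comm]; push_cast; ring
    rw [hab, Int.cast_one, one_mul] at h1
    linear_combination Φ.1.det * h1 - h2
  refine exists_equivariantValuation (isVal_loopSum φ) (loopSum_equivariant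
    (κ := fun Φ => φ (Φ.1.mulVec ![1, 0]) - Φ.1.det * fracAct Φ (φ ![1, 0])) ?_) ?_ ?_ ?_
  · intro Φ d hd
    rw [← hconst Φ d hd, add_sub_cancel]
    rcases det_eq_one_or Φ with h | h
    · rw [h, one_smul]
    · rw [h, neg_one_smul, heven]
  · rw [loopSum_origin, map_zero]
  · rw [loopSum_unitSegment, show (![-1, 0] : Fin 2 → ℤ) = -![1, 0] by decide, heven, sub_self,
      zero_mul, map_zero]
  · have h1 := hφ ![1, 0] ![0, 1] (by decide)
    have h2 := hφ ![0, 1] ![-1, 1] (by decide)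
    rw [show crs ![1, 0] ![0, 1] = 1 by decide, Int.cast_one, one_mul] at h1
    rw [show crs ![0, 1] ![-1, 1] = 1 by decide, Int.cast_one, one_mul, hσ.quot_comm] at h2
    rw [isTriangleSeries_iff] at hf
    have h3 := congrArg (algebraMap PS Frac) hf
    have h4 := congrArg (algebraMap PS Frac) (lin_mul_expQuot ![1, 0])
    have h5 := congrArg (algebraMap PS Frac) (lin_mul_expQuot ![-1, 1])
    have h6 : expV ![0, 1] = expV ![1, 0] * expV ![-1, 1] := by rw [← expV_add]; simp
    have n1 := algebraMap_lin_ne_zero (v := ![1, 0]) (by decide)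
    have n2 := algebraMap_lin_ne_zero (v := ![0, 1]) (by decide)
    have n3 := algebraMap_lin_ne_zero (v := ![-1, 1]) (by decide)
    simp only [map_mul, map_sub, map_one] at h3 h4 h5
    rw [loopSum_stdTriangle, show (![0, -1] : Fin 2 → ℤ) = -![0, 1] by decide, heven,
      eq_add_of_sub_eq h2, eq_add_of_sub_eq h1, h6]
    have h7 := div_mul_cancel₀ (algebraMap PS Frac (linSub ![-1, 1] ![0, 1] σ)) (mul_ne_zero n3 n2)
    have h8 := div_mul_cancel₀ (algebraMap PS Frac (linSub ![1, 0] ![0, 1] σ)) (mul_ne_zero n1 n2)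
    change quot σ ![-1, 1] ![0, 1] * _ = _ at h7
    change quot σ ![1, 0] ![0, 1] * _ = _ at h8
    rw [linSub_id] at h8
    rw [y_eq_lin] at h3
    simp only [map_mul, map_sub, map_one]
    apply mul_left_cancel₀ n2
    linear_combination
      algebraMap PS Frac (lin ![0, 1]) * quot σ ![1, 0] ![0, 1] * h4 -
      algebraMap PS Frac (lin ![0, 1]) * quot σ ![-1, 1] ![0, 1] *
        algebraMap PS Frac (expV ![1, 0]) * h5 +
      algebraMap PS Frac (expV ![1, 0]) * algebraMap PS Frac (linSub1 ![-1, 1] expQuot) * h7 -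
      algebraMap PS Frac (linSub1 ![1, 0] expQuot) * h8 - h3

end IsSymbol

/-! ### Admissible power series and simple valuations -/

theorem Admissible.exists_isSymbol {ϱ : PS} (hϱ : Admissible ϱ) :
    ∃ σ, IsSymbol σ ∧ ϱ = linSub ![1, 0] ![1, 1] σ := by
  refine ⟨linSub ![1, 0] ![-1, 1] ϱ, ?_, (linSub_shear_cancel ϱ).symm⟩
  rw [← admissible_iff, linSub_shear_cancel]
  exact hϱ

theorem Admissible.eq_of_isTriangleSeries {ϱ ϱ' f : PS} (hϱ : Admissible ϱ) (hϱ' : Admissible ϱ')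
    (h : IsTriangleSeries ϱ f) (h' : IsTriangleSeries ϱ' f) : ϱ = ϱ' := by
  obtain ⟨σ, hσ, rfl⟩ := hϱ.exists_isSymbol
  obtain ⟨τ, hτ, rfl⟩ := hϱ'.exists_isSymbol
  rw [hσ.eq_of_isTriangleSeries hτ h h']

theorem IsTriangleSeries.eq {ϱ f f' : PS} (h : IsTriangleSeries ϱ f)
    (h' : IsTriangleSeries ϱ f') : f = f' :=
  mul_left_cancel₀ (y_eq_lin ▸ lin_ne_zero (v := ![0, 1]) (by decide) : y ≠ 0)
    (Eq.trans h (Eq.symm h'))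

theorem IsEquivariantValuation.exists_admissible {Z : LatticePolytope → PS}
    (hZ : IsEquivariantValuation Z) (h1 : Z unitSegment = 0) :
    ∃ ϱ, Admissible ϱ ∧ IsTriangleSeries ϱ (Z stdTriangle) := by
  obtain ⟨σ, hσ, hf⟩ := hZ.exists_isSymbol h1
  exact ⟨_, (admissible_iff σ).mpr hσ, hf⟩

theorem Admissible.exists_valuation {ϱ : PS} (hϱ : Admissible ϱ) :
    ∃ Z, IsEquivariantValuation Z ∧ Z origin = 0 ∧ Z unitSegment = 0 ∧
      IsTriangleSeries ϱ (Z stdTriangle) := by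
  obtain ⟨σ, hσ, rfl⟩ := hϱ.exists_isSymbol
  obtain ⟨f, hf⟩ := hσ.exists_isTriangleSeries
  obtain ⟨Z, hZ, h0, h1, rfl⟩ := hσ.exists_valuation hf
  exact ⟨Z, hZ, h0, h1, hf⟩

theorem IsEquivariantValuation.ext {Z Z' : LatticePolytope → PS} (hZ : IsEquivariantValuation Z)
    (hZ' : IsEquivariantValuation Z') (h0 : Z origin = Z' origin)
    (h1 : Z unitSegment = Z' unitSegment) (h2 : Z stdTriangle = Z' stdTriangle) : Z = Z' := by
  funext P
  exact sub_eq_zero.mp ((hZ.sub hZ').eq_zero (sub_eq_zero.mpr h0) (sub_eq_zero.mpr h1)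
    (sub_eq_zero.mpr h2) P)

end LatticeVal

end

theorem mainTheorem1 :
    -- every equivariant valuation has the stated form
    (∀ Z : LatticeVal.LatticePolytope → LatticeVal.PS, LatticeVal.IsEquivariantValuation Z →
      ∃ (c : ℚ) (g : PowerSeries ℚ) (ϱ f₂ : LatticeVal.PS),
        Z LatticeVal.origin = MvPowerSeries.C c ∧
        Z LatticeVal.unitSegment = LatticeVal.segmentSeries g ∧
        LatticeVal.Admissible ϱ ∧
        LatticeVal.IsTriangleSeries ϱ f₂ ∧
        Z LatticeVal.stdTriangle =
          f₂ + LatticeVal.boundaryPart (Z LatticeVal.unitSegment) ∧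
        ∃ Z₁ Z₂ : LatticeVal.LatticePolytope → LatticeVal.PS,
          LatticeVal.IsEquivariantValuation Z₁ ∧ LatticeVal.IsEquivariantValuation Z₂ ∧
          Z = Z₁ + Z₂ ∧
          Z₁ LatticeVal.origin = Z LatticeVal.origin ∧
          Z₁ LatticeVal.unitSegment = Z LatticeVal.unitSegment ∧
          Z₁ LatticeVal.stdTriangle = LatticeVal.boundaryPart (Z LatticeVal.unitSegment) ∧
          LatticeVal.IsSimple Z₂ ∧ Z₂ LatticeVal.stdTriangle = f₂) ∧
    -- every choice of the data arises from an equivariant valuation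
    (∀ (c : ℚ) (g : PowerSeries ℚ) (ϱ : LatticeVal.PS), LatticeVal.Admissible ϱ →
      ∃ f₂ : LatticeVal.PS, LatticeVal.IsTriangleSeries ϱ f₂ ∧
        ∃ Z : LatticeVal.LatticePolytope → LatticeVal.PS,
          LatticeVal.IsEquivariantValuation Z ∧
          Z LatticeVal.origin = MvPowerSeries.C c ∧
          Z LatticeVal.unitSegment = LatticeVal.segmentSeries g ∧
          Z LatticeVal.stdTriangle =
            f₂ + LatticeVal.boundaryPart (LatticeVal.segmentSeries g)) ∧
    -- simple equivariant valuations correspond bijectively to the admissible power series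
    (∀ Z : LatticeVal.LatticePolytope → LatticeVal.PS,
      LatticeVal.IsEquivariantValuation Z → LatticeVal.IsSimple Z →
      ∃! ϱ : LatticeVal.PS,
        LatticeVal.Admissible ϱ ∧ LatticeVal.IsTriangleSeries ϱ (Z LatticeVal.stdTriangle)) ∧
    (∀ ϱ : LatticeVal.PS, LatticeVal.Admissible ϱ →
      ∃! Z : LatticeVal.LatticePolytope → LatticeVal.PS,
        LatticeVal.IsEquivariantValuation Z ∧ LatticeVal.IsSimple Z ∧
        LatticeVal.IsTriangleSeries ϱ (Z LatticeVal.stdTriangle)) := by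
  refine ⟨?_, ?_, ?_, ?_⟩
  · intro Z hZ
    obtain ⟨c, h0⟩ := hZ.exists_origin_eq
    obtain ⟨h, hh, h1⟩ := hZ.exists_unitSegment_eq
    obtain ⟨g, rfl⟩ := hh.exists_eq
    obtain ⟨Z₁, hZ₁, e0, e1, e2⟩ := hh.exists_valuation_origin c
    -- `Z - Z₁` vanishes on points and segments, hence it is simple
    have hZ₂ := hZ.sub hZ₁
    have z0 : (Z - Z₁) LatticeVal.origin = 0 := by rw [Pi.sub_apply, h0, e0, sub_self]
    have z1 : (Z - Z₁) LatticeVal.unitSegment = 0 := by rw [Pi.sub_apply, h1, e1, sub_self]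
    obtain ⟨ϱ, hϱ, hf⟩ := hZ₂.exists_admissible z1
    refine ⟨c, g, ϱ, (Z - Z₁) LatticeVal.stdTriangle, h0,
      h1.trans (LatticeVal.segmentSeries_eq g).symm, hϱ, hf, ?_,
      Z₁, Z - Z₁, hZ₁, hZ₂, (add_sub_cancel _ _).symm, e0.trans h0.symm, e1.trans h1.symm, ?_,
      hZ₂.isSimple_iff.mpr ⟨z0, z1⟩, rfl⟩
    · rw [h1, ← e2, Pi.sub_apply, sub_add_cancel]
    · rw [h1, e2]
  · intro c g ϱ hϱ
    obtain ⟨Z₁, hZ₁, e0, e1, e2⟩ :=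
      (LatticeVal.isSegmentSymm_segmentSeries1 g).exists_valuation_origin c
    obtain ⟨Z₂, hZ₂, z0, z1, hf⟩ := hϱ.exists_valuation
    refine ⟨Z₂ LatticeVal.stdTriangle, hf, Z₂ + Z₁, hZ₂.add hZ₁, ?_, ?_, ?_⟩
    · rw [Pi.add_apply, z0, e0, zero_add]
    · rw [Pi.add_apply, z1, e1, zero_add, LatticeVal.segmentSeries_eq]
    · rw [Pi.add_apply, e2, LatticeVal.segmentSeries_eq]
  · intro Z hZ hs
    obtain ⟨ϱ, hϱ, hf⟩ := hZ.exists_admissible (hZ.isSimple_iff.mp hs).2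
    exact ⟨ϱ, ⟨hϱ, hf⟩, fun ϱ' h => h.1.eq_of_isTriangleSeries hϱ h.2 hf⟩
  · intro ϱ hϱ
    obtain ⟨Z, hZ, z0, z1, hf⟩ := hϱ.exists_valuation
    refine ⟨Z, ⟨hZ, hZ.isSimple_iff.mpr ⟨z0, z1⟩, hf⟩, ?_⟩
    rintro Z' ⟨hZ', hs', hf'⟩
    obtain ⟨z0', z1'⟩ := hZ'.isSimple_iff.mp hs'
    exact hZ'.ext hZ (z0'.trans z0.symm) (z1'.trans z1.symm) (hf'.eq hf)
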